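/- Let $G$ be a simply connected nilpotent real Lie group of dimension $6$ with Lie algebra $\mathfrak g$, let $\Gamma\subset G$ be a discrete subgroup such that $M=\Gamma\backslash G$ is compact (so that $M$ is a $6$-dimensional nilmanifold). For a Hermitian structure $(J,g)$ on $M$, that is, an integrable almost complex structure $J$ and a Riemannian metric $g$ for which $J$ is orthogonal, let $\Omega(X,Y)=g(JX,Y)$ be the fundamental $2$-form. The structure is called SKT (strong KT) if $dJd\Omega=0$ (equivalently $\partial\bar\partial\Omega=0$) and $d\Omega\neq0$, and it is called invariant if $J$ and $g$ are induced by left-invariant tensors on $G$. Then $M$ admits an invariant SKT structure if and only if $\mathfrak g$ is isomorphic to one of the four Lie algebras $$(0,0,0,0,13+42,14+23),\quad (0,0,0,0,12,14+23),\quad (0,0,0,0,12,34),\quad (0,0,0,0,0,12).$$ Here $(0,0,0,0,\beta,\gamma)$ is the real Lie algebra with a basis whose dual basis $(e^i)$ satisfies $de^1=de^2=de^3=de^4=0$, $de^5=\beta$, $de^6=\gamma$, where $ij$ stands for $e^i\wedge e^j$ and $d\alpha(x,y)=-\alpha([x,y])$. In particular, if $M$ admits an invariant SKT structure, then $\mathfrak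 g$ is $2$-step nilpotent, and its first Betti number $b_1(\mathfrak g)=\dim\{\alpha\in\mathfrak g^*: d\alpha=0\}$ equals the first Betti number $b_1(M)=\dim H^1(M;\mathbb R)$ and is at least $4$. -/

import Mathlib

open scoped Manifold ContDiff

noncomputable section

/-! ### Lie algebras given by structure equations -/

/-- The value on `(x, y)` of the 2-form `∑ e^i ∧ e^j`, the sum being over the pairs `(i, j)` in the
list `β`. Indices start at `0`, so the form written `13 + 42` is the list `[(0, 2), (3, 1)]`. -/
def twoForm (β : List (Fin 4 × Fin 4)) (x y : Fin 6 → ℝ) : ℝ :=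
  (β.map fun p =>
    x (p.1.castLE (by decide)) * y (p.2.castLE (by decide)) -
      x (p.2.castLE (by decide)) * y (p.1.castLE (by decide))).sum

theorem twoForm_add_left (β : List (Fin 4 × Fin 4)) (x y z : Fin 6 → ℝ) :
    twoForm β (x + y) z = twoForm β x z + twoForm β y z := by
  induction β with
  | nil => simp [twoForm]
  | cons p β ih =>
    simp only [twoForm, List.map_cons, List.sum_cons, Pi.add_apply] at ih ⊢
    rw [ih]; ring

theorem twoForm_swap (β : List (Fin 4 × Fin 4)) (x y : Fin 6 → ℝ) :
    twoForm β y x = -twoForm β x y := by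
  induction β with
  | nil => simp [twoForm]
  | cons p β ih =>
    simp only [twoForm, List.map_cons, List.sum_cons] at ih ⊢
    rw [ih]; ring

theorem twoForm_smul_left (β : List (Fin 4 × Fin 4)) (c : ℝ) (x y : Fin 6 → ℝ) :
    twoForm β (c • x) y = c * twoForm β x y := by
  induction β with
  | nil => simp [twoForm]
  | cons p β ih =>
    simp only [twoForm, List.map_cons, List.sum_cons, Pi.smul_apply, smul_eq_mul] at ih ⊢
    rw [ih]; ring

theorem twoForm_eq_zero (β : List (Fin 4 × Fin 4)) (x y : Fin 6 → ℝ)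
    (h : ∀ i : Fin 4, x (i.castLE (by decide)) = 0) : twoForm β x y = 0 := by
  induction β with
  | nil => simp [twoForm]
  | cons p β ih =>
    simp only [twoForm, List.map_cons, List.sum_cons] at ih ⊢
    rw [ih, h, h]; ring

/-- The real Lie algebra `(0, 0, 0, 0, β, γ)`: it has a basis `e_1, …, e_6` whose dual basis
satisfies `de^1 = de^2 = de^3 = de^4 = 0`, `de^5 = β` and `de^6 = γ`, where
`dα(x, y) = -α([x, y])`. -/
def StrAlg (_β _γ : List (Fin 4 × Fin 4)) : Type := Fin 6 → ℝ

namespace StrAlg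

variable {β γ : List (Fin 4 × Fin 4)}

instance : AddCommGroup (StrAlg β γ) := inferInstanceAs (AddCommGroup (Fin 6 → ℝ))

instance : Module ℝ (StrAlg β γ) := inferInstanceAs (Module ℝ (Fin 6 → ℝ))

/-- The bracket dual to the structure equations. -/
def br (β γ : List (Fin 4 × Fin 4)) (x y : Fin 6 → ℝ) : Fin 6 → ℝ :=
  ![0, 0, 0, 0, -twoForm β x y, -twoForm γ x y]

theorem br_add_left (x y z : Fin 6 → ℝ) : br β γ (x + y) z = br β γ x z + br β γ y z := by
  ext i; fin_cases i <;> simp [br, twoForm_add_left, add_comm]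

theorem br_swap (x y : Fin 6 → ℝ) : br β γ y x = -br β γ x y := by
  ext i; fin_cases i <;> simp [br, twoForm_swap _ x y]

theorem br_smul_left (c : ℝ) (x y : Fin 6 → ℝ) : br β γ (c • x) y = c • br β γ x y := by
  ext i; fin_cases i <;> simp [br, twoForm_smul_left]

theorem br_br_left (x y z : Fin 6 → ℝ) : br β γ (br β γ x y) z = 0 := by
  have h : ∀ i : Fin 4, br β γ x y (i.castLE (by decide)) = 0 := by
    intro i; fin_cases i <;> rfl
  ext i; fin_cases i <;> simp [br] <;> exact twoForm_eq_zero _ _ z h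

theorem br_br_right (x y z : Fin 6 → ℝ) : br β γ x (br β γ y z) = 0 := by
  rw [br_swap, br_br_left, neg_zero]

theorem br_add_right (x y z : Fin 6 → ℝ) : br β γ x (y + z) = br β γ x y + br β γ x z := by
  rw [br_swap, br_add_left, br_swap x y, br_swap x z, neg_add, neg_neg, neg_neg]

theorem br_self (x : Fin 6 → ℝ) : br β γ x x = 0 := self_eq_neg.mp (br_swap x x)

theorem br_leibniz (x y z : Fin 6 → ℝ) :
    br β γ x (br β γ y z) = br β γ (br β γ x y) z + br β γ y (br β γ x z) := by
  rw [br_br_right, br_br_left, br_br_right, add_zero]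

theorem br_smul_right (c : ℝ) (x y : Fin 6 → ℝ) : br β γ x (c • y) = c • br β γ x y := by
  rw [br_swap, br_smul_left, br_swap x y, smul_neg, neg_neg]

instance : LieRing (StrAlg β γ) where
  bracket x y := br β γ x y
  add_lie x y z := br_add_left x y z
  lie_add x y z := br_add_right x y z
  lie_self x := br_self x
  leibniz_lie x y z := br_leibniz x y z

instance : LieAlgebra ℝ (StrAlg β γ) where
  lie_smul c x y := br_smul_right c x y

end StrAlg

/-- The Lie algebra `L` is isomorphic to one of `(0,0,0,0,13+42,14+23)`, `(0,0,0,0,12,14+23)`,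
`(0,0,0,0,12,34)`, `(0,0,0,0,0,12)`. -/
def IsOneOfFour (L : Type*) [LieRing L] [LieAlgebra ℝ L] : Prop :=
  Nonempty (L ≃ₗ⁅ℝ⁆ StrAlg [(0, 2), (3, 1)] [(0, 3), (1, 2)]) ∨
  Nonempty (L ≃ₗ⁅ℝ⁆ StrAlg [(0, 1)] [(0, 3), (1, 2)]) ∨
  Nonempty (L ≃ₗ⁅ℝ⁆ StrAlg [(0, 1)] [(2, 3)]) ∨
  Nonempty (L ≃ₗ⁅ℝ⁆ StrAlg [] [(0, 1)])

/-- `L` is 2-step nilpotent: in the descending central series `L^0 = L`, `L^(i+1) = [L^i, L]` one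
has `L^2 = 0` and `L^1 ≠ 0`. -/
def IsTwoStep (L : Type*) [LieRing L] [LieAlgebra ℝ L] : Prop :=
  LieModule.lowerCentralSeries ℝ L L 2 = ⊥ ∧ LieModule.lowerCentralSeries ℝ L L 1 ≠ ⊥

/-- The closed 1-forms of a Lie algebra: the kernel of `(dα)(x, y) = -α([x, y])`. -/
def lieClosedOneForms (L : Type*) [LieRing L] [LieAlgebra ℝ L] :
    Submodule ℝ (Module.Dual ℝ L) where
  carrier := {α | ∀ x y : L, α ⁅x, y⁆ = 0}
  add_mem' := fun ha hb x y => by simp [ha x y, hb x y]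
  zero_mem' := fun _ _ => rfl
  smul_mem' := fun c _ ha x y => by simp [ha x y]

/-- The first Betti number `b₁(L) = dim H¹(L; ℝ)`. The exact 1-forms of a Lie algebra vanish. -/
def lieBettiOne (L : Type*) [LieRing L] [LieAlgebra ℝ L] : ℕ :=
  Module.finrank ℝ (lieClosedOneForms L)

/-! ### Differential forms on manifolds -/

section Forms

variable {E : Type*} [NormedAddCommGroup E] [NormedSpace ℝ E]
  {M : Type*} [TopologicalSpace M] [ChartedSpace E M]

variable (E M) in
/-- Fields of alternating `k`-linear forms on the tangent spaces of `M`. -/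
abbrev FormField (k : ℕ) : Type _ :=
  ∀ x : M, TangentSpace 𝓘(ℝ, E) x [⋀^Fin k]→L[ℝ] ℝ

variable (E M) in
/-- Vector fields on `M`. -/
abbrev VecField : Type _ := ∀ x : M, TangentSpace 𝓘(ℝ, E) x

/-- The vector field `X` is smooth. -/
def VecField.Smooth [IsManifold 𝓘(ℝ, E) ∞ M] (X : VecField E M) : Prop :=
  ContMDiff 𝓘(ℝ, E) 𝓘(ℝ, E).tangent ∞ fun x => (⟨x, X x⟩ : TangentBundle 𝓘(ℝ, E) M)

/-- The expression of a form in the preferred chart at `x`: its pullback by the inverse chart. -/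
def FormField.inChart {k : ℕ} (σ : FormField E M k) (x : M) (y : E) : E [⋀^Fin k]→L[ℝ] ℝ :=
  (σ ((extChartAt 𝓘(ℝ, E) x).symm y)).compContinuousLinearMap
    (mfderiv 𝓘(ℝ, E) 𝓘(ℝ, E) (extChartAt 𝓘(ℝ, E) x).symm y)

/-- A form is smooth if its expressions in charts are. -/
def FormField.Smooth {k : ℕ} (σ : FormField E M k) : Prop :=
  ∀ x : M, ContDiffOn ℝ ∞ (σ.inChart x) (extChartAt 𝓘(ℝ, E) x).target

/-- The exterior derivative of a form on `M`: at `x`, take the exterior derivative in `E` of the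
expression in the chart at `x`, and pull it back by the chart. -/
def FormField.d {k : ℕ} (σ : FormField E M k) : FormField E M (k + 1) := fun x =>
  (extDeriv (σ.inChart x) (extChartAt 𝓘(ℝ, E) x x)).compContinuousLinearMap
    (mfderiv 𝓘(ℝ, E) 𝓘(ℝ, E) (extChartAt 𝓘(ℝ, E) x) x)

theorem FormField.inChart_add {k : ℕ} (σ η : FormField E M k) (x : M) :
    (σ + η).inChart x = σ.inChart x + η.inChart x := rfl

theorem FormField.inChart_smul {k : ℕ} (c : ℝ) (σ : FormField E M k) (x : M) :
    (c • σ).inChart x = c • σ.inChart x := rfl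

theorem FormField.Smooth.differentiableAt {k : ℕ} {σ : FormField E M k} (h : σ.Smooth) (x : M) :
    DifferentiableAt ℝ (σ.inChart x) (extChartAt 𝓘(ℝ, E) x x) :=
  ((h x).contDiffAt (extChartAt_target_mem_nhds x)).differentiableAt (by simp)

variable (E M) in
/-- The space of smooth closed 1-forms on `M`. -/
def closedOneForms : Submodule ℝ (FormField E M 1) where
  carrier := {σ | σ.Smooth ∧ σ.d = 0}
  add_mem' := by
    rintro σ η ⟨hσ, dσ⟩ ⟨hη, dη⟩
    refine ⟨fun x => (hσ x).add (hη x), ?_⟩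
    ext x v
    have h1 := congrArg (fun α => α v) (congrFun dσ x)
    have h2 := congrArg (fun α => α v) (congrFun dη x)
    simp only [FormField.d, FormField.inChart_add,
      extDeriv_add (hσ.differentiableAt x) (hη.differentiableAt x)] at h1 h2 ⊢
    exact (congrArg₂ (· + ·) h1 h2).trans (add_zero _)
  zero_mem' := by
    have h : ∀ x : M, (0 : FormField E M 1).inChart x = 0 := fun _ => rfl
    refine ⟨fun x => by rw [h]; exact contDiffOn_const, ?_⟩
    ext x v
    simp only [FormField.d, h]
    have : extDeriv (0 : E → E [⋀^Fin 1]→L[ℝ] ℝ) = 0 := by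
      ext1 y
      have := extDeriv_fun_smul (x := y) (0 : ℝ) (0 : E → E [⋀^Fin 1]→L[ℝ] ℝ)
      simpa using this
    rw [this]; rfl
  smul_mem' := by
    rintro c σ ⟨hσ, dσ⟩
    refine ⟨fun x => (hσ x).const_smul c, ?_⟩
    ext x v
    have h1 := congrArg (fun α => α v) (congrFun dσ x)
    simp only [FormField.d, FormField.inChart_smul, extDeriv_smul] at h1 ⊢
    exact (congrArg (c * ·) h1).trans (mul_zero _)

variable (E M) in
/-- The space of exact 1-forms `df`, for `f` a smooth function on `M`. -/
def exactOneForms : Submodule ℝ (FormField E M 1) where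
  carrier := {σ | ∃ f : M → ℝ, ContMDiff 𝓘(ℝ, E) 𝓘(ℝ, ℝ) ∞ f ∧
    ∀ x v, σ x v = mfderiv 𝓘(ℝ, E) 𝓘(ℝ, ℝ) f x (v 0)}
  add_mem' := by
    rintro σ η ⟨f, hf, h1⟩ ⟨g, hg, h2⟩
    refine ⟨f + g, hf.add hg, fun x v => ?_⟩
    rw [mfderiv_add (hf.mdifferentiable (by simp) x) (hg.mdifferentiable (by simp) x)]
    exact congrArg₂ (· + ·) (h1 x v) (h2 x v)
  zero_mem' := ⟨fun _ => 0, contMDiff_const, fun x v => by rw [mfderiv_const]; rfl⟩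
  smul_mem' := by
    rintro c σ ⟨f, hf, h1⟩
    refine ⟨c • f, (contMDiff_const (c := c)).mul hf, fun x v => ?_⟩
    rw [const_smul_mfderiv (hf.mdifferentiable (by simp) x)]
    exact congrArg (c * ·) (h1 x v)

variable (E M) in
/-- The first Betti number of `M`, as the dimension (a cardinal) of the first de Rham cohomology
space `H¹(M; ℝ)`, the space of classes of closed 1-forms modulo exact ones. -/
def bettiOne : Cardinal :=
  Module.rank ℝ ((closedOneForms E M).map (exactOneForms E M).mkQ)

end Forms

/-! ### Hermitian manifolds and the strong KT condition -/

section Hermitian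

variable (E : Type*) [NormedAddCommGroup E] [NormedSpace ℝ E]
  (M : Type*) [TopologicalSpace M] [ChartedSpace E M] [IsManifold 𝓘(ℝ, E) ∞ M]

/-- A Hermitian structure `(J, g)` on the manifold `M`: a smooth integrable almost complex structure
`J` (one with vanishing Nijenhuis tensor) and a smooth Riemannian metric `g` for which `J` is
orthogonal. -/
structure HermitianStructure where
  J : ∀ x : M, TangentSpace 𝓘(ℝ, E) x →L[ℝ] TangentSpace 𝓘(ℝ, E) x
  g : ∀ x : M, TangentSpace 𝓘(ℝ, E) x →L[ℝ] TangentSpace 𝓘(ℝ, E) x →L[ℝ] ℝ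
  J_smooth : ∀ X : VecField E M, X.Smooth → VecField.Smooth fun x => J x (X x)
  J_J : ∀ x v, J x (J x v) = -v
  integrable : ∀ X Y : VecField E M, X.Smooth → Y.Smooth → ∀ x,
    VectorField.mlieBracket 𝓘(ℝ, E) (fun z => J z (X z)) (fun z => J z (Y z)) x
      - J x (VectorField.mlieBracket 𝓘(ℝ, E) (fun z => J z (X z)) Y x)
      - J x (VectorField.mlieBracket 𝓘(ℝ, E) X (fun z => J z (Y z)) x)
      - VectorField.mlieBracket 𝓘(ℝ, E) X Y x = 0
  g_smooth : ∀ X Y : VecField E M, X.Smooth → Y.Smooth →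
    ContMDiff 𝓘(ℝ, E) 𝓘(ℝ, ℝ) ∞ fun x => g x (X x) (Y x)
  g_symm : ∀ x v w, g x v w = g x w v
  g_pos : ∀ x v, v ≠ 0 → 0 < g x v v
  g_J : ∀ x v w, g x (J x v) (J x w) = g x v w

namespace HermitianStructure

variable {E M} (h : HermitianStructure E M)

theorem g_J_self (x : M) (v : TangentSpace 𝓘(ℝ, E) x) : h.g x (h.J x v) v = 0 := by
  have h1 := h.g_J x (h.J x v) v
  rw [h.J_J, h.g_symm x _ (h.J x v), map_neg] at h1
  linarith

/-- The fundamental 2-form `Ω(v, w) = g(Jv, w)`; equivalently `g(v, w) = Ω(v, Jw)`. -/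
def Ω : FormField E M 2 := fun x =>
  { toFun := fun v => h.g x (h.J x (v 0)) (v 1)
    map_update_add' := by
      intro _ m i a b
      fin_cases i <;> simp [Function.update]
    map_update_smul' := by
      intro _ m i c a
      fin_cases i <;> simp [Function.update]
    map_eq_zero_of_eq' := by
      intro v i j hv hij
      have h01 : v 0 = v 1 := by
        fin_cases i <;> fin_cases j <;> first | exact absurd rfl hij | exact hv | exact hv.symm
      change h.g x (h.J x (v 0)) (v 1) = 0
      rw [← h01]
      exact h.g_J_self x (v 0)
    cont := by
      change Continuous fun v : Fin 2 → TangentSpace 𝓘(ℝ, E) x => h.g x (h.J x (v 0)) (v 1)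
      have h1 : Continuous fun p : E × E =>
          (show E →L[ℝ] E →L[ℝ] ℝ from h.g x) ((show E →L[ℝ] E from h.J x) p.1) p.2 := by
        fun_prop
      exact h1.comp ((continuous_apply (0 : Fin 2)).prodMk (continuous_apply (1 : Fin 2)) :
        Continuous fun v : Fin 2 → E => (v 0, v 1)) }

theorem g_eq_Ω (x : M) (v w : TangentSpace 𝓘(ℝ, E) x) : h.g x v w = h.Ω x ![v, h.J x w] :=
  (h.g_J x v w).symm

/-- The action of `J` on `k`-forms, `(Jσ)(v₁, …, v_k) = σ(Jv₁, …, Jv_k)`. -/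
def onForms {k : ℕ} (σ : FormField E M k) : FormField E M k := fun x =>
  (σ x).compContinuousLinearMap (h.J x)

/-- The Hermitian structure is strong KT: `dJdΩ = 0` (that is, `∂∂̄Ω = 0`) but `dΩ ≠ 0`. -/
def IsSKT : Prop := (h.onForms h.Ω.d).d = 0 ∧ h.Ω.d ≠ 0

end HermitianStructure

end Hermitian

/-! ### Nilmanifolds and invariant structures -/

instance : ENat.LEInfty (minSmoothness ℝ 3) := ⟨by
  simp only [minSmoothness_of_isRCLikeNormedField]; exact ENat.LEInfty.out⟩

section Nilmanifold

variable {E : Type*} [NormedAddCommGroup E] [NormedSpace ℝ E]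
  {G : Type*} [TopologicalSpace G] [ChartedSpace E G] [Group G]
  {M : Type*} [TopologicalSpace M] [ChartedSpace E M]

variable (E) in
/-- The map `π : G → M` identifies the manifold `M` with the space `Γ \ G` of cosets `Γ a`: it is a
surjective local diffeomorphism whose fibres are these cosets. -/
structure IsCosetProjection (Γ : Subgroup G) (π : G → M) : Prop where
  isLocalDiffeomorph : IsLocalDiffeomorph 𝓘(ℝ, E) 𝓘(ℝ, E) ∞ π
  surjective : Function.Surjective π
  eq_iff : ∀ a b : G, π a = π b ↔ ∃ γ ∈ Γ, b = γ * a

/-- The image in `T_{π(a)} M` of the value at `a` of the left-invariant vector field on `G` given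
by `v`. -/
def pushInvariant (π : G → M) (v : GroupLieAlgebra 𝓘(ℝ, E) G) (a : G) :
    TangentSpace 𝓘(ℝ, E) (π a) :=
  mfderiv 𝓘(ℝ, E) 𝓘(ℝ, E) π a (mulInvariantVectorField v a)

/-- The Hermitian structure `(J, g)` on `M = Γ \ G` is invariant: `J` and `g` are induced by
left-invariant tensors on `G`, that is, by an endomorphism `J₀` and a bilinear form `g₀` of the Lie
algebra of `G` (linearity of `J₀` and `g₀` is automatic, as `v ↦ pushInvariant π v a` is a linear
isomorphism). -/
def HermitianStructure.IsInvariant [IsManifold 𝓘(ℝ, E) ∞ M] (h : HermitianStructure E M) (π : G → M) : Prop :=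
  (∃ J₀ : GroupLieAlgebra 𝓘(ℝ, E) G → GroupLieAlgebra 𝓘(ℝ, E) G, ∀ (a : G) v,
    h.J (π a) (pushInvariant π v a) = pushInvariant π (J₀ v) a) ∧
  (∃ g₀ : GroupLieAlgebra 𝓘(ℝ, E) G → GroupLieAlgebra 𝓘(ℝ, E) G → ℝ, ∀ (a : G) v w,
    h.g (π a) (pushInvariant π v a) (pushInvariant π w a) = g₀ v w)

variable (E) in
/-- `M = Γ \ G`, with projection `π`, admits an invariant strong KT structure. -/
def AdmitsInvariantSKT [IsManifold 𝓘(ℝ, E) ∞ M] (π : G → M) : Prop :=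
  ∃ h : HermitianStructure E M, h.IsInvariant π ∧ h.IsSKT

end Nilmanifold

end

open scoped Topology
open Filter

noncomputable section

/-! ### Smoothness of maps with values in alternating forms -/

section AlternatingSmooth

variable {E : Type*} [NormedAddCommGroup E] [NormedSpace ℝ E] [FiniteDimensional ℝ E]
  {E' : Type*} [NormedAddCommGroup E'] [NormedSpace ℝ E'] {k : ℕ}

/-! Write 𝔤 for the Lie algebra of G. Two independent arguments are joined: one reduces invariant
SKT structures to linear algebra on 𝔤 and classifies them there, the other computes H¹(M).

Reduction. An invariant tensor has constant coefficients in the frame of left-invariant fields.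
Hence d of an invariant form is the Chevalley–Eilenberg differential, the Nijenhuis tensor is the
algebraic one, and M admits an invariant SKT structure iff 𝔤 carries a pair (J, g) with `IsLieSKT`
(`exists_isLieSKT_of_admits`, `admits_of_isLieSKT`). Explicit pairs on the four algebras give
existence.

Classification. If J is integrable on a nilpotent algebra, [K, K] + J[K, K] is proper in every
nonzero J-invariant subalgebra K (`exists_orthogonal`). This yields an orthonormal basis X, JX, Y,
JY, Z, JZ with [𝔤, 𝔤] ⊂ H = {X, JX}^⊥, [H, H] ⊂ C = ⟨Z, JZ⟩ and [C, C] = 0. On a complex line,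
commuting nilpotent actions of A and JA that satisfy the integrability relation vanish
(`lie_mem_of_pair`); so C is central in H. If [Y, JY] = 0, then H is abelian, and tracing the SKT
equation against J gives |ad X|² + |ad JX|² = 0 on H (`eq_zero_of_integrable_skt`). Thus H is
central and [X, JX] is the only bracket, which is (0,0,0,0,0,12). If w = [Y, JY] ≠ 0, then C = ⟨w,
Jw⟩ is central in 𝔤, and SKT forces all brackets into C. What remains of SKT is one scalar equation:
after a change of basis it writes the coefficient t of w in [x₁, x₂] as half a sum of squares of the
coefficients of the mixed brackets [xᵢ, yⱼ]. Either t > 0 can be scaled to 1, and 𝔤 is the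
Heisenberg algebra over ℝ[ε]/(ε² = κ), the sign of κ selecting one of the first three algebras; or
the mixed brackets vanish and 𝔤 is (0,0,0,0,12,34) or (0,0,0,0,0,12). Being 2-step with b₁ ≥ 4 is
then read off.

Betti numbers. Let 𝔤 be 2-step nilpotent. Integrating dΦ(v) = v + ½[Φ, v] gives a logarithm Φ : G →
𝔤 with the Baker–Campbell–Hausdorff product (`exists_log`, `log_mul`). A closed 1-form on M pulls
back to dF on the simply connected group G, with F(γx) = F(γ) + F(x) for γ ∈ Γ. As M is compact, F
is a quasimorphism, and its homogenization is a homomorphism φ equal to F on Γ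
(`exists_hom_of_equivariant`). Such a φ is ℓ ∘ Φ with ℓ linear and zero on brackets
(`hom_eq_comp_log`), and F − ℓ ∘ Φ descends to M, so the form is cohomologous to the invariant form
ℓ. An exact invariant form vanishes at a maximum of its primitive, hence everywhere. -/

theorem exists_alternating_coordinates (E : Type*) [NormedAddCommGroup E] [NormedSpace ℝ E]
    [FiniteDimensional ℝ E] (k : ℕ) :
    ∃ (ι : Type) (_ : Fintype ι) (p : ι → Fin k → E) (A : ι → E [⋀^Fin k]→L[ℝ] ℝ),
      ∀ T : E [⋀^Fin k]→L[ℝ] ℝ, T = ∑ r, T (p r) • A r := by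
  let b := Module.finBasis ℝ E
  let ι := Fin k → Fin (Module.finrank ℝ E)
  let ev : (E [⋀^Fin k]→L[ℝ] ℝ) →ₗ[ℝ] (ι → ℝ) :=
    { toFun := fun T r => T fun i => b (r i)
      map_add' := fun _ _ => rfl
      map_smul' := fun _ _ => rfl }
  have hev : LinearMap.ker ev = ⊥ := by
    rw [LinearMap.ker_eq_bot]
    intro T T' h
    apply ContinuousAlternatingMap.toAlternatingMap_injective
    apply AlternatingMap.coe_multilinearMap_injective
    exact Module.Basis.ext_multilinear (fun _ => b) fun r => congrFun h r
  obtain ⟨L, hL⟩ := ev.exists_leftInverse_of_injective hev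
  classical
  refine ⟨ι, inferInstance, fun r i => b (r i), fun r => L (Pi.single r 1), fun T => ?_⟩
  have h1 : L (ev T) = T := LinearMap.congr_fun hL T
  have h2 : ev T = ∑ r, ev T r • Pi.single r (1 : ℝ) := by
    ext s
    rw [Finset.sum_apply, Finset.sum_eq_single s]
    · simp
    · intro r _ hr
      simp [Pi.single_eq_of_ne hr.symm]
    · simp
  rw [h2, map_sum] at h1
  simp only [map_smul] at h1
  exact h1.symm

/-- A form is a fixed linear combination of finitely many of its values, so smoothness can be tested
on constant vectors. -/
theorem contDiffAt_alternating {n : ℕ∞ω} {τ : E' → E [⋀^Fin k]→L[ℝ] ℝ} {y : E'}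
    (h : ∀ v, ContDiffAt ℝ n (fun z => τ z v) y) : ContDiffAt ℝ n τ y := by
  obtain ⟨ι, _, p, A, hA⟩ := exists_alternating_coordinates E k
  have : τ = fun z => ∑ r, τ z (p r) • A r := funext fun z => hA (τ z)
  rw [this]
  exact ContDiffAt.sum fun r _ => (h (p r)).smul contDiffAt_const

theorem ContDiffAt.alternating_apply {n : ℕ∞ω} {τ : E' → E [⋀^Fin k]→L[ℝ] ℝ} {y : E'}
    {w : Fin k → E' → E} (hτ : ContDiffAt ℝ n τ y) (hw : ∀ i, ContDiffAt ℝ n (w i) y) :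
    ContDiffAt ℝ n (fun z => τ z fun i => w i z) y := by
  obtain ⟨ι, _, p, A, hA⟩ := exists_alternating_coordinates E k
  have h1 : ∀ v : Fin k → E, ContDiffAt ℝ n (fun z => τ z v) y := by
    intro v
    have := (ContinuousAlternatingMap.apply ℝ E ℝ v).contDiff.contDiffAt.comp y hτ
    exact this
  have : (fun z => τ z fun i => w i z) = fun z => ∑ r, τ z (p r) * A r (fun i => w i z) := by
    ext z
    conv_lhs => rw [hA (τ z)]
    simp [ContinuousAlternatingMap.sum_apply]
  rw [this]
  refine ContDiffAt.sum fun r _ => (h1 (p r)).mul ?_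
  have h2 : ContDiffAt ℝ n (fun z i => w i z) y := contDiffAt_pi.2 hw
  exact ((A r).toContinuousMultilinearMap.contDiff.contDiffAt).comp y h2

end AlternatingSmooth

/-! ### Pullback of forms by parametrizations and naturality of the exterior derivative -/

section Pull

variable {E : Type*} [NormedAddCommGroup E] [NormedSpace ℝ E]
  {M : Type*} [TopologicalSpace M] [ChartedSpace E M] {k : ℕ}

/-- The pullback of a form on `M` by a map from the model space. -/
def FormField.pull (σ : FormField E M k) (Ψ : E → M) (y : E) : E [⋀^Fin k]→L[ℝ] ℝ :=
  (σ (Ψ y)).compContinuousLinearMap (mfderiv 𝓘(ℝ, E) 𝓘(ℝ, E) Ψ y)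

theorem FormField.pull_comp (σ : FormField E M k) {Ψ : E → M} {f : E → E} {y : E}
    (hΨ : MDifferentiableAt 𝓘(ℝ, E) 𝓘(ℝ, E) Ψ (f y)) (hf : DifferentiableAt ℝ f y) :
    σ.pull (Ψ ∘ f) y = (σ.pull Ψ (f y)).compContinuousLinearMap (fderiv ℝ f y) := by
  have h := mfderiv_comp y hΨ hf.mdifferentiableAt
  ext v
  simp only [FormField.pull]
  rw [h, mfderiv_eq_fderiv]
  rfl

theorem FormField.pull_congr (σ : FormField E M k) {Ψ Ψ' : E → M} {y : E}
    (h : Ψ =ᶠ[𝓝 y] Ψ') : σ.pull Ψ y = σ.pull Ψ' y := by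
  have h1 := h.mfderiv_eq (I := 𝓘(ℝ, E)) (I' := 𝓘(ℝ, E))
  have h0 := h.eq_of_nhds
  simp only [FormField.pull]
  have key : ∀ (a b : M) (_ : a = b) (A : E →L[ℝ] E) (B : E →L[ℝ] E) (_ : A = B),
    (show E [⋀^Fin k]→L[ℝ] ℝ from (σ a)).compContinuousLinearMap A =
    (show E [⋀^Fin k]→L[ℝ] ℝ from (σ b)).compContinuousLinearMap B := by
    rintro a _ rfl A _ rfl; rfl
  exact key _ _ h0 _ _ h1

theorem FormField.pull_eventuallyEq_comp (σ : FormField E M k) {Ψ Ψ' : E → M} {f : E → E} {y : E}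
    (h : Ψ' =ᶠ[𝓝 y] Ψ ∘ f)
    (hΨ : ∀ᶠ z in 𝓝 (f y), MDifferentiableAt 𝓘(ℝ, E) 𝓘(ℝ, E) Ψ z) (hf : ContDiffAt ℝ ∞ f y) :
    σ.pull Ψ' =ᶠ[𝓝 y] fun z => (σ.pull Ψ (f z)).compContinuousLinearMap (fderiv ℝ f z) := by
  have h1 : ∀ᶠ z in 𝓝 y, DifferentiableAt ℝ f z := by
    filter_upwards [(hf.of_le (m := 1) (by simp)).eventually (by simp)] with z hz
    exact hz.differentiableAt (by simp)
  filter_upwards [h.eventuallyEq_nhds, h1, hf.continuousAt.eventually hΨ] with z h2 h3 h4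
  rw [σ.pull_congr h2, σ.pull_comp h4 h3]

theorem FormField.contDiffAt_pull_of_comp [FiniteDimensional ℝ E] (σ : FormField E M k)
    {Ψ Ψ' : E → M} {f : E → E} {y : E} (h : Ψ' =ᶠ[𝓝 y] Ψ ∘ f)
    (hΨ : ∀ᶠ z in 𝓝 (f y), MDifferentiableAt 𝓘(ℝ, E) 𝓘(ℝ, E) Ψ z) (hf : ContDiffAt ℝ ∞ f y)
    (hσ : ContDiffAt ℝ ∞ (σ.pull Ψ) (f y)) : ContDiffAt ℝ ∞ (σ.pull Ψ') y := by
  refine ContDiffAt.congr_of_eventuallyEq ?_ (σ.pull_eventuallyEq_comp h hΨ hf)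
  refine contDiffAt_alternating fun v => ?_
  refine (hσ.comp y hf).alternating_apply (w := fun i z => fderiv ℝ f z (v i)) fun i => ?_
  exact (hf.fderiv_right (m := ∞) (by simp)).clm_apply contDiffAt_const

variable [IsManifold 𝓘(ℝ, E) ∞ M]

theorem eventually_mdifferentiableAt_extChartAt_symm {x : M} {y : E}
    (hy : y ∈ (extChartAt 𝓘(ℝ, E) x).target) :
    ∀ᶠ z in 𝓝 y, MDifferentiableAt 𝓘(ℝ, E) 𝓘(ℝ, E) (extChartAt 𝓘(ℝ, E) x).symm z := by
  filter_upwards [(isOpen_extChartAt_target x).mem_nhds hy] with z hz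
  exact ((contMDiffOn_extChartAt_symm (n := ∞) x).contMDiffAt
    ((isOpen_extChartAt_target x).mem_nhds hz)).mdifferentiableAt (by simp)

/-- `FormField.d` uses a different chart at each point; this is its independence of that choice.
Near y, Ψ is the inverse chart composed with the transition map, and the derivative in the model
space commutes with pullback by the latter. -/
theorem FormField.extDeriv_pull (σ : FormField E M k) {Ψ : E → M} {y : E}
    (hΨ : ContMDiffAt 𝓘(ℝ, E) 𝓘(ℝ, E) ∞ Ψ y)
    (hσ : DifferentiableAt ℝ (σ.inChart (Ψ y)) (extChartAt 𝓘(ℝ, E) (Ψ y) (Ψ y))) :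
    extDeriv (σ.pull Ψ) y = σ.d.pull Ψ y := by
  set ψ := extChartAt 𝓘(ℝ, E) (Ψ y)
  have hψ : ContMDiffAt 𝓘(ℝ, E) 𝓘(ℝ, E) ∞ ψ (Ψ y) := contMDiffAt_extChartAt
  have hf : ContDiffAt ℝ ∞ (ψ ∘ Ψ) y := (hψ.comp y hΨ).contDiffAt
  have h1 : Ψ =ᶠ[𝓝 y] ψ.symm ∘ (ψ ∘ Ψ) := by
    filter_upwards [hΨ.continuousAt.eventually (extChartAt_source_mem_nhds (I := 𝓘(ℝ, E)) (Ψ y))]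
      with z hz
    exact (ψ.left_inv hz).symm
  have h2 := σ.pull_eventuallyEq_comp h1
    (eventually_mdifferentiableAt_extChartAt_symm (mem_extChartAt_target (Ψ y))) hf
  rw [h2.extDeriv_eq]
  have hσ' : DifferentiableAt ℝ (σ.pull ψ.symm) ((ψ ∘ Ψ) y) := hσ
  have h3 := extDeriv_pullback (f := ψ ∘ Ψ) (x := y) (r := ∞) hσ' hf
    (by simp only [minSmoothness_of_isRCLikeNormedField]; exact ENat.LEInfty.out)
  rw [h3]
  ext v
  simp only [FormField.pull, FormField.d]
  rw [← mfderiv_eq_fderiv, mfderiv_comp y (hψ.mdifferentiableAt (by simp))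
    (hΨ.mdifferentiableAt (by simp))]
  rfl

end Pull

/-! ### Forms in a local frame with constant structure functions -/

section FrameChart

variable (E : Type*) [NormedAddCommGroup E] [NormedSpace ℝ E]
  (M : Type*) [TopologicalSpace M] [ChartedSpace E M]

/-- A local parametrization `Ψ` of `M`, defined on an open set `U` of the model space, together with
a frame `Θ` of vector fields on `U` whose Lie brackets are given by the structure map `br`. -/
structure FrameChart (br : E → E → E) where
  Ψ : E → M
  U : Set E
  Θ : E → E →L[ℝ] E
  isOpen : IsOpen U
  diffeo : ∀ y ∈ U, IsLocalDiffeomorphAt 𝓘(ℝ, E) 𝓘(ℝ, E) ∞ Ψ y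
  smooth : ∀ y ∈ U, ContDiffAt ℝ ∞ Θ y
  invertible : ∀ y ∈ U, (Θ y).IsInvertible
  lie : ∀ y ∈ U, ∀ v w, VectorField.lieBracket ℝ (fun z => Θ z v) (fun z => Θ z w) y = Θ y (br v w)

namespace FrameChart

variable {E M} {br : E → E → E} (F : FrameChart E M br)

/-- The frame transported to `M`. -/
def fr (y v : E) : TangentSpace 𝓘(ℝ, E) (F.Ψ y) :=
  mfderiv 𝓘(ℝ, E) 𝓘(ℝ, E) F.Ψ y (show TangentSpace 𝓘(ℝ, E) y from F.Θ y v)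

variable {F} {y : E}

theorem contMDiffAt (hy : y ∈ F.U) : ContMDiffAt 𝓘(ℝ, E) 𝓘(ℝ, E) ∞ F.Ψ y :=
  (F.diffeo y hy).contMDiffAt

theorem eventually_mdifferentiableAt (hy : y ∈ F.U) :
    ∀ᶠ z in 𝓝 y, MDifferentiableAt 𝓘(ℝ, E) 𝓘(ℝ, E) F.Ψ z := by
  filter_upwards [F.isOpen.mem_nhds hy] with z hz
  exact (contMDiffAt hz).mdifferentiableAt (by simp)

/-- The inverse of the frame. -/
def Θinv (F : FrameChart E M br) (y : E) : E →L[ℝ] E := (F.Θ y).inverse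

theorem Θinv_Θ (hy : y ∈ F.U) (v : E) : F.Θinv y (F.Θ y v) = v := by
  obtain ⟨e, he⟩ := F.invertible y hy
  simp [Θinv, ← he]

theorem Θ_Θinv (hy : y ∈ F.U) (v : E) : F.Θ y (F.Θinv y v) = v := by
  obtain ⟨e, he⟩ := F.invertible y hy
  simp [Θinv, ← he]

theorem contDiffAt_Θinv [CompleteSpace E] (hy : y ∈ F.U) : ContDiffAt ℝ ∞ F.Θinv y :=
  ((F.invertible y hy).contDiffAt_map_inverse (n := ∞)).comp y (F.smooth y hy)

/-- The derivative of the parametrization, as a continuous linear equivalence. -/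
def dΨ (hy : y ∈ F.U) : E ≃L[ℝ] TangentSpace 𝓘(ℝ, E) (F.Ψ y) :=
  (F.diffeo y hy).mfderivToContinuousLinearEquiv (by simp)

theorem exists_inverse (hy : y ∈ F.U) : ∃ f : M → E, ContMDiffAt 𝓘(ℝ, E) 𝓘(ℝ, E) ∞ f (F.Ψ y) ∧
    f (F.Ψ y) = y ∧ ∀ᶠ x in 𝓝 (F.Ψ y), F.Ψ (f x) = x := by
  have h := F.diffeo y hy
  refine ⟨h.localInverse, h.localInverse_contMDiffAt,
    h.localInverse_left_inv h.localInverse_mem_target, ?_⟩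
  exact h.localInverse_eventuallyEq_right

section Forms

variable [FiniteDimensional ℝ E] [CompleteSpace E] {k : ℕ} {σ : FormField E M k}
  {T : E → E [⋀^Fin k]→L[ℝ] ℝ}

theorem pull_eq (hy : y ∈ F.U) (hσ : ∀ v : Fin k → E, σ (F.Ψ y) (fun i => F.fr y (v i)) = T y v) :
    σ.pull F.Ψ y = (T y).compContinuousLinearMap (F.Θinv y) := by
  ext v
  have h := hσ fun i => F.Θinv y (v i)
  have h2 : ∀ i, F.fr y (F.Θinv y (v i)) =
      mfderiv 𝓘(ℝ, E) 𝓘(ℝ, E) F.Ψ y (show TangentSpace 𝓘(ℝ, E) y from v i) := fun i => by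
    rw [fr, Θ_Θinv hy]
  simp only [h2] at h
  exact h

theorem contDiffAt_pull (hT : ∀ y ∈ F.U, ContDiffAt ℝ ∞ T y)
    (hσ : ∀ y ∈ F.U, ∀ v : Fin k → E, σ (F.Ψ y) (fun i => F.fr y (v i)) = T y v) (hy : y ∈ F.U) :
    ContDiffAt ℝ ∞ (σ.pull F.Ψ) y := by
  have h : σ.pull F.Ψ =ᶠ[𝓝 y] fun z => (T z).compContinuousLinearMap (F.Θinv z) := by
    filter_upwards [F.isOpen.mem_nhds hy] with z hz
    exact pull_eq hz (hσ z hz)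
  refine ContDiffAt.congr_of_eventuallyEq ?_ h
  refine contDiffAt_alternating fun v => ?_
  exact (hT y hy).alternating_apply (w := fun i z => F.Θinv z (v i)) fun i =>
    (contDiffAt_Θinv hy).clm_apply contDiffAt_const

variable [IsManifold 𝓘(ℝ, E) ∞ M]

/-- A local inverse of Ψ followed by Ψ rewrites the chart expression as a smooth change of variables
of the frame expression, so smooth frame coefficients suffice. -/
theorem contDiffAt_inChart (hT : ∀ y ∈ F.U, ContDiffAt ℝ ∞ T y)
    (hσ : ∀ y ∈ F.U, ∀ v : Fin k → E, σ (F.Ψ y) (fun i => F.fr y (v i)) = T y v) (hy : y ∈ F.U)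
    {x : M} {z : E} (hz : z ∈ (extChartAt 𝓘(ℝ, E) x).target)
    (hzy : (extChartAt 𝓘(ℝ, E) x).symm z = F.Ψ y) : ContDiffAt ℝ ∞ (σ.inChart x) z := by
  obtain ⟨f, hf, hfy, hfi⟩ := exists_inverse hy
  have h1 : ContMDiffAt 𝓘(ℝ, E) 𝓘(ℝ, E) ∞ (extChartAt 𝓘(ℝ, E) x).symm z :=
    (contMDiffOn_extChartAt_symm (n := ∞) x).contMDiffAt ((isOpen_extChartAt_target x).mem_nhds hz)
  rw [← hzy] at hf hfi hfy
  refine σ.contDiffAt_pull_of_comp (Ψ := F.Ψ) (f := f ∘ (extChartAt 𝓘(ℝ, E) x).symm) ?_ ?_ ?_ ?_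
  · filter_upwards [h1.continuousAt.eventually hfi] with w hw
    exact hw.symm
  · simp only [Function.comp_apply, hfy]
    exact eventually_mdifferentiableAt hy
  · exact (hf.comp z h1).contDiffAt
  · simp only [Function.comp_apply, hfy]
    exact contDiffAt_pull hT hσ hy

/-- Cartan's formula evaluated on the frame fields, whose Lie brackets are again frame fields, given
by `br`. -/
theorem d_apply {n : ℕ} {σ : FormField E M (n + 1)} {T : E → E [⋀^Fin (n + 1)]→L[ℝ] ℝ}
    (hT : ∀ y ∈ F.U, ContDiffAt ℝ ∞ T y)
    (hσ : ∀ y ∈ F.U, ∀ v : Fin (n + 1) → E, σ (F.Ψ y) (fun i => F.fr y (v i)) = T y v)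
    (hy : y ∈ F.U) (v : Fin (n + 2) → E) :
    σ.d (F.Ψ y) (fun i => F.fr y (v i)) =
      (∑ i, (-1) ^ i.val • fderiv ℝ (fun z => T z (i.removeNth v)) y (F.Θ y (v i))) -
        ∑ i : Fin (n + 1), ∑ j ≥ i, (-1) ^ (i + j : ℕ) •
            T y (Matrix.vecCons (br (v i.castSucc) (v j.succ))
              (j.removeNth <| i.castSucc.removeNth v)) := by
  have h0 : DifferentiableAt ℝ (σ.inChart (F.Ψ y)) (extChartAt 𝓘(ℝ, E) (F.Ψ y) (F.Ψ y)) :=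
    (contDiffAt_inChart hT hσ hy (mem_extChartAt_target _) (extChartAt_to_inv _)).differentiableAt
      (by simp)
  have h1 : DifferentiableAt ℝ (σ.pull F.Ψ) y :=
    (contDiffAt_pull hT hσ hy).differentiableAt (by simp)
  have h2 : ∀ i, DifferentiableAt ℝ (fun z => F.Θ z (v i)) y := fun i =>
    ((F.smooth y hy).clm_apply contDiffAt_const).differentiableAt (by simp)
  have h3 : ∀ z ∈ F.U, ∀ w : Fin (n + 1) → E, σ.pull F.Ψ z (fun i => F.Θ z (w i)) = T z w := by
    intro z hz w
    rw [← hσ z hz]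
    rfl
  have h4 : σ.d (F.Ψ y) (fun i => F.fr y (v i)) =
      extDeriv (σ.pull F.Ψ) y (fun i => F.Θ y (v i)) := by
    rw [σ.extDeriv_pull (contMDiffAt hy) h0]
    rfl
  rw [h4, extDeriv_apply_vectorField h1 h2]
  congr 1
  · refine Finset.sum_congr rfl fun i _ => ?_
    congr 2
    refine Filter.EventuallyEq.fderiv_eq ?_
    filter_upwards [F.isOpen.mem_nhds hy] with z hz
    rw [← h3 z hz]
    rfl
  · refine Finset.sum_congr rfl fun i _ => Finset.sum_congr rfl fun j _ => ?_
    congr 1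
    rw [F.lie y hy, ← h3 y hy]
    congr 1
    ext l
    refine Fin.cases ?_ (fun l => ?_) l <;> rfl

end Forms

end FrameChart
end FrameChart

/-! ### Vector fields in a frame and tensoriality of the Nijenhuis expression -/

section Nijenhuis

variable {E : Type*} [NormedAddCommGroup E] [NormedSpace ℝ E]

open VectorField in
-- All derivatives of V and W cancel because J² = −1. The right side sees V and W only through their
-- values at y, which permits replacing arbitrary fields by frame fields.
theorem nijenhuis_eq_tensor {J : E → E →L[ℝ] E} {V W : E → E} {y : E}
    (hJ : DifferentiableAt ℝ J y) (hV : DifferentiableAt ℝ V y) (hW : DifferentiableAt ℝ W y)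
    (hJJ : ∀ v, J y (J y v) = -v) :
    lieBracket ℝ (fun z => J z (V z)) (fun z => J z (W z)) y
      - J y (lieBracket ℝ (fun z => J z (V z)) W y) - J y (lieBracket ℝ V (fun z => J z (W z)) y)
      - lieBracket ℝ V W y =
    fderiv ℝ J y (J y (V y)) (W y) - fderiv ℝ J y (J y (W y)) (V y)
      + J y (fderiv ℝ J y (W y) (V y)) - J y (fderiv ℝ J y (V y) (W y)) := by
  have h : ∀ {X : E → E}, DifferentiableAt ℝ X y → ∀ u, fderiv ℝ (fun z => J z (X z)) y u =
      fderiv ℝ J y u (X y) + J y (fderiv ℝ X y u) := by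
    intro X hX u
    rw [(hJ.hasFDerivAt.clm_apply hX.hasFDerivAt).fderiv]
    simp [add_comm]
  simp only [lieBracket, h hV, h hW, map_sub, map_add, hJJ]
  abel

end Nijenhuis

namespace FrameChart

variable {E : Type*} [NormedAddCommGroup E] [NormedSpace ℝ E] [CompleteSpace E]
  {M : Type*} [TopologicalSpace M] [ChartedSpace E M] [IsManifold 𝓘(ℝ, E) ∞ M]
  {br : E → E → E} {F : FrameChart E M br} {y : E}

/-- The field is the tangent map of Ψ applied to a smooth field on the model space, precomposed with
a local inverse of Ψ. -/
theorem contMDiffAt_vecField {X : VecField E M} {ξ : E → E} (hy : y ∈ F.U)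
    (hξ : ContDiffAt ℝ ∞ ξ y) (hX : ∀ z ∈ F.U, X (F.Ψ z) = F.fr z (ξ z)) :
    ContMDiffAt 𝓘(ℝ, E) 𝓘(ℝ, E).tangent ∞ (fun x => (⟨x, X x⟩ : TangentBundle 𝓘(ℝ, E) M))
      (F.Ψ y) := by
  obtain ⟨f, hf, hfy, hfi⟩ := exists_inverse hy
  have h1 : ContMDiffOn 𝓘(ℝ, E) 𝓘(ℝ, E) ∞ F.Ψ F.U :=
    fun z hz => (contMDiffAt hz).contMDiffWithinAt
  have h2 := h1.contMDiffOn_tangentMapWithin (m := ∞) (by simp) F.isOpen.uniqueMDiffOn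
  have h3 : ContMDiffAt 𝓘(ℝ, E) 𝓘(ℝ, E).tangent ∞
      (fun z => (⟨z, F.Θ z (ξ z)⟩ : TangentBundle 𝓘(ℝ, E) E)) y :=
    contMDiffAt_vectorSpace_iff_contDiffAt.2 ((F.smooth y hy).clm_apply hξ)
  have hopen : IsOpen (Bundle.TotalSpace.proj ⁻¹' F.U : Set (TangentBundle 𝓘(ℝ, E) E)) :=
    F.isOpen.preimage (FiberBundle.continuous_proj E _)
  have h4 := h2.contMDiffAt (x := (⟨y, F.Θ y (ξ y)⟩ : TangentBundle 𝓘(ℝ, E) E))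
    (hopen.mem_nhds hy)
  have h5 := h4.comp y h3
  rw [← hfy] at h5
  have h6 := h5.comp (F.Ψ y) hf
  refine h6.congr_of_eventuallyEq ?_
  have hU : ∀ᶠ x in 𝓝 (F.Ψ y), f x ∈ F.U :=
    hf.continuousAt.eventually (by rw [hfy]; exact F.isOpen.mem_nhds hy)
  filter_upwards [hfi, hU] with x hx hxU
  have h7 : (⟨x, X x⟩ : TangentBundle 𝓘(ℝ, E) M) = ⟨F.Ψ (f x), X (F.Ψ (f x))⟩ := by rw [hx]
  rw [h7, hX _ hxU]
  simp only [Function.comp_apply, tangentMapWithin]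
  rw [mfderivWithin_of_isOpen F.isOpen hxU]
  rfl

/-- The expression of a vector field in the parametrization. -/
def hat (F : FrameChart E M br) (X : VecField E M) (y : E) : E :=
  VectorField.mpullback 𝓘(ℝ, E) 𝓘(ℝ, E) F.Ψ X y

theorem isInvertible_mfderiv (hy : y ∈ F.U) :
    (mfderiv 𝓘(ℝ, E) 𝓘(ℝ, E) F.Ψ y).IsInvertible :=
  ⟨(F.diffeo y hy).mfderivToContinuousLinearEquiv (by simp), rfl⟩

theorem hat_eq (hy : y ∈ F.U) (X : VecField E M) : F.hat X y = (dΨ hy).symm (X (F.Ψ y)) := by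
  have h : (mfderiv 𝓘(ℝ, E) 𝓘(ℝ, E) F.Ψ y).inverse =
      ((F.diffeo y hy).mfderivToContinuousLinearEquiv (by simp)).symm :=
    ContinuousLinearMap.inverse_equiv ((F.diffeo y hy).mfderivToContinuousLinearEquiv (by simp))
  exact congrArg (fun A => A (X (F.Ψ y))) h

theorem dΨ_hat (hy : y ∈ F.U) (X : VecField E M) : dΨ hy (F.hat X y) = X (F.Ψ y) := by
  rw [hat_eq hy, ContinuousLinearEquiv.apply_symm_apply]

theorem contDiffAt_hat {X : VecField E M} (hy : y ∈ F.U)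
    (hX : ContMDiffAt 𝓘(ℝ, E) 𝓘(ℝ, E).tangent ∞ (fun x => (⟨x, X x⟩ : TangentBundle 𝓘(ℝ, E) M))
      (F.Ψ y)) : ContDiffAt ℝ ∞ (F.hat X) y := by
  have : IsManifold 𝓘(ℝ, E) 1 M := IsManifold.of_le (n := ∞) (by simp)
  have h := ContMDiffAt.mpullback_vectorField_preimage (n := ∞) hX (contMDiffAt hy)
    (isInvertible_mfderiv hy) (by simp)
  exact contMDiffAt_vectorSpace_iff_contDiffAt.1 h

omit [CompleteSpace E] in
theorem _root_.mlieBracket_eq_lieBracket_apply (V W : E → E) (y : E) :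
    VectorField.mlieBracket 𝓘(ℝ, E) (show VecField E E from V) (show VecField E E from W) y =
      VectorField.lieBracket ℝ V W y := by
  have h := congrFun (VectorField.mlieBracketWithin_eq_lieBracketWithin (𝕜 := ℝ) (V := V) (W := W)
    (s := Set.univ)) y
  rw [VectorField.lieBracketWithin_univ] at h
  exact h

theorem hat_mlieBracket {X Y : VecField E M} (hy : y ∈ F.U)
    (hX : ContMDiffAt 𝓘(ℝ, E) 𝓘(ℝ, E).tangent ∞ (fun x => (⟨x, X x⟩ : TangentBundle 𝓘(ℝ, E) M))
      (F.Ψ y))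
    (hY : ContMDiffAt 𝓘(ℝ, E) 𝓘(ℝ, E).tangent ∞ (fun x => (⟨x, Y x⟩ : TangentBundle 𝓘(ℝ, E) M))
      (F.Ψ y)) :
    F.hat (VectorField.mlieBracket 𝓘(ℝ, E) X Y) y =
      VectorField.lieBracket ℝ (F.hat X) (F.hat Y) y := by
  have := VectorField.mpullback_mlieBracket (n := ∞) (hX.mdifferentiableAt (by simp))
    (hY.mdifferentiableAt (by simp)) (contMDiffAt hy)
    (by simp only [minSmoothness_of_isRCLikeNormedField]; exact ENat.LEInfty.out)
  rw [hat, this]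
  exact mlieBracket_eq_lieBracket_apply _ _ y

theorem hat_of_fr {X : VecField E M} (hy : y ∈ F.U) {v : E} (hX : X (F.Ψ y) = F.fr y v) :
    F.hat X y = F.Θ y v := by
  rw [hat_eq hy, hX]
  exact (dΨ hy).symm_apply_apply _

/-- The bracket of vector fields with constant coefficients in the frame. -/
theorem mlieBracket_of_fr {X Y : VecField E M} (hy : y ∈ F.U) {v w : E}
    (hX : ∀ z ∈ F.U, X (F.Ψ z) = F.fr z v) (hY : ∀ z ∈ F.U, Y (F.Ψ z) = F.fr z w) :
    VectorField.mlieBracket 𝓘(ℝ, E) X Y (F.Ψ y) = F.fr y (br v w) := by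
  have h1 := hat_mlieBracket hy (contMDiffAt_vecField hy contDiffAt_const hX)
    (contMDiffAt_vecField hy contDiffAt_const hY)
  have h2 : F.hat X =ᶠ[𝓝 y] fun z => F.Θ z v := by
    filter_upwards [F.isOpen.mem_nhds hy] with z hz using hat_of_fr hz (hX z hz)
  have h3 : F.hat Y =ᶠ[𝓝 y] fun z => F.Θ z w := by
    filter_upwards [F.isOpen.mem_nhds hy] with z hz using hat_of_fr hz (hY z hz)
  rw [h2.lieBracket_vectorField_eq h3, F.lie y hy] at h1
  rw [← dΨ_hat hy (VectorField.mlieBracket 𝓘(ℝ, E) X Y), h1]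
  rfl

/-- By tensoriality only frame fields need checking, and on these the Nijenhuis tensor is the
algebraic expression in `hN`. -/
theorem nijenhuis_eq_zero {J : ∀ x : M, TangentSpace 𝓘(ℝ, E) x →L[ℝ] TangentSpace 𝓘(ℝ, E) x}
    {J₀ : E →L[ℝ] E} (hJ : ∀ z ∈ F.U, ∀ v, J (F.Ψ z) (F.fr z v) = F.fr z (J₀ v))
    (hJJ : ∀ v, J₀ (J₀ v) = -v)
    (hN : ∀ v w, br (J₀ v) (J₀ w) - J₀ (br (J₀ v) w) - J₀ (br v (J₀ w)) - br v w = 0)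
    (hy : y ∈ F.U) {X Y : VecField E M} (hX : X.Smooth) (hY : Y.Smooth)
    (hJX : VecField.Smooth fun z => J z (X z)) (hJY : VecField.Smooth fun z => J z (Y z)) :
    VectorField.mlieBracket 𝓘(ℝ, E) (fun z => J z (X z)) (fun z => J z (Y z)) (F.Ψ y)
      - J (F.Ψ y) (VectorField.mlieBracket 𝓘(ℝ, E) (fun z => J z (X z)) Y (F.Ψ y))
      - J (F.Ψ y) (VectorField.mlieBracket 𝓘(ℝ, E) X (fun z => J z (Y z)) (F.Ψ y))
      - VectorField.mlieBracket 𝓘(ℝ, E) X Y (F.Ψ y) = 0 := by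
  set K : E → E →L[ℝ] E := fun z => (F.Θ z).comp (J₀.comp (F.Θinv z)) with hK
  have hKΘ : ∀ z ∈ F.U, ∀ v, K z (F.Θ z v) = F.Θ z (J₀ v) := fun z hz v => by
    simp [hK, Θinv_Θ hz]
  have hJd : ∀ z (hz : z ∈ F.U) (v : E), J (F.Ψ z) (dΨ hz v) = dΨ hz (K z v) := by
    intro z hz v
    have h := hJ z hz (F.Θinv z v)
    have h1 : F.fr z (F.Θinv z v) = dΨ hz v := by
      rw [fr, Θ_Θinv hz]; rfl
    rw [h1] at h
    rw [h]
    rfl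
  have hhat : ∀ Z : VecField E M, ∀ z ∈ F.U,
      F.hat (fun x => J x (Z x)) z = K z (F.hat Z z) := by
    intro Z z hz
    rw [hat_eq hz, ← dΨ_hat hz Z, hJd z hz, ContinuousLinearEquiv.symm_apply_apply]
  have hhat' : ∀ Z : VecField E M, F.hat (fun x => J x (Z x)) =ᶠ[𝓝 y] fun z => K z (F.hat Z z) :=
    fun Z => by filter_upwards [F.isOpen.mem_nhds hy] with z hz using hhat Z z hz
  have hXs := contDiffAt_hat (F := F) hy (hX _)
  have hYs := contDiffAt_hat (F := F) hy (hY _)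
  have hKs : ContDiffAt ℝ ∞ K y :=
    (F.smooth y hy).clm_comp (contDiffAt_const.clm_comp (contDiffAt_Θinv hy))
  have hKK : ∀ v, K y (K y v) = -v := fun v => by
    simp [hK, Θinv_Θ hy, hJJ, Θ_Θinv hy]
  have hc : ∀ v : E, ContDiffAt ℝ ∞ (fun z => F.Θ z v) y := fun v =>
    (F.smooth y hy).clm_apply contDiffAt_const
  have hKΘ' : ∀ v, (fun z => K z (F.Θ z v)) =ᶠ[𝓝 y] fun z => F.Θ z (J₀ v) :=
    fun v => by filter_upwards [F.isOpen.mem_nhds hy] with z hz using hKΘ z hz v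
  -- Frame fields with constant coefficients that agree with X and Y at the single point y.
  obtain ⟨v, hv⟩ : ∃ v, F.Θ y v = F.hat X y := ⟨_, Θ_Θinv hy _⟩
  obtain ⟨w, hw⟩ : ∃ w, F.Θ y w = F.hat Y y := ⟨_, Θ_Θinv hy _⟩
  have t1 := nijenhuis_eq_tensor (hKs.differentiableAt (by simp)) (hXs.differentiableAt (by simp))
    (hYs.differentiableAt (by simp)) hKK
  have t2 := nijenhuis_eq_tensor (hKs.differentiableAt (by simp))
    ((hc v).differentiableAt (by simp)) ((hc w).differentiableAt (by simp)) hKK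
  simp only [hv, hw] at t2
  rw [← t1, (hKΘ' v).lieBracket_vectorField_eq (hKΘ' w),
    (hKΘ' v).lieBracket_vectorField_eq (.refl _ _), 
    Filter.EventuallyEq.lieBracket_vectorField_eq (.refl _ _) (hKΘ' w)] at t2
  simp only [F.lie y hy, hKΘ y hy, ← map_sub, hN, map_zero] at t2
  rw [← dΨ_hat hy (VectorField.mlieBracket 𝓘(ℝ, E) (fun z => J z (X z)) (fun z => J z (Y z))),
    ← dΨ_hat hy (VectorField.mlieBracket 𝓘(ℝ, E) (fun z => J z (X z)) Y),
    ← dΨ_hat hy (VectorField.mlieBracket 𝓘(ℝ, E) X (fun z => J z (Y z))),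
    ← dΨ_hat hy (VectorField.mlieBracket 𝓘(ℝ, E) X Y), hJd, hJd, ← map_sub, ← map_sub, ← map_sub,
    hat_mlieBracket hy (hJX _) (hJY _), hat_mlieBracket hy (hJX _) (hY _),
    hat_mlieBracket hy (hX _) (hJY _), hat_mlieBracket hy (hX _) (hY _),
    (hhat' X).lieBracket_vectorField_eq (hhat' Y),
    (hhat' X).lieBracket_vectorField_eq (.refl _ _), 
    Filter.EventuallyEq.lieBracket_vectorField_eq (.refl _ _) (hhat' Y), ← t2, map_zero]

end FrameChart

/-! ### The left-invariant frame of a Lie group -/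

section LieGroupFrame

variable {E : Type*} [NormedAddCommGroup E] [NormedSpace ℝ E]
  {G : Type*} [TopologicalSpace G] [ChartedSpace E G] [Group G] [LieGroup 𝓘(ℝ, E) ∞ G]

open Bundle in
-- The field at g is the tangent map of the multiplication evaluated on the pair (0 at g, v at 1),
-- so it is as smooth as that tangent map.
theorem contMDiff_top_mulInvariantVectorField (v : GroupLieAlgebra 𝓘(ℝ, E) G) :
    ContMDiff 𝓘(ℝ, E) 𝓘(ℝ, E).tangent ∞
      (fun g : G => (⟨g, mulInvariantVectorField v g⟩ : TangentBundle 𝓘(ℝ, E) G)) := by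
  let fg : G → TangentBundle 𝓘(ℝ, E) G := fun g ↦ TotalSpace.mk' E g 0
  have sfg : ContMDiff 𝓘(ℝ, E) 𝓘(ℝ, E).tangent ∞ fg := contMDiff_zeroSection _ _
  let fv : G → TangentBundle 𝓘(ℝ, E) G := fun _ ↦ TotalSpace.mk' E 1 v
  have sfv : ContMDiff 𝓘(ℝ, E) 𝓘(ℝ, E).tangent ∞ fv := contMDiff_const
  let F₁ : G → (TangentBundle 𝓘(ℝ, E) G × TangentBundle 𝓘(ℝ, E) G) := fun g ↦ (fg g, fv g)
  have S₁ : ContMDiff 𝓘(ℝ, E) (𝓘(ℝ, E).tangent.prod 𝓘(ℝ, E).tangent) ∞ F₁ := sfg.prodMk sfv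
  let F₂ : (TangentBundle 𝓘(ℝ, E) G × TangentBundle 𝓘(ℝ, E) G) →
      TangentBundle (𝓘(ℝ, E).prod 𝓘(ℝ, E)) (G × G) :=
    (equivTangentBundleProd 𝓘(ℝ, E) G 𝓘(ℝ, E) G).symm
  have S₂ : ContMDiff (𝓘(ℝ, E).tangent.prod 𝓘(ℝ, E).tangent)
      (𝓘(ℝ, E).prod 𝓘(ℝ, E)).tangent ∞ F₂ := contMDiff_equivTangentBundleProd_symm
  let F₃ : TangentBundle (𝓘(ℝ, E).prod 𝓘(ℝ, E)) (G × G) → TangentBundle 𝓘(ℝ, E) G :=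
    tangentMap (𝓘(ℝ, E).prod 𝓘(ℝ, E)) 𝓘(ℝ, E) (fun (p : G × G) ↦ p.1 * p.2)
  have S₃ : ContMDiff (𝓘(ℝ, E).prod 𝓘(ℝ, E)).tangent 𝓘(ℝ, E).tangent ∞ F₃ := by
    apply ContMDiff.contMDiff_tangentMap _ (m := ∞) le_rfl
    exact contMDiff_mul 𝓘(ℝ, E) ∞
  let S := (S₃.comp S₂).comp S₁
  convert! S with g
  · simp [F₁, F₂, F₃, fg, fv]
  · simp only [Function.comp_apply, tangentMap, F₃, F₂, F₁, fg, fv]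
    rw [mfderiv_prod_eq_add_apply ((contMDiff_mul 𝓘(ℝ, E) ∞).mdifferentiableAt (by simp))]
    exact (by simp : ∀ (A : E →L[ℝ] E) (w : E), w = A 0 + w) _ _

/-- The invariant frame at `g`. -/
def frameMap (g : G) : E →L[ℝ] E := mfderiv 𝓘(ℝ, E) 𝓘(ℝ, E) (g * ·) (1 : G)

theorem frameMap_mul (g h : G) :
    frameMap (E := E) (g * h) = (show E →L[ℝ] E from mfderiv 𝓘(ℝ, E) 𝓘(ℝ, E) (g * ·) h).comp
      (frameMap h) := by
  have h1 : (fun x => g * h * x) = (g * ·) ∘ (h * ·) := by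
    ext x; simp [mul_assoc]
  have hd : ∀ a b : G, MDifferentiableAt 𝓘(ℝ, E) 𝓘(ℝ, E) (a * ·) b := fun a b =>
    (contMDiff_mul_left (n := ∞)).contMDiffAt.mdifferentiableAt (by simp)
  have h2 := mfderiv_comp (1 : G) (hd g (h * 1)) (hd h 1)
  rw [← h1] at h2
  refine h2.trans ?_
  rw [mul_one]
  rfl

theorem frameMap_one : frameMap (E := E) (1 : G) = ContinuousLinearMap.id ℝ E := by
  have h1 : (fun x : G => 1 * x) = id := by ext x; simp
  change mfderiv 𝓘(ℝ, E) 𝓘(ℝ, E) (fun x : G => 1 * x) 1 = _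
  rw [h1, mfderiv_id]
  rfl

theorem frameMap_isInvertible (g : G) : (frameMap (E := E) g).IsInvertible := by
  have h1 := frameMap_mul (E := E) g⁻¹ g
  have h2 := inverse_mfderiv_mul_left (I := 𝓘(ℝ, E)) (g := g) (h := (1 : G))
  have hd : ∀ a b : G, MDifferentiableAt 𝓘(ℝ, E) 𝓘(ℝ, E) (a * ·) b := fun a b =>
    (contMDiff_mul_left (n := ∞)).contMDiffAt.mdifferentiableAt (by simp)
  rw [inv_mul_cancel, frameMap_one] at h1
  have h3 := frameMap_mul (E := E) g g⁻¹
  rw [mul_inv_cancel, frameMap_one] at h3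
  have e1 : (g * ·) ∘ (g⁻¹ * ·) = (id : G → G) := by ext x; simp
  have h4 := mfderiv_comp (I := 𝓘(ℝ, E)) (I' := 𝓘(ℝ, E)) (I'' := 𝓘(ℝ, E)) g
    (hd g (g⁻¹ * g)) (hd g⁻¹ g)
  rw [e1, mfderiv_id, inv_mul_cancel] at h4
  refine ContinuousLinearMap.IsInvertible.of_inverse (g := show E →L[ℝ] E from
    mfderiv 𝓘(ℝ, E) 𝓘(ℝ, E) (g⁻¹ * ·) g) h4.symm h1.symm

end LieGroupFrame

/-! ### Charts of the group as framed parametrizations of the quotient -/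

section GroupChart

variable {E : Type*} [NormedAddCommGroup E] [NormedSpace ℝ E] [FiniteDimensional ℝ E]
  [CompleteSpace E]
  {G : Type*} [TopologicalSpace G] [ChartedSpace E G] [Group G] [LieGroup 𝓘(ℝ, E) ∞ G]
  {M : Type*} [TopologicalSpace M] [ChartedSpace E M] [IsManifold 𝓘(ℝ, E) ∞ M]

theorem isLocalDiffeomorphAt_extChartAt_symm (a : G) {y : E}
    (hy : y ∈ (extChartAt 𝓘(ℝ, E) a).target) :
    IsLocalDiffeomorphAt 𝓘(ℝ, E) 𝓘(ℝ, E) ∞ (extChartAt 𝓘(ℝ, E) a).symm y :=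
  ⟨{ toPartialEquiv := (extChartAt 𝓘(ℝ, E) a).symm
     open_source := isOpen_extChartAt_target a
     open_target := isOpen_extChartAt_source a
     contMDiffOn_toFun := contMDiffOn_extChartAt_symm a
     contMDiffOn_invFun := by
       have h := contMDiffOn_extChartAt (I := 𝓘(ℝ, E)) (n := ∞) (x := a)
       rwa [← extChartAt_source 𝓘(ℝ, E)] at h }, hy, fun _ _ => rfl⟩

/-- The bracket of the Lie algebra of `G`, on the model space. -/
def groupBr (E : Type*) [NormedAddCommGroup E] [NormedSpace ℝ E]
    (G : Type*) [TopologicalSpace G] [ChartedSpace E G] [Group G] [LieGroup 𝓘(ℝ, E) ∞ G]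
    (v w : E) : E :=
  (⁅(show GroupLieAlgebra 𝓘(ℝ, E) G from v), (show GroupLieAlgebra 𝓘(ℝ, E) G from w)⁆ :
    GroupLieAlgebra 𝓘(ℝ, E) G)

/-- The framed parametrization of `M` near `π a` given by a chart of `G` at `a` and the invariant
fields. -/
def groupChart {π : G → M} (hπ : IsLocalDiffeomorph 𝓘(ℝ, E) 𝓘(ℝ, E) ∞ π) (a : G) :
    FrameChart E M (groupBr E G) where
  Ψ := π ∘ (extChartAt 𝓘(ℝ, E) a).symm
  U := (extChartAt 𝓘(ℝ, E) a).target
  Θ y := ContinuousLinearMap.comp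
    (ContinuousLinearMap.inverse (show E →L[ℝ] E from
      mfderiv 𝓘(ℝ, E) 𝓘(ℝ, E) (extChartAt 𝓘(ℝ, E) a).symm y))
    (frameMap ((extChartAt 𝓘(ℝ, E) a).symm y))
  isOpen := isOpen_extChartAt_target a
  diffeo y hy := 
    IsLocalDiffeomorphAt.comp 𝓘(ℝ, E) M (isLocalDiffeomorphAt_extChartAt_symm a hy) (hπ _)
  smooth := by
    intro y hy
    have h : ContDiffOn ℝ ∞ (fun y => ContinuousLinearMap.comp
      (ContinuousLinearMap.inverse (show E →L[ℝ] E from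
        mfderiv 𝓘(ℝ, E) 𝓘(ℝ, E) (extChartAt 𝓘(ℝ, E) a).symm y))
      (frameMap (E := E) ((extChartAt 𝓘(ℝ, E) a).symm y))) (extChartAt 𝓘(ℝ, E) a).target := by
      rw [contDiffOn_clm_apply]
      intro v y hy
      refine ContDiffAt.contDiffWithinAt ?_
      have h1 : IsManifold 𝓘(ℝ, E) 1 G := IsManifold.of_le (n := ∞) (by simp)
      have hd := isLocalDiffeomorphAt_extChartAt_symm a hy
      have h := ContMDiffAt.mpullback_vectorField_preimage (n := ∞) (m := ∞)
        ((contMDiff_top_mulInvariantVectorField (E := E) (G := G) v).contMDiffAt)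
        hd.contMDiffAt ⟨hd.mfderivToContinuousLinearEquiv (by simp), rfl⟩ (by simp)
      exact contMDiffAt_vectorSpace_iff_contDiffAt.1 h
    exact h.contDiffAt ((isOpen_extChartAt_target a).mem_nhds hy)
  invertible := by
    intro y hy
    have hd := isLocalDiffeomorphAt_extChartAt_symm a hy
    have h1 : ContinuousLinearMap.IsInvertible (show E →L[ℝ] E from
      mfderiv 𝓘(ℝ, E) 𝓘(ℝ, E) (extChartAt 𝓘(ℝ, E) a).symm y) :=
      ⟨hd.mfderivToContinuousLinearEquiv (by simp), rfl⟩
    exact h1.inverse.comp (frameMap_isInvertible _)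
  lie := by
    intro y hy v w
    have h1 : IsManifold 𝓘(ℝ, E) 1 G := IsManifold.of_le (n := ∞) (by simp)
    have hd := isLocalDiffeomorphAt_extChartAt_symm a hy
    have hs : ∀ v : GroupLieAlgebra 𝓘(ℝ, E) G, MDifferentiableAt 𝓘(ℝ, E) 𝓘(ℝ, E).tangent
        (fun g : G => (⟨g, mulInvariantVectorField v g⟩ : TangentBundle 𝓘(ℝ, E) G))
        ((extChartAt 𝓘(ℝ, E) a).symm y) := fun v =>
      (contMDiff_top_mulInvariantVectorField v).contMDiffAt.mdifferentiableAt (by simp)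
    have h := VectorField.mpullback_mlieBracket (n := ∞) (hs v) (hs w) hd.contMDiffAt
      (by simp only [minSmoothness_of_isRCLikeNormedField]; exact ENat.LEInfty.out)
    have h2 := mulInvariantVector_mlieBracket (I := 𝓘(ℝ, E)) (G := G) v w
    exact (mlieBracket_eq_lieBracket_apply _ _ y).symm.trans (h.symm.trans (congrArg (fun V =>
      VectorField.mpullback 𝓘(ℝ, E) 𝓘(ℝ, E) (extChartAt 𝓘(ℝ, E) a).symm V y) h2.symm))

variable {π : G → M} (hπ : IsLocalDiffeomorph 𝓘(ℝ, E) 𝓘(ℝ, E) ∞ π)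

theorem groupChart_Ψ (a : G) (y : E) :
    (groupChart hπ a).Ψ y = π ((extChartAt 𝓘(ℝ, E) a).symm y) := rfl

theorem groupChart_fr {a : G} {y : E} (hy : y ∈ (extChartAt 𝓘(ℝ, E) a).target) (v : E) :
    (groupChart hπ a).fr y v = pushInvariant π v ((extChartAt 𝓘(ℝ, E) a).symm y) := by
  have hd := isLocalDiffeomorphAt_extChartAt_symm a hy
  have h1 := mfderiv_comp y ((hπ _).mdifferentiableAt (by simp)) (hd.mdifferentiableAt (by simp))
  have h2 : ∀ w : E, (show E →L[ℝ] E from mfderiv 𝓘(ℝ, E) 𝓘(ℝ, E) (extChartAt 𝓘(ℝ, E) a).symm y)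
      ((ContinuousLinearMap.inverse (show E →L[ℝ] E from
        mfderiv 𝓘(ℝ, E) 𝓘(ℝ, E) (extChartAt 𝓘(ℝ, E) a).symm y)) w) = w := by
    intro w
    have h3 : ContinuousLinearMap.IsInvertible (show E →L[ℝ] E from
      mfderiv 𝓘(ℝ, E) 𝓘(ℝ, E) (extChartAt 𝓘(ℝ, E) a).symm y) :=
      ⟨hd.mfderivToContinuousLinearEquiv (by simp), rfl⟩
    exact h3.self_apply_inverse w
  change mfderiv 𝓘(ℝ, E) 𝓘(ℝ, E) (π ∘ (extChartAt 𝓘(ℝ, E) a).symm) y _ = _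
  rw [h1]
  exact congrArg (mfderiv 𝓘(ℝ, E) 𝓘(ℝ, E) π ((extChartAt 𝓘(ℝ, E) a).symm y)) (h2 _)

theorem mem_groupChart_U (a : G) : extChartAt 𝓘(ℝ, E) a a ∈ (groupChart hπ a).U :=
  mem_extChartAt_target a

theorem groupChart_Ψ_self (a : G) : (groupChart hπ a).Ψ (extChartAt 𝓘(ℝ, E) a a) = π a := by
  rw [groupChart_Ψ, extChartAt_to_inv]

end GroupChart

/-! ### Strong KT structures on a Lie algebra -/

section Algebraic

variable {L : Type*} [LieRing L] [LieAlgebra ℝ L]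

/-- The differential of the fundamental form `Ω(x, y) = g(Jx, y)` on a Lie algebra. -/
def dOmega (J : L →ₗ[ℝ] L) (g : L →ₗ[ℝ] L →ₗ[ℝ] ℝ) (x y z : L) : ℝ :=
  -(g (J ⁅x, y⁆) z - g (J ⁅x, z⁆) y + g (J ⁅y, z⁆) x)

/-- The 3-form `JdΩ` on a Lie algebra. -/
def torsion (J : L →ₗ[ℝ] L) (g : L →ₗ[ℝ] L →ₗ[ℝ] ℝ) (x y z : L) : ℝ :=
  dOmega J g (J x) (J y) (J z)

/-- `(J, g)` is a strong KT structure on the Lie algebra `L`. -/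
structure IsLieSKT (J : L →ₗ[ℝ] L) (g : L →ₗ[ℝ] L →ₗ[ℝ] ℝ) : Prop where
  J_J : ∀ x, J (J x) = -x
  integrable : ∀ x y, ⁅J x, J y⁆ - J ⁅J x, y⁆ - J ⁅x, J y⁆ - ⁅x, y⁆ = 0
  symm : ∀ x y, g x y = g y x
  pos : ∀ x, x ≠ 0 → 0 < g x x
  g_J : ∀ x y, g (J x) (J y) = g x y
  closed : ∀ x y z w, torsion J g ⁅x, y⁆ z w - torsion J g ⁅x, z⁆ y w + torsion J g ⁅x, w⁆ y z
    + torsion J g ⁅y, z⁆ x w - torsion J g ⁅y, w⁆ x z + torsion J g ⁅z, w⁆ x y = 0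
  nonclosed : ∃ x y z, dOmega J g x y z ≠ 0

end Algebraic

/-! ### Invariant forms and vector fields on the quotient -/

section Invariant

variable {E : Type*} [NormedAddCommGroup E] [NormedSpace ℝ E] [FiniteDimensional ℝ E]
  [CompleteSpace E]
  {G : Type*} [TopologicalSpace G] [ChartedSpace E G] [Group G] [LieGroup 𝓘(ℝ, E) ∞ G]
  {M : Type*} [TopologicalSpace M] [ChartedSpace E M] [IsManifold 𝓘(ℝ, E) ∞ M]
  {π : G → M}

/-- The map `v ↦ pushInvariant π v a`, as a continuous linear map. -/
def pushMap (π : G → M) (a : G) : E →L[ℝ] E :=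
  (show E →L[ℝ] E from mfderiv 𝓘(ℝ, E) 𝓘(ℝ, E) π a).comp (frameMap a)

theorem pushMap_bijective (hπ : IsLocalDiffeomorph 𝓘(ℝ, E) 𝓘(ℝ, E) ∞ π) (a : G) :
    Function.Bijective (pushMap (E := E) π a) := by
  have h : Function.Bijective (show E →L[ℝ] E from mfderiv 𝓘(ℝ, E) 𝓘(ℝ, E) π a) :=
    (hπ.mfderivToContinuousLinearEquiv (by simp) a).bijective
  exact h.comp (frameMap_isInvertible a).bijective

/-- `pushMap` as a linear equivalence. -/
def pushEquiv (hπ : IsLocalDiffeomorph 𝓘(ℝ, E) 𝓘(ℝ, E) ∞ π) (a : G) : E ≃ₗ[ℝ] E :=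
  LinearEquiv.ofBijective (pushMap (E := E) π a : E →ₗ[ℝ] E) (pushMap_bijective hπ a)

/-- The form `σ` on `M` is induced by the left-invariant form on `G` with value `T`. -/
def IsInvariantForm {k : ℕ} (π : G → M) (σ : FormField E M k) (T : (Fin k → E) → ℝ) : Prop :=
  ∀ (a : G) (v : Fin k → E), σ (π a) (fun i => pushInvariant π (v i) a) = T v

theorem IsInvariantForm.exists_alternating {k : ℕ} {σ : FormField E M k} {T : (Fin k → E) → ℝ}
    (h : IsInvariantForm π σ T) : ∃ A : E [⋀^Fin k]→L[ℝ] ℝ, ∀ v, T v = A v :=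
  ⟨(show E [⋀^Fin k]→L[ℝ] ℝ from σ (π 1)).compContinuousLinearMap (pushMap π 1),
    fun v => (h 1 v).symm⟩

theorem IsInvariantForm.smooth {k : ℕ} {σ : FormField E M k} {T : (Fin k → E) → ℝ}
    (hπ : IsLocalDiffeomorph 𝓘(ℝ, E) 𝓘(ℝ, E) ∞ π) (hs : Function.Surjective π)
    (h : IsInvariantForm π σ T) : σ.Smooth := by
  obtain ⟨A, hA⟩ := h.exists_alternating
  intro x z hz
  obtain ⟨a, ha⟩ := hs ((extChartAt 𝓘(ℝ, E) x).symm z)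
  refine ContDiffAt.contDiffWithinAt ?_
  refine FrameChart.contDiffAt_inChart (F := groupChart hπ a) (T := fun _ => A)
    (fun _ _ => contDiffAt_const) ?_ (mem_groupChart_U hπ a) hz ?_
  · intro y hy v
    rw [← hA, ← h ((extChartAt 𝓘(ℝ, E) a).symm y)]
    simp only [groupChart_fr hπ hy]
    rfl
  · rw [groupChart_Ψ_self, ha]

/-- Coefficients in the invariant frame are constant, so the derivative terms of Cartan's formula
drop out and the Chevalley–Eilenberg differential remains. -/
theorem IsInvariantForm.d {n : ℕ} {σ : FormField E M (n + 1)} {T : (Fin (n + 1) → E) → ℝ}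
    (hπ : IsLocalDiffeomorph 𝓘(ℝ, E) 𝓘(ℝ, E) ∞ π) (h : IsInvariantForm π σ T) :
    IsInvariantForm π σ.d fun v => -∑ i : Fin (n + 1), ∑ j ≥ i, (-1) ^ (i + j : ℕ) *
      T (Matrix.vecCons (groupBr E G (v i.castSucc) (v j.succ))
        (j.removeNth <| i.castSucc.removeNth v)) := by
  obtain ⟨A, hA⟩ := h.exists_alternating
  intro a v
  have h1 := FrameChart.d_apply (F := groupChart hπ a) (T := fun _ => A) (σ := σ)
    (fun _ _ => contDiffAt_const) (fun y hy v => by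
      rw [← hA, ← h ((extChartAt 𝓘(ℝ, E) a).symm y)]
      simp only [groupChart_fr hπ hy]
      rfl) (mem_groupChart_U hπ a) v
  simp only [groupChart_fr hπ (mem_groupChart_U hπ a)] at h1
  -- The formula obtained is based at the image of a under the chart and its inverse; this point
  -- equals a only propositionally, so the tangent spaces are transported along the equality.
  have h2 : ∀ (b : G) (_ : b = a), (show E [⋀^Fin (n+2)]→L[ℝ] ℝ from σ.d (π b))
      (fun i => pushMap π b (v i)) =
      (show E [⋀^Fin (n+2)]→L[ℝ] ℝ from σ.d (π a)) (fun i => pushMap π a (v i)) := by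
    rintro b rfl; rfl
  have h3 := (h2 _ (extChartAt_to_inv (I := 𝓘(ℝ, E)) a)).symm.trans h1
  refine h3.trans ?_
  simp [hA]

theorem isInvariantForm_unique {k : ℕ} {σ τ : FormField E M k} {T : (Fin k → E) → ℝ}
    (hπ : IsLocalDiffeomorph 𝓘(ℝ, E) 𝓘(ℝ, E) ∞ π) (hs : Function.Surjective π)
    (h : IsInvariantForm π σ T) (h' : IsInvariantForm π τ T) : σ = τ := by
  funext x
  obtain ⟨a, rfl⟩ := hs x
  ext v
  have hv : v = fun i => pushInvariant π ((pushEquiv hπ a).symm (v i)) a := by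
    funext i
    exact ((pushEquiv hπ a).apply_symm_apply (v i)).symm
  rw [hv, h, h']

/-- The vector field on `M` induced by a left-invariant field on `G`. -/
def invField (π : G → M) (hs : Function.Surjective π) (v : E) : VecField E M := fun x =>
  pushInvariant π v (Function.surjInv hs x)

variable {Γ : Subgroup G} (hπ : IsCosetProjection E Γ π)
include hπ

/-- Two points of a fibre differ by a left translation by some c ∈ Γ; π is unchanged by it and
left-invariant fields are preserved, so these fields descend to M. -/
theorem pushInvariant_of_eq {a b : G} (hab : π a = π b) (v : E) :
    (show E from pushInvariant π v a) = (show E from pushInvariant π v b) := by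
  obtain ⟨c, hc, rfl⟩ := (hπ.eq_iff a b).1 hab
  have h1 : π ∘ (c * ·) = π := by
    funext x
    exact ((hπ.eq_iff x (c * x)).2 ⟨c, hc, rfl⟩).symm
  have h2 := mfderiv_comp (I := 𝓘(ℝ, E)) (I' := 𝓘(ℝ, E)) (I'' := 𝓘(ℝ, E)) a
    ((hπ.isLocalDiffeomorph (c * a)).mdifferentiableAt (by simp))
    ((contMDiff_mul_left (n := ∞) (a := c)).contMDiffAt.mdifferentiableAt (by simp))
  rw [h1] at h2
  change pushMap π a v = pushMap π (c * a) v
  rw [pushMap, pushMap, frameMap_mul]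
  exact congrArg (fun A : E →L[ℝ] E => A (frameMap a v)) h2

theorem invField_apply (v : E) (a : G) :
    invField π hπ.surjective v (π a) = pushInvariant π v a :=
  pushInvariant_of_eq hπ (Function.surjInv_eq hπ.surjective (π a)) v

theorem invField_smooth (v : E) : (invField π hπ.surjective v).Smooth := by
  intro x
  obtain ⟨a, rfl⟩ := hπ.surjective x
  have := FrameChart.contMDiffAt_vecField (F := groupChart hπ.isLocalDiffeomorph a)
    (X := invField π hπ.surjective v) (ξ := fun _ => v)
    (mem_groupChart_U hπ.isLocalDiffeomorph a) contDiffAt_const (fun z hz => by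
      rw [groupChart_fr _ hz]
      exact invField_apply hπ v _)
  rwa [groupChart_Ψ_self] at this

theorem mlieBracket_invField (v w : E) :
    VectorField.mlieBracket 𝓘(ℝ, E) (invField π hπ.surjective v) (invField π hπ.surjective w) =
      invField π hπ.surjective (groupBr E G v w) := by
  funext x
  obtain ⟨a, rfl⟩ := hπ.surjective x
  have := FrameChart.mlieBracket_of_fr (F := groupChart hπ.isLocalDiffeomorph a)
    (X := invField π hπ.surjective v) (Y := invField π hπ.surjective w)
    (mem_groupChart_U hπ.isLocalDiffeomorph a) (v := v) (w := w)
    (fun z hz => by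
      rw [groupChart_fr _ hz]
      exact invField_apply hπ v _)
    (fun z hz => by
      rw [groupChart_fr _ hz]
      exact invField_apply hπ w _)
  rw [groupChart_fr _ (mem_groupChart_U hπ.isLocalDiffeomorph a)] at this
  rw [invField_apply hπ]
  have h2 : ∀ (b : G) (_ : b = a), (show E from VectorField.mlieBracket 𝓘(ℝ, E)
      (invField π hπ.surjective v) (invField π hπ.surjective w) (π b)) =
      pushMap π b (groupBr E G v w) → (show E from VectorField.mlieBracket 𝓘(ℝ, E)
      (invField π hπ.surjective v) (invField π hπ.surjective w) (π a)) =
      pushMap π a (groupBr E G v w) := by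
    rintro b rfl h; exact h
  exact h2 _ (extChartAt_to_inv (I := 𝓘(ℝ, E)) a) this

end Invariant

/-! ### From invariant Hermitian structures to the Lie algebra -/

section HermitianInvariant

theorem sum_Ici_fin_two (f : Fin 2 → Fin 2 → ℝ) :
    ∑ i, ∑ j ≥ i, f i j = f 0 0 + f 0 1 + f 1 1 := by
  have e0 : Finset.Ici (0 : Fin 2) = {0, 1} := by decide
  have e1 : Finset.Ici (1 : Fin 2) = {1} := by decide
  rw [Fin.sum_univ_two, e0, e1, Finset.sum_pair (by decide), Finset.sum_singleton]

theorem sum_Ici_fin_three (f : Fin 3 → Fin 3 → ℝ) :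
    ∑ i, ∑ j ≥ i, f i j = f 0 0 + f 0 1 + f 0 2 + f 1 1 + f 1 2 + f 2 2 := by
  have e0 : Finset.Ici (0 : Fin 3) = {0, 1, 2} := by decide
  have e1 : Finset.Ici (1 : Fin 3) = {1, 2} := by decide
  have e2 : Finset.Ici (2 : Fin 3) = {2} := by decide
  rw [Fin.sum_univ_three, e0, e1, e2, Finset.sum_insert (by decide), Finset.sum_pair (by decide),
    Finset.sum_pair (by decide), Finset.sum_singleton]
  ring

variable {E : Type*} [NormedAddCommGroup E] [NormedSpace ℝ E] [FiniteDimensional ℝ E]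
  [CompleteSpace E]
  {G : Type*} [TopologicalSpace G] [ChartedSpace E G] [Group G] [LieGroup 𝓘(ℝ, E) ∞ G]
  {M : Type*} [TopologicalSpace M] [ChartedSpace E M] [IsManifold 𝓘(ℝ, E) ∞ M]
  {π : G → M} {Γ : Subgroup G} {h : HermitianStructure E M}
  {J : E →ₗ[ℝ] E} {g : E →ₗ[ℝ] E →ₗ[ℝ] ℝ}

/-- The complex structure at `x`, acting on the model space. -/
def HermitianStructure.modelJ (h : HermitianStructure E M) (x : M) : E →L[ℝ] E := h.J x

/-- The metric at `x`, on the model space. -/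
def HermitianStructure.modelG (h : HermitianStructure E M) (x : M) : E →L[ℝ] E →L[ℝ] ℝ := h.g x

/-- `h` is induced by `J` and `g`. -/
structure HermitianStructure.IsInducedBy (h : HermitianStructure E M) (π : G → M)
    (J : E →ₗ[ℝ] E) (g : E →ₗ[ℝ] E →ₗ[ℝ] ℝ) : Prop where
  hJ : ∀ a v, h.modelJ (π a) (pushMap π a v) = pushMap π a (J v)
  hg : ∀ a v w, h.modelG (π a) (pushMap π a v) (pushMap π a w) = g v w

/-- `dOmega` on the Lie algebra of `G`, read on the model space. -/
def groupDOmega (G : Type*) [TopologicalSpace G] [ChartedSpace E G] [Group G]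
    [LieGroup 𝓘(ℝ, E) ∞ G] (J : E →ₗ[ℝ] E) (g : E →ₗ[ℝ] E →ₗ[ℝ] ℝ) (x y z : E) : ℝ :=
  -(g (J (groupBr E G x y)) z - g (J (groupBr E G x z)) y + g (J (groupBr E G y z)) x)

/-- `torsion` on the Lie algebra of `G`, read on the model space. -/
def groupTorsion (G : Type*) [TopologicalSpace G] [ChartedSpace E G] [Group G]
    [LieGroup 𝓘(ℝ, E) ∞ G] (J : E →ₗ[ℝ] E) (g : E →ₗ[ℝ] E →ₗ[ℝ] ℝ) (x y z : E) : ℝ :=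
  groupDOmega G J g (J x) (J y) (J z)

/-- The differential of `groupTorsion`. -/
def groupDTorsion (G : Type*) [TopologicalSpace G] [ChartedSpace E G] [Group G]
    [LieGroup 𝓘(ℝ, E) ∞ G] (J : E →ₗ[ℝ] E) (g : E →ₗ[ℝ] E →ₗ[ℝ] ℝ) (x y z w : E) : ℝ :=
  groupTorsion G J g (groupBr E G x y) z w - groupTorsion G J g (groupBr E G x z) y w
    + groupTorsion G J g (groupBr E G x w) y z + groupTorsion G J g (groupBr E G y z) x w
    - groupTorsion G J g (groupBr E G y w) x z + groupTorsion G J g (groupBr E G z w) x y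

theorem isInvariantForm_onForms {k : ℕ} {σ : FormField E M k} {T : (Fin k → E) → ℝ}
    (hh : h.IsInducedBy π J g) (hσ : IsInvariantForm π σ T) :
    IsInvariantForm π (h.onForms σ) fun v => T fun i => J (v i) := by
  intro a v
  have h1 : (fun i => h.modelJ (π a) (pushMap π a (v i))) = fun i => pushMap π a (J (v i)) :=
    funext fun i => hh.hJ a (v i)
  exact (congrArg (fun u : Fin k → E => (show E [⋀^Fin k]→L[ℝ] ℝ from σ (π a)) u) h1).trans
    (hσ a fun i => J (v i))

theorem isInvariantForm_Ω (hh : h.IsInducedBy π J g) :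
    IsInvariantForm π h.Ω fun v => g (J (v 0)) (v 1) := by
  intro a v
  refine Eq.trans ?_ (hh.hg a (J (v 0)) (v 1))
  exact congrArg (fun u : E => h.modelG (π a) u (pushMap π a (v 1))) (hh.hJ a (v 0))

theorem isInvariantForm_dΩ (hπ : IsLocalDiffeomorph 𝓘(ℝ, E) 𝓘(ℝ, E) ∞ π)
    (hh : h.IsInducedBy π J g) :
    IsInvariantForm π h.Ω.d fun v => groupDOmega G J g (v 0) (v 1) (v 2) := by
  intro a v
  refine ((isInvariantForm_Ω hh).d hπ a v).trans ?_
  refine (congrArg Neg.neg (sum_Ici_fin_two _)).trans ?_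
  change -((-1 : ℝ) ^ (0 + 0) * g (J (groupBr E G (v 0) (v 1))) (v 2) +
    (-1 : ℝ) ^ (0 + 1) * g (J (groupBr E G (v 0) (v 2))) (v 1) +
    (-1 : ℝ) ^ (1 + 1) * g (J (groupBr E G (v 1) (v 2))) (v 0)) = _
  beta_reduce
  unfold groupDOmega
  ring

theorem isInvariantForm_dJdΩ (hπ : IsLocalDiffeomorph 𝓘(ℝ, E) 𝓘(ℝ, E) ∞ π)
    (hh : h.IsInducedBy π J g) :
    IsInvariantForm π (h.onForms h.Ω.d).d fun v =>
      -groupDTorsion G J g (v 0) (v 1) (v 2) (v 3) := by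
  intro a v
  refine ((isInvariantForm_onForms hh (isInvariantForm_dΩ hπ hh)).d hπ a v).trans ?_
  refine (congrArg Neg.neg (sum_Ici_fin_three _)).trans ?_
  change -((-1 : ℝ) ^ (0 + 0) * groupTorsion G J g (groupBr E G (v 0) (v 1)) (v 2) (v 3) +
    (-1 : ℝ) ^ (0 + 1) * groupTorsion G J g (groupBr E G (v 0) (v 2)) (v 1) (v 3) +
    (-1 : ℝ) ^ (0 + 2) * groupTorsion G J g (groupBr E G (v 0) (v 3)) (v 1) (v 2) +
    (-1 : ℝ) ^ (1 + 1) * groupTorsion G J g (groupBr E G (v 1) (v 2)) (v 0) (v 3) +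
    (-1 : ℝ) ^ (1 + 2) * groupTorsion G J g (groupBr E G (v 1) (v 3)) (v 0) (v 2) +
    (-1 : ℝ) ^ (2 + 2) * groupTorsion G J g (groupBr E G (v 2) (v 3)) (v 0) (v 1)) = _
  beta_reduce
  unfold groupDTorsion
  ring

variable (hπ : IsCosetProjection E Γ π)
include hπ

/-- An invariant form is determined by its values on the invariant frame, so vanishing of dΩ and of
dJdΩ can be read on the Lie algebra. -/
theorem isSKT_iff (hh : h.IsInducedBy π J g) :
    h.IsSKT ↔ (∀ x y z w, groupDTorsion G J g x y z w = 0) ∧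
      ∃ x y z, groupDOmega G J g x y z ≠ 0 := by
  have h1 := isInvariantForm_dΩ hπ.isLocalDiffeomorph hh
  have h2 := isInvariantForm_dJdΩ hπ.isLocalDiffeomorph hh
  constructor
  · rintro ⟨h3, h4⟩
    constructor
    · intro x y z w
      have h5 := h2 1 ![x, y, z, w]
      rw [h3] at h5
      exact neg_eq_zero.1 h5.symm
    · by_contra! hc
      refine h4 (isInvariantForm_unique hπ.isLocalDiffeomorph hπ.surjective h1 ?_)
      intro a v
      exact (hc _ _ _).symm
  · rintro ⟨h3, x, y, z, h4⟩
    constructor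
    · refine isInvariantForm_unique hπ.isLocalDiffeomorph hπ.surjective h2 ?_
      intro a v
      exact (neg_eq_zero.2 (h3 _ _ _ _)).symm
    · intro h5
      have h6 := h1 1 ![x, y, z]
      rw [h5] at h6
      exact h4 h6.symm

/-- Invariance supplies bare functions. J₀ is linear because the frame at 1 is injective and
intertwines it with a linear map; the form is the metric read at the identity. -/
theorem HermitianStructure.IsInvariant.exists_isInducedBy (H : h.IsInvariant π) :
    ∃ J g, h.IsInducedBy π J g := by
  obtain ⟨⟨J₁, hJ₀⟩, g₀, hg₀⟩ := H
  obtain ⟨J₀, hJ₁⟩ : ∃ J₀ : E → E, ∀ a (v : E),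
      h.modelJ (π a) (pushMap π a v) = pushMap π a (J₀ v) := ⟨J₁, hJ₀⟩
  have hinj : Function.Injective (pushMap (E := E) π (1 : G)) :=
    (pushMap_bijective hπ.isLocalDiffeomorph 1).1
  let J : E →ₗ[ℝ] E :=
    { toFun := J₀
      map_add' := fun v w => hinj (by
        rw [map_add, ← hJ₁, ← hJ₁, ← hJ₁, map_add, map_add])
      map_smul' := fun c v => hinj (by
        rw [map_smul, ← hJ₁, ← hJ₁, map_smul, map_smul, RingHom.id_apply]) }
  let g : E →ₗ[ℝ] E →ₗ[ℝ] ℝ :=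
    LinearMap.mk₂ ℝ (fun v w => h.modelG (π 1) (pushMap π 1 v) (pushMap π 1 w))
      (fun v w x => by simp)
      (fun c v w => by simp)
      (fun v w x => by simp)
      (fun c v w => by simp)
  exact ⟨J, g, ⟨hJ₁, fun a v w => (hg₀ a v w).trans (hg₀ 1 v w).symm⟩⟩

theorem modelJ_invField (hh : h.IsInducedBy π J g) (v : E) :
    (fun z => h.J z (invField π hπ.surjective v z)) = invField π hπ.surjective (J v) := by
  funext z
  obtain ⟨a, rfl⟩ := hπ.surjective z
  refine (congrArg (h.modelJ (π a)) (invField_apply hπ v a)).trans ?_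
  exact (hh.hJ a v).trans (invField_apply hπ (J v) a).symm

theorem HermitianStructure.IsInducedBy.integrable (hh : h.IsInducedBy π J g) (v w : E) :
    groupBr E G (J v) (J w) - J (groupBr E G (J v) w) - J (groupBr E G v (J w))
      - groupBr E G v w = 0 := by
  have h1 := h.integrable _ _ (invField_smooth hπ v) (invField_smooth hπ w) (π 1)
  rw [modelJ_invField hπ hh, modelJ_invField hπ hh, mlieBracket_invField hπ,
    mlieBracket_invField hπ, mlieBracket_invField hπ, mlieBracket_invField hπ,
    invField_apply hπ, invField_apply hπ, invField_apply hπ, invField_apply hπ] at h1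
  have h2 : pushMap π (1 : G) (groupBr E G (J v) (J w)) -
    h.modelJ (π 1) (pushMap π (1 : G) (groupBr E G (J v) w)) -
    h.modelJ (π 1) (pushMap π (1 : G) (groupBr E G v (J w))) -
    pushMap π (1 : G) (groupBr E G v w) = 0 := h1
  rw [hh.hJ, hh.hJ, ← map_sub, ← map_sub, ← map_sub] at h2
  exact (pushMap_bijective hπ.isLocalDiffeomorph 1).1 (h2.trans (map_zero _).symm)

theorem exists_isLieSKT_of_admits (H : AdmitsInvariantSKT E π) :
    ∃ (J : GroupLieAlgebra 𝓘(ℝ, E) G →ₗ[ℝ] GroupLieAlgebra 𝓘(ℝ, E) G)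
      (g : GroupLieAlgebra 𝓘(ℝ, E) G →ₗ[ℝ] GroupLieAlgebra 𝓘(ℝ, E) G →ₗ[ℝ] ℝ), IsLieSKT J g := by
  obtain ⟨h, hi, hskt⟩ := H
  obtain ⟨J, g, hh⟩ := hi.exists_isInducedBy hπ
  have hs := (isSKT_iff hπ hh).1 hskt
  have hinj := (pushMap_bijective (E := E) hπ.isLocalDiffeomorph 1).1
  refine ⟨J, g, ?_, ?_, ?_, ?_, ?_, hs.1, hs.2⟩
  · intro x
    refine hinj ?_
    refine (hh.hJ 1 (J x)).symm.trans ?_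
    refine (congrArg (h.modelJ (π 1)) (hh.hJ 1 x).symm).trans ?_
    exact (h.J_J (π 1) _).trans (map_neg (pushMap (E := E) π (1 : G)) x).symm
  · exact fun v w => hh.integrable hπ v w
  · intro v w
    exact (hh.hg 1 v w).symm.trans ((h.g_symm (π 1) _ _).trans (hh.hg 1 w v))
  · intro v hv
    refine lt_of_lt_of_eq (h.g_pos (π 1) (pushMap (E := E) π 1 v) fun h0 => hv (hinj ?_))
      (hh.hg 1 v v)
    exact Eq.trans h0 (map_zero (pushMap (E := E) π (1 : G))).symm
  · intro v w
    refine (hh.hg 1 (J v) (J w)).symm.trans ?_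
    refine Eq.trans ?_ (hh.hg 1 v w)
    refine Eq.trans ?_ (h.g_J (π 1) _ _)
    exact congrArg₂ (fun a b => h.modelG (π 1) a b) (hh.hJ 1 v).symm (hh.hJ 1 w).symm

end HermitianInvariant

/-! ### From the Lie algebra to invariant Hermitian structures -/

section Induced

variable {E : Type*} [NormedAddCommGroup E] [NormedSpace ℝ E] [FiniteDimensional ℝ E]
  [CompleteSpace E]
  {G : Type*} [TopologicalSpace G] [ChartedSpace E G] [Group G] [LieGroup 𝓘(ℝ, E) ∞ G]
  {M : Type*} [TopologicalSpace M] [ChartedSpace E M] [IsManifold 𝓘(ℝ, E) ∞ M]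
  {π : G → M} {Γ : Subgroup G} (hπ : IsCosetProjection E Γ π)
  (J : E →ₗ[ℝ] E) (g : E →ₗ[ℝ] E →ₗ[ℝ] ℝ)

/-- The identification of the Lie algebra of `G` with the tangent space of `M` at `x`. -/
def pushAt (x : M) : E ≃ₗ[ℝ] E :=
  pushEquiv hπ.isLocalDiffeomorph (Function.surjInv hπ.surjective x)

theorem pushAt_apply (a : G) (v : E) : pushAt hπ (π a) v = pushMap π a v :=
  pushInvariant_of_eq hπ (Function.surjInv_eq hπ.surjective (π a)) v

/-- The field of endomorphisms of the tangent spaces of `M` induced by `J`. -/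
def inducedJ (x : M) : E →L[ℝ] E :=
  LinearMap.toContinuousLinearMap ((pushAt hπ x).conj J)

/-- The field of bilinear forms on the tangent spaces of `M` induced by `g`. -/
def inducedG (x : M) : E →L[ℝ] E →L[ℝ] ℝ :=
  LinearMap.toContinuousLinearMap ((LinearMap.toContinuousLinearMap (𝕜 := ℝ) (E := E)
    (F' := ℝ)).toLinearMap ∘ₗ (g.compl₁₂ (pushAt hπ x).symm.toLinearMap
      (pushAt hπ x).symm.toLinearMap))

theorem inducedJ_apply (x : M) (v : E) :
    inducedJ hπ J x v = pushAt hπ x (J ((pushAt hπ x).symm v)) := rfl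

theorem inducedG_apply (x : M) (v w : E) :
    inducedG hπ g x v w = g ((pushAt hπ x).symm v) ((pushAt hπ x).symm w) := rfl

theorem inducedJ_pushMap (a : G) (v : E) :
    inducedJ hπ J (π a) (pushMap π a v) = pushMap π a (J v) := by
  rw [inducedJ_apply, ← pushAt_apply hπ, ← pushAt_apply hπ, LinearEquiv.symm_apply_apply]

theorem inducedG_pushMap (a : G) (v w : E) :
    inducedG hπ g (π a) (pushMap π a v) (pushMap π a w) = g v w := by
  rw [inducedG_apply, ← pushAt_apply hπ, ← pushAt_apply hπ, LinearEquiv.symm_apply_apply,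
    LinearEquiv.symm_apply_apply]

variable {a : G} {z : E}

theorem inducedJ_fr (hz : z ∈ (groupChart hπ.isLocalDiffeomorph a).U) (v : E) :
    inducedJ hπ J ((groupChart hπ.isLocalDiffeomorph a).Ψ z)
      ((groupChart hπ.isLocalDiffeomorph a).fr z v) =
      (groupChart hπ.isLocalDiffeomorph a).fr z (J v) := by
  rw [groupChart_fr _ hz, groupChart_fr _ hz]
  exact inducedJ_pushMap hπ J ((extChartAt 𝓘(ℝ, E) a).symm z) v

theorem inducedG_fr (hz : z ∈ (groupChart hπ.isLocalDiffeomorph a).U) (v w : E) :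
    inducedG hπ g ((groupChart hπ.isLocalDiffeomorph a).Ψ z)
      ((groupChart hπ.isLocalDiffeomorph a).fr z v)
      ((groupChart hπ.isLocalDiffeomorph a).fr z w) = g v w := by
  rw [groupChart_fr _ hz, groupChart_fr _ hz]
  exact inducedG_pushMap hπ g ((extChartAt 𝓘(ℝ, E) a).symm z) v w

omit [FiniteDimensional ℝ E] [CompleteSpace E] [IsManifold 𝓘(ℝ, E) ∞ M] in
theorem FrameChart.fr_Θinv_hat [CompleteSpace E] [IsManifold 𝓘(ℝ, E) ∞ M]
    {br : E → E → E} {F : FrameChart E M br} (hz : z ∈ F.U)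
    (X : VecField E M) : X (F.Ψ z) = F.fr z (F.Θinv z (F.hat X z)) := by
  rw [fr, Θ_Θinv hz]
  exact (dΨ_hat hz X).symm

omit [FiniteDimensional ℝ E] [CompleteSpace E] [IsManifold 𝓘(ℝ, E) ∞ M] in
theorem FrameChart.contDiffAt_Θinv_hat [CompleteSpace E] [IsManifold 𝓘(ℝ, E) ∞ M]
    {br : E → E → E} {F : FrameChart E M br} (hz : z ∈ F.U)
    {X : VecField E M} (hX : X.Smooth) : ContDiffAt ℝ ∞ (fun z => F.Θinv z (F.hat X z)) z :=
  (contDiffAt_Θinv hz).clm_apply (contDiffAt_hat hz (hX _))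

/-- A smooth field has smooth coefficients in the invariant frame, and J acts on these coefficients
by a constant matrix. -/
theorem inducedJ_smooth {X : VecField E M} (hX : X.Smooth) :
    VecField.Smooth (E := E) (M := M) fun x => inducedJ hπ J x (X x) := by
  intro x
  obtain ⟨a, rfl⟩ := hπ.surjective x
  set F := groupChart hπ.isLocalDiffeomorph a
  have hy := mem_groupChart_U hπ.isLocalDiffeomorph a
  have := FrameChart.contMDiffAt_vecField (F := F)
    (X := fun x => inducedJ hπ J x (X x))
    (ξ := fun z => J.toContinuousLinearMap (F.Θinv z (F.hat X z))) hy
    ((J.toContinuousLinearMap).contDiff.contDiffAt.comp _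
      (FrameChart.contDiffAt_Θinv_hat hy hX)) (fun z hz => by
      rw [FrameChart.fr_Θinv_hat hz X]
      exact inducedJ_fr hπ J hz _)
  rwa [groupChart_Ψ_self] at this

theorem inducedG_smooth {X Y : VecField E M} (hX : X.Smooth) (hY : Y.Smooth) :
    ContMDiff 𝓘(ℝ, E) 𝓘(ℝ, ℝ) ∞ fun x => inducedG hπ g x (X x) (Y x) := by
  intro x
  obtain ⟨a, rfl⟩ := hπ.surjective x
  set F := groupChart hπ.isLocalDiffeomorph a with hF
  have hy := mem_groupChart_U hπ.isLocalDiffeomorph a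
  obtain ⟨f, hf, hfy, hfi⟩ := FrameChart.exists_inverse hy
  set y := extChartAt 𝓘(ℝ, E) a a
  set g' : E →L[ℝ] E →L[ℝ] ℝ := LinearMap.toContinuousLinearMap
    ((LinearMap.toContinuousLinearMap (𝕜 := ℝ) (E := E) (F' := ℝ)).toLinearMap ∘ₗ g) with hg'
  have h1 : ContDiffAt ℝ ∞
      (fun z => g' (F.Θinv z (F.hat X z)) (F.Θinv z (F.hat Y z))) y :=
    ((g'.contDiff.contDiffAt.comp _ (FrameChart.contDiffAt_Θinv_hat hy hX))).clm_apply
      (FrameChart.contDiffAt_Θinv_hat hy hY)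
  rw [← hfy] at h1
  have h2 := h1.contMDiffAt.comp _ hf
  rw [← hF, groupChart_Ψ_self] at h2
  refine h2.congr_of_eventuallyEq ?_
  rw [← hF, groupChart_Ψ_self] at hfi hf
  have hU : ∀ᶠ x in 𝓝 (π a), f x ∈ F.U :=
    hf.continuousAt.eventually (by
      rw [← groupChart_Ψ_self hπ.isLocalDiffeomorph a, hfy]; exact F.isOpen.mem_nhds hy)
  filter_upwards [hfi, hU] with x hx hxU
  have h7 : ∀ x' : M, x' = x → inducedG hπ g x (X x) (Y x) = inducedG hπ g x' (X x') (Y x') := by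
    rintro _ rfl; rfl
  rw [h7 _ hx, FrameChart.fr_Θinv_hat hxU X, FrameChart.fr_Θinv_hat hxU Y]
  exact inducedG_fr hπ g hxU _ _

variable {J g}

theorem inducedJ_inducedJ (J_J : ∀ v, J (J v) = -v) (x : M) (v : E) :
    inducedJ hπ J x (inducedJ hπ J x v) = -v := by
  rw [inducedJ_apply, inducedJ_apply, LinearEquiv.symm_apply_apply, J_J, map_neg,
    LinearEquiv.apply_symm_apply]

theorem inducedG_inducedJ (g_J : ∀ v w, g (J v) (J w) = g v w) (x : M) (v w : E) :
    inducedG hπ g x (inducedJ hπ J x v) (inducedJ hπ J x w) = inducedG hπ g x v w := by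
  rw [inducedG_apply, inducedJ_apply, inducedJ_apply, LinearEquiv.symm_apply_apply,
    LinearEquiv.symm_apply_apply, g_J, inducedG_apply]

/-- The invariant Hermitian structure on `M` induced by a Hermitian structure on the Lie algebra
of `G`. -/
def inducedHermitian (J_J : ∀ v, J (J v) = -v)
    (hN : ∀ v w, groupBr E G (J v) (J w) - J (groupBr E G (J v) w) - J (groupBr E G v (J w))
      - groupBr E G v w = 0)
    (symm : ∀ v w, g v w = g w v) (pos : ∀ v, v ≠ 0 → 0 < g v v)
    (g_J : ∀ v w, g (J v) (J w) = g v w) : HermitianStructure E M where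
  J := inducedJ hπ J
  g := inducedG hπ g
  J_smooth X hX := inducedJ_smooth hπ J hX
  J_J := inducedJ_inducedJ hπ J_J
  integrable X Y hX hY x := by
    obtain ⟨a, rfl⟩ := hπ.surjective x
    have := FrameChart.nijenhuis_eq_zero (F := groupChart hπ.isLocalDiffeomorph a)
      (J := inducedJ hπ J) (J₀ := J.toContinuousLinearMap) (fun z hz v => inducedJ_fr hπ J hz v)
      J_J hN (mem_groupChart_U hπ.isLocalDiffeomorph a) hX hY
      (inducedJ_smooth hπ J hX) (inducedJ_smooth hπ J hY)
    rwa [groupChart_Ψ_self] at this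
  g_smooth X Y hX hY := inducedG_smooth hπ g hX hY
  g_symm x v w := symm _ _
  g_pos x v hv := pos _ fun h => hv ((pushAt hπ x).symm.map_eq_zero_iff.1 h)
  g_J := inducedG_inducedJ hπ g_J

include hπ in
theorem admits_of_isLieSKT
    {J : GroupLieAlgebra 𝓘(ℝ, E) G →ₗ[ℝ] GroupLieAlgebra 𝓘(ℝ, E) G}
    {g : GroupLieAlgebra 𝓘(ℝ, E) G →ₗ[ℝ] GroupLieAlgebra 𝓘(ℝ, E) G →ₗ[ℝ] ℝ}
    (h : IsLieSKT J g) : AdmitsInvariantSKT E π := by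
  have hh : (inducedHermitian (J := (show E →ₗ[ℝ] E from J))
      (g := (show E →ₗ[ℝ] E →ₗ[ℝ] ℝ from g)) hπ h.J_J h.integrable h.symm h.pos
      h.g_J).IsInducedBy π (show E →ₗ[ℝ] E from J) (show E →ₗ[ℝ] E →ₗ[ℝ] ℝ from g) :=
    ⟨fun a v => inducedJ_pushMap hπ (show E →ₗ[ℝ] E from J) a v,
      fun a v w => inducedG_pushMap hπ (show E →ₗ[ℝ] E →ₗ[ℝ] ℝ from g) a v w⟩
  exact ⟨_, ⟨⟨fun v => J v, hh.hJ⟩, ⟨fun v w => g v w, hh.hg⟩⟩,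
    (isSKT_iff hπ hh).2 ⟨h.closed, h.nonclosed⟩⟩

end Induced

/-! ### Strong KT structures on the four algebras, and their elementary invariants -/

section Existence

/-- Strong KT structures are transported by isomorphisms. -/
theorem IsLieSKT.comap {L L' : Type*} [LieRing L] [LieAlgebra ℝ L] [LieRing L'] [LieAlgebra ℝ L']
    (e : L ≃ₗ⁅ℝ⁆ L') {J : L' →ₗ[ℝ] L'} {g : L' →ₗ[ℝ] L' →ₗ[ℝ] ℝ} (h : IsLieSKT J g) :
    ∃ (J' : L →ₗ[ℝ] L) (g' : L →ₗ[ℝ] L →ₗ[ℝ] ℝ), IsLieSKT J' g' := by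
  set J' : L →ₗ[ℝ] L := e.symm.toLinearEquiv.toLinearMap ∘ₗ J ∘ₗ e.toLinearEquiv.toLinearMap
  set g' : L →ₗ[ℝ] L →ₗ[ℝ] ℝ :=
    g.compl₁₂ e.toLinearEquiv.toLinearMap e.toLinearEquiv.toLinearMap
  have hJ : ∀ x, e (J' x) = J (e x) := fun x => e.apply_symm_apply _
  have hg : ∀ x y, g' x y = g (e x) (e y) := fun x y => rfl
  have hl : ∀ x y, e ⁅x, y⁆ = ⁅e x, e y⁆ := fun x y => LieHom.map_lie e.toLieHom x y
  have hd : ∀ x y z, dOmega J' g' x y z = dOmega J g (e x) (e y) (e z) := by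
    intro x y z
    simp only [dOmega, hg, hJ, hl]
  refine ⟨J', g', ?_, ?_, ?_, ?_, ?_, ?_, ?_⟩
  · intro x
    refine e.injective ?_
    change e (J' (J' x)) = e (-x)
    rw [hJ, hJ, h.J_J, map_neg]
  · intro x y
    refine e.injective ?_
    change e _ = e 0
    simp only [map_sub, hJ, hl, h.integrable, map_zero]
  · intro x y
    exact h.symm _ _
  · intro x hx
    exact h.pos _ fun h0 => hx (e.injective (h0.trans e.map_zero.symm))
  · intro x y
    rw [hg, hJ, hJ, h.g_J, hg]
  · intro x y z w
    simp only [torsion, hd, hJ, hl]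
    exact h.closed (e x) (e y) (e z) (e w)
  · obtain ⟨x, y, z, hxyz⟩ := h.nonclosed
    refine ⟨e.symm x, e.symm y, e.symm z, ?_⟩
    rwa [hd, e.apply_symm_apply, e.apply_symm_apply, e.apply_symm_apply]

/-- The strong KT condition when `[L, L] + J[L, L]` is central. -/
theorem IsLieSKT.of_central {L : Type*} [LieRing L] [LieAlgebra ℝ L] {J : L →ₗ[ℝ] L}
    {g : L →ₗ[ℝ] L →ₗ[ℝ] ℝ} (J_J : ∀ x, J (J x) = -x)
    (integrable : ∀ x y, ⁅J x, J y⁆ - J ⁅J x, y⁆ - J ⁅x, J y⁆ - ⁅x, y⁆ = 0)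
    (symm : ∀ x y, g x y = g y x) (pos : ∀ x, x ≠ 0 → 0 < g x x)
    (g_J : ∀ x y, g (J x) (J y) = g x y) (central : ∀ x y z : L, ⁅J ⁅x, y⁆, z⁆ = 0)
    (closed : ∀ x y z w, (g ⁅J z, J w⁆ ⁅x, y⁆ : ℝ) - g ⁅J y, J w⁆ ⁅x, z⁆ + g ⁅J y, J z⁆ ⁅x, w⁆
      + g ⁅J x, J w⁆ ⁅y, z⁆ - g ⁅J x, J z⁆ ⁅y, w⁆ + g ⁅J x, J y⁆ ⁅z, w⁆ = 0)
    (nonabelian : ∃ x y : L, ⁅x, y⁆ ≠ 0) :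
    IsLieSKT J g := by
  refine ⟨J_J, integrable, symm, pos, g_J, ?_, ?_⟩
  · intro x y z w
    have h : ∀ a b c d : L, torsion J g ⁅a, b⁆ c d = -g ⁅J c, J d⁆ ⁅a, b⁆ := by
      intro a b c d
      simp only [torsion, dOmega, central, map_zero, LinearMap.zero_apply, g_J]
      ring
    simp only [h]
    linarith [closed x y z w]
  · obtain ⟨x, y, h⟩ := nonabelian
    -- As J⁅x, y⁆ is central, dΩ on this triple equals −|⁅x, y⁆|².
    refine ⟨x, y, J ⁅x, y⁆, ?_⟩
    have h1 : ∀ u, ⁅u, J ⁅x, y⁆⁆ = 0 := fun u => by rw [← lie_skew, central, neg_zero]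
    simp only [dOmega, h1, map_zero, LinearMap.zero_apply, g_J]
    have := pos _ h
    intro h2
    linarith

/-- The standard metric on `ℝ⁶`. -/
def diagMetric : (Fin 6 → ℝ) →ₗ[ℝ] (Fin 6 → ℝ) →ₗ[ℝ] ℝ :=
  LinearMap.mk₂ ℝ (fun x y : Fin 6 → ℝ =>
      x 0 * y 0 + x 1 * y 1 + x 2 * y 2 + x 3 * y 3 + x 4 * y 4 + x 5 * y 5)
    (fun x y z => by simp only [Pi.add_apply]; ring)
    (fun r x y => by simp only [Pi.smul_apply, smul_eq_mul]; ring)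
    (fun x y z => by simp only [Pi.add_apply]; ring)
    (fun r x y => by simp only [Pi.smul_apply, smul_eq_mul]; ring)

theorem diagMetric_apply (x y : Fin 6 → ℝ) : diagMetric x y =
    x 0 * y 0 + x 1 * y 1 + x 2 * y 2 + x 3 * y 3 + x 4 * y 4 + x 5 * y 5 := rfl

theorem diagMetric_pos (x : Fin 6 → ℝ) (hx : x ≠ 0) :
    0 < diagMetric x x := by
  rw [diagMetric_apply]
  by_contra! h
  apply hx
  have h5 := mul_self_nonneg (x 5)
  have h0 := mul_self_nonneg (x 0)
  have h1 := mul_self_nonneg (x 1)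
  have h2 := mul_self_nonneg (x 2)
  have h3 := mul_self_nonneg (x 3)
  have h4 := mul_self_nonneg (x 4)
  ext i
  fin_cases i <;> refine mul_self_eq_zero.1 ?_ <;> simp only [Fin.zero_eta, Fin.mk_one,
    Fin.reduceFinMk, Fin.isValue] <;> linarith

/-- The complex structure `e₁ ↦ e₃ + 2/√3 e₂`, `e₃ ↦ -e₁ + 2/√3 e₄`, `e₄ ↦ e₂`, `e₅ ↦ √3 e₆`. -/
def complexStructure₁ : (Fin 6 → ℝ) →ₗ[ℝ] (Fin 6 → ℝ) where
  toFun x := ![-x 2, 2 * (√3)⁻¹ * x 0 + x 3, x 0, -x 1 + 2 * (√3)⁻¹ * x 2, -(√3)⁻¹ * x 5,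
    √3 * x 4]
  map_add' x y := by ext i; fin_cases i <;> simp <;> ring
  map_smul' c x := by ext i; fin_cases i <;> simp <;> ring

/-- Coordinates orthonormal for the metric compatible with `complexStructure₁`. -/
def metricCoordinates₁ : (Fin 6 → ℝ) →ₗ[ℝ] (Fin 6 → ℝ) where
  toFun x := ![(√3)⁻¹ * x 0, (√3)⁻¹ * x 2, x 3 + (√3)⁻¹ * x 0, x 1 - (√3)⁻¹ * x 2, x 4,
    (√3)⁻¹ * x 5]
  map_add' x y := by ext i; fin_cases i <;> simp <;> ring
  map_smul' c x := by ext i; fin_cases i <;> simp <;> ring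

/-- The complex structure `e₁ ↦ e₃ + e₄`, `e₄ ↦ -e₁ + e₂`, `e₂ ↦ e₃`, `e₆ ↦ e₅` on `ℝ⁶`. -/
def complexStructure₂ : (Fin 6 → ℝ) →ₗ[ℝ] (Fin 6 → ℝ) where
  toFun x := ![-x 3, x 3 - x 2, x 0 + x 1, x 0, x 5, -x 4]
  map_add' x y := by ext i; fin_cases i <;> simp <;> ring
  map_smul' c x := by ext i; fin_cases i <;> simp <;> ring

/-- Coordinates orthonormal for the metric compatible with `complexStructure₂`. -/
def metricCoordinates₂ : (Fin 6 → ℝ) →ₗ[ℝ] (Fin 6 → ℝ) where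
  toFun x := ![x 0, x 3, x 0 + x 1, x 2, x 4, x 5]
  map_add' x y := by ext i; fin_cases i <;> simp <;> ring
  map_smul' c x := by ext i; fin_cases i <;> simp <;> ring

/-- The standard metric in linear coordinates. -/
def pullMetric (A : (Fin 6 → ℝ) →ₗ[ℝ] (Fin 6 → ℝ)) : (Fin 6 → ℝ) →ₗ[ℝ] (Fin 6 → ℝ) →ₗ[ℝ] ℝ :=
  diagMetric.compl₁₂ A A

theorem pullMetric_apply (A : (Fin 6 → ℝ) →ₗ[ℝ] (Fin 6 → ℝ)) (x y : Fin 6 → ℝ) :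
    pullMetric A x y = diagMetric (A x) (A y) := rfl

theorem metricCoordinates₁_injective (x : Fin 6 → ℝ) (h : metricCoordinates₁ x = 0) : x = 0 := by
  have h0 := congrFun h 0
  have h1 := congrFun h 1
  have h2 := congrFun h 2
  have h3 := congrFun h 3
  have h4 := congrFun h 4
  have h5 := congrFun h 5
  simp [metricCoordinates₁] at h0 h1 h2 h3 h4 h5
  rw [h0] at h2
  rw [h1] at h3
  ext i
  fin_cases i <;> simp [*] <;> linarith

theorem metricCoordinates₂_injective (x : Fin 6 → ℝ) (h : metricCoordinates₂ x = 0) : x = 0 := by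
  have h0 := congrFun h 0
  have h1 := congrFun h 1
  have h2 := congrFun h 2
  have h3 := congrFun h 3
  have h4 := congrFun h 4
  have h5 := congrFun h 5
  simp [metricCoordinates₂] at h0 h1 h2 h3 h4 h5
  rw [h0] at h2
  ext i
  fin_cases i <;> simp [*] <;> linarith

/-- The complex structure `e₁ ↦ e₂`, `e₃ ↦ e₄`, `e₅ ↦ e₆` on `ℝ⁶`. -/
def complexStructure₃ : (Fin 6 → ℝ) →ₗ[ℝ] (Fin 6 → ℝ) where
  toFun x := ![-x 1, x 0, -x 3, x 2, -x 5, x 4]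
  map_add' x y := by ext i; fin_cases i <;> simp <;> ring
  map_smul' c x := by ext i; fin_cases i <;> simp

theorem StrAlg.isLieSKT {β γ : List (Fin 4 × Fin 4)} {J : (Fin 6 → ℝ) →ₗ[ℝ] (Fin 6 → ℝ)}
    {g : (Fin 6 → ℝ) →ₗ[ℝ] (Fin 6 → ℝ) →ₗ[ℝ] ℝ} (J_J : ∀ x, J (J x) = -x)
    (integrable : ∀ x y, br β γ (J x) (J y) - J (br β γ (J x) y) - J (br β γ x (J y))
      - br β γ x y = 0)
    (symm : ∀ x y, g x y = g y x) (pos : ∀ x, x ≠ 0 → 0 < g x x)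
    (g_J : ∀ x y, g (J x) (J y) = g x y) (central : ∀ x y z, br β γ (J (br β γ x y)) z = 0)
    (closed : ∀ x y z w, g (br β γ (J z) (J w)) (br β γ x y) - g (br β γ (J y) (J w)) (br β γ x z)
      + g (br β γ (J y) (J z)) (br β γ x w) + g (br β γ (J x) (J w)) (br β γ y z)
      - g (br β γ (J x) (J z)) (br β γ y w) + g (br β γ (J x) (J y)) (br β γ z w) = 0)
    (nonabelian : ∃ x y, br β γ x y ≠ 0) :
    IsLieSKT (L := StrAlg β γ) J g :=
  IsLieSKT.of_central (L := StrAlg β γ) J_J integrable symm pos g_J central closed nonabelian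

theorem isLieSKT_complexStructure₁ : IsLieSKT (L := StrAlg [(0, 2), (3, 1)] [(0, 3), (1, 2)])
    complexStructure₁ (pullMetric metricCoordinates₁) := by
  have h3 : √3 * √3 = (3 : ℝ) := by simp
  have h2 : √3 ^ 2 = (3 : ℝ) := by simp
  have hi2 : (√3)⁻¹ ^ 2 = (1 / 3 : ℝ) := by rw [inv_pow, h2]; norm_num
  have hinv : (√3)⁻¹ = (√3 / 3 : ℝ) := by
    have : (0 : ℝ) < √3 := by positivity
    field_simp
    rw [h2]
  -- The basis √3e₁−e₄, √3e₃+e₂, e₄, e₂, e₅, √3e₆ is orthonormal, and J sends the first vector of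
  -- each consecutive pair to the second. With X, Y the first and third vectors, [X, JX] = 2[Y, JY]
  -- (from 3 − 1 = 2, whence the √3), and the four mixed brackets have length 1 for |[Y, JY]| = 1.
  -- SKT then reads 2·2 = 1 + 1 + 1 + 1.
  refine StrAlg.isLieSKT ?_ ?_ ?_
    (fun x hx => diagMetric_pos _ fun h => hx (metricCoordinates₁_injective x h)) ?_ ?_ ?_ ?_
  · intro x
    ext i
    fin_cases i <;> simp [complexStructure₁] <;> ring
  · intro x y
    ext i
    fin_cases i <;> simp [complexStructure₁, StrAlg.br, twoForm, hinv] <;> ring_nf <;>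
      simp only [h2] <;> ring
  · intro x y
    simp only [pullMetric_apply, diagMetric_apply]; ring
  · intro x y
    simp [pullMetric_apply, diagMetric_apply, complexStructure₁, metricCoordinates₁]
    simp only [hinv]
    ring_nf
  · intro x y z
    ext i
    fin_cases i <;> simp [complexStructure₁, StrAlg.br, twoForm]
  · intro x y z w
    simp [complexStructure₁, StrAlg.br, twoForm, pullMetric_apply, diagMetric_apply,
      metricCoordinates₁]
    ring_nf
    simp only [hi2]
    ring
  · refine ⟨Pi.single 0 1, Pi.single 2 1, fun h => ?_⟩
    have := congrFun h 4
    simp [StrAlg.br, twoForm] at this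

theorem isLieSKT_complexStructure₂ : IsLieSKT (L := StrAlg [(0, 1)] [(0, 3), (1, 2)])
    complexStructure₂ (pullMetric metricCoordinates₂) := by
  -- Here the orthonormal basis is e₁−e₂, e₄, e₂, e₃, e₆, e₅, again with J pairing consecutive
  -- vectors. Now [X, JX] = [Y, JY], two mixed brackets have length 1 and two vanish, so SKT reads
  -- 2·1 = 1 + 1.
  refine StrAlg.isLieSKT ?_ ?_ ?_
    (fun x hx => diagMetric_pos _ fun h => hx (metricCoordinates₂_injective x h)) ?_ ?_ ?_ ?_
  · intro x
    ext i
    fin_cases i <;> simp [complexStructure₂]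
    ring
  · intro x y
    ext i
    fin_cases i <;> simp [complexStructure₂, StrAlg.br, twoForm] <;> ring
  · intro x y
    simp only [pullMetric_apply, diagMetric_apply]; ring
  · intro x y
    simp [pullMetric_apply, diagMetric_apply, complexStructure₂, metricCoordinates₂]
    ring
  · intro x y z
    ext i
    fin_cases i <;> simp [complexStructure₂, StrAlg.br, twoForm]
  · intro x y z w
    simp [complexStructure₂, StrAlg.br, twoForm, pullMetric_apply, diagMetric_apply,
      metricCoordinates₂]
    ring
  · refine ⟨Pi.single 0 1, Pi.single 1 1, fun h => ?_⟩
    have := congrFun h 4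
    simp [StrAlg.br, twoForm] at this

theorem isLieSKT_complexStructure₃ : IsLieSKT (L := StrAlg [(0, 1)] [(2, 3)])
    complexStructure₃ diagMetric := by
  refine StrAlg.isLieSKT ?_ ?_ ?_ diagMetric_pos ?_ ?_ ?_ ?_
  · intro x
    ext i
    fin_cases i <;> simp [complexStructure₃]
  · intro x y
    ext i
    fin_cases i <;> simp [complexStructure₃, StrAlg.br, twoForm] <;> ring
  · intro x y
    simp only [diagMetric_apply]; ring
  · intro x y
    simp [diagMetric_apply, complexStructure₃]
    ring
  · intro x y z
    ext i
    fin_cases i <;> simp [complexStructure₃, StrAlg.br, twoForm]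
  · intro x y z w
    simp [complexStructure₃, StrAlg.br, twoForm, diagMetric_apply]
    ring
  · refine ⟨Pi.single 0 1, Pi.single 1 1, fun h => ?_⟩
    have := congrFun h 4
    simp [StrAlg.br, twoForm] at this

theorem isLieSKT_complexStructure₃' : IsLieSKT (L := StrAlg [] [(0, 1)])
    complexStructure₃ diagMetric := by
  refine StrAlg.isLieSKT ?_ ?_ ?_ diagMetric_pos ?_ ?_ ?_ ?_
  · intro x
    ext i
    fin_cases i <;> simp [complexStructure₃]
  · intro x y
    ext i
    fin_cases i <;> simp [complexStructure₃, StrAlg.br, twoForm] <;> ring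
  · intro x y
    simp only [diagMetric_apply]; ring
  · intro x y
    simp [diagMetric_apply, complexStructure₃]
    ring
  · intro x y z
    ext i
    fin_cases i <;> simp [complexStructure₃, StrAlg.br, twoForm]
  · intro x y z w
    simp [complexStructure₃, StrAlg.br, twoForm, diagMetric_apply]
    ring
  · refine ⟨Pi.single 0 1, Pi.single 1 1, fun h => ?_⟩
    have := congrFun h 5
    simp [StrAlg.br, twoForm] at this

variable {L : Type*} [LieRing L] [LieAlgebra ℝ L]

theorem IsOneOfFour.exists_isLieSKT (h : IsOneOfFour L) :
    ∃ (J : L →ₗ[ℝ] L) (g : L →ₗ[ℝ] L →ₗ[ℝ] ℝ), IsLieSKT J g := by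
  rcases h with ⟨⟨e⟩⟩ | ⟨⟨e⟩⟩ | ⟨⟨e⟩⟩ | ⟨⟨e⟩⟩
  · exact isLieSKT_complexStructure₁.comap e
  · exact isLieSKT_complexStructure₂.comap e
  · exact isLieSKT_complexStructure₃.comap e
  · exact isLieSKT_complexStructure₃'.comap e

theorem lowerCentralSeries_one_ne_bot_iff :
    LieModule.lowerCentralSeries ℝ L L 1 ≠ ⊥ ↔ ∃ x y : L, ⁅x, y⁆ ≠ 0 := by
  rw [LieModule.lowerCentralSeries_succ, LieModule.lowerCentralSeries_zero, ne_eq,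
    LieSubmodule.lie_eq_bot_iff]
  push Not
  simp

theorem lowerCentralSeries_two_eq_bot_iff :
    LieModule.lowerCentralSeries ℝ L L 2 = ⊥ ↔ ∀ x y z : L, ⁅x, ⁅y, z⁆⁆ = 0 := by
  rw [LieModule.lowerCentralSeries_succ, LieSubmodule.lie_eq_bot_iff]
  constructor
  · intro h x y z
    refine h x trivial _ ?_
    rw [LieModule.lowerCentralSeries_succ]
    exact LieSubmodule.lie_mem_lie trivial trivial
  · intro h x _ m hm
    rw [LieModule.lowerCentralSeries_succ, ← LieSubmodule.mem_toSubmodule,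
      LieSubmodule.lieIdeal_oper_eq_linear_span'] at hm
    induction hm using Submodule.span_induction with
    | mem m hm =>
      obtain ⟨y, _, z, _, rfl⟩ := hm
      exact h x y z
    | zero => simp
    | add a b _ _ ha hb => rw [lie_add, ha, hb, add_zero]
    | smul c a _ ha => rw [lie_smul, ha, smul_zero]

theorem StrAlg.exists_bracket (h : IsOneOfFour L) : ∃ β γ : List (Fin 4 × Fin 4),
    Nonempty (L ≃ₗ⁅ℝ⁆ StrAlg β γ) ∧ ∃ x y : StrAlg β γ, ⁅x, y⁆ ≠ 0 := by
  rcases h with h | h | h | h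
  · refine ⟨_, _, h, (Pi.single 0 1 : Fin 6 → ℝ), (Pi.single 2 1 : Fin 6 → ℝ), fun h => ?_⟩
    have : StrAlg.br _ _ _ _ = 0 := h
    simpa [StrAlg.br, twoForm] using congrFun this 4
  · refine ⟨_, _, h, (Pi.single 0 1 : Fin 6 → ℝ), (Pi.single 1 1 : Fin 6 → ℝ), fun h => ?_⟩
    have : StrAlg.br _ _ _ _ = 0 := h
    simpa [StrAlg.br, twoForm] using congrFun this 4
  · refine ⟨_, _, h, (Pi.single 0 1 : Fin 6 → ℝ), (Pi.single 1 1 : Fin 6 → ℝ), fun h => ?_⟩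
    have : StrAlg.br _ _ _ _ = 0 := h
    simpa [StrAlg.br, twoForm] using congrFun this 4
  · refine ⟨_, _, h, (Pi.single 0 1 : Fin 6 → ℝ), (Pi.single 1 1 : Fin 6 → ℝ), fun h => ?_⟩
    have : StrAlg.br _ _ _ _ = 0 := h
    simpa [StrAlg.br, twoForm] using congrFun this 5

theorem IsOneOfFour.isTwoStep (h : IsOneOfFour L) : IsTwoStep L := by
  obtain ⟨β, γ, ⟨e⟩, x, y, hxy⟩ := StrAlg.exists_bracket h
  have hl : ∀ x y, e ⁅x, y⁆ = ⁅e x, e y⁆ := fun x y => LieHom.map_lie e.toLieHom x y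
  refine ⟨lowerCentralSeries_two_eq_bot_iff.2 fun x y z => e.injective ?_,
    lowerCentralSeries_one_ne_bot_iff.2 ⟨e.symm x, e.symm y, fun h0 => hxy ?_⟩⟩
  · change e _ = e 0
    rw [hl, hl, map_zero]
    exact StrAlg.br_br_right _ _ _
  · have := congrArg e h0
    rwa [hl, e.apply_symm_apply, e.apply_symm_apply, map_zero] at this

/-- The coordinate forms e¹, …, e⁴ vanish on brackets and are independent. -/
theorem IsOneOfFour.four_le_lieBettiOne (h : IsOneOfFour L) : 4 ≤ lieBettiOne L := by
  obtain ⟨β, γ, ⟨e⟩, -⟩ := StrAlg.exists_bracket h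
  have hl : ∀ x y, e ⁅x, y⁆ = ⁅e x, e y⁆ := fun x y => LieHom.map_lie e.toLieHom x y
  have : FiniteDimensional ℝ (StrAlg β γ) := inferInstanceAs (FiniteDimensional ℝ (Fin 6 → ℝ))
  have : FiniteDimensional ℝ L := e.toLinearEquiv.symm.finiteDimensional
  let ev : Fin 4 → Module.Dual ℝ L := fun i =>
    (LinearMap.proj (R := ℝ) (φ := fun _ : Fin 6 => ℝ) (i.castLE (by decide))) ∘ₗ
      (e.toLinearEquiv.toLinearMap : L →ₗ[ℝ] (Fin 6 → ℝ))
  have hev : ∀ i x, ev i x = (e x : Fin 6 → ℝ) (i.castLE (by decide)) := fun i x => rfl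
  let B : (Fin 4 → ℝ) →ₗ[ℝ] lieClosedOneForms L :=
    LinearMap.codRestrict _ (Fintype.linearCombination ℝ ev) fun c x y => by
      have h0 : ∀ i, ev i ⁅x, y⁆ = 0 := fun i => by
        rw [hev, hl]
        fin_cases i <;> rfl
      rw [Fintype.linearCombination_apply, LinearMap.sum_apply]
      simp only [LinearMap.smul_apply, h0, smul_zero, Finset.sum_const_zero]
  have hB : Function.Injective B := by
    refine (injective_iff_map_eq_zero B).2 fun c hc => ?_
    ext i
    obtain ⟨x, hx⟩ := e.surjective (Pi.single (i.castLE (by decide)) 1 : Fin 6 → ℝ)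
    have h0 : (B c : Module.Dual ℝ L) x = ∑ j, c j * ev j x := by
      change (Fintype.linearCombination ℝ ev c) x = _
      rw [Fintype.linearCombination_apply, LinearMap.sum_apply]
      rfl
    have h1 : (B c : Module.Dual ℝ L) x = 0 := by rw [hc]; rfl
    have h2 : ∀ j, ev j x = (Pi.single (i.castLE (by decide)) 1 : Fin 6 → ℝ)
        (j.castLE (by decide)) := fun j => (hev j x).trans (congrFun hx _)
    rw [h0, Finset.sum_eq_single i, h2] at h1
    · simpa using h1
    · intro j _ hj
      rw [h2, Pi.single_apply, if_neg (fun h => hj (by simpa [Fin.ext_iff] using h)), mul_zero]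
    · simp
  have h4 := LinearMap.finrank_le_finrank_of_injective hB
  rw [Module.finrank_fin_fun] at h4
  exact h4

end Existence

/-! ### Recognizing the four algebras from bracket relations -/

section NormalForm

variable {L : Type*} [LieRing L] [LieAlgebra ℝ L]

/-- A Lie algebra spanned by six vectors satisfying the brackets of `StrAlg β γ` is isomorphic to
it. -/
theorem nonempty_equiv_strAlg (hdim : Module.finrank ℝ L = 6) {f0 f1 f2 f3 f4 f5 : L}
    (hf : ⊤ ≤ Submodule.span ℝ (Set.range ![f0, f1, f2, f3, f4, f5]))
    {β γ : List (Fin 4 × Fin 4)} (h4 : ∀ v : L, ⁅f4, v⁆ = 0) (h5 : ∀ v : L, ⁅f5, v⁆ = 0)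
    (b01 b02 b03 b12 b13 b23 c01 c02 c03 c12 c13 c23 : ℝ)
    (k01 : ⁅f0, f1⁆ = -b01 • f4 - c01 • f5)
    (k02 : ⁅f0, f2⁆ = -b02 • f4 - c02 • f5)
    (k03 : ⁅f0, f3⁆ = -b03 • f4 - c03 • f5)
    (k12 : ⁅f1, f2⁆ = -b12 • f4 - c12 • f5)
    (k13 : ⁅f1, f3⁆ = -b13 • f4 - c13 • f5)
    (k23 : ⁅f2, f3⁆ = -b23 • f4 - c23 • f5)
    (hβ : ∀ x y, twoForm β x y = b01 * (x 0 * y 1 - x 1 * y 0) +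
      b02 * (x 0 * y 2 - x 2 * y 0) +
      b03 * (x 0 * y 3 - x 3 * y 0) +
      b12 * (x 1 * y 2 - x 2 * y 1) +
      b13 * (x 1 * y 3 - x 3 * y 1) +
      b23 * (x 2 * y 3 - x 3 * y 2))
    (hγ : ∀ x y, twoForm γ x y = c01 * (x 0 * y 1 - x 1 * y 0) +
      c02 * (x 0 * y 2 - x 2 * y 0) +
      c03 * (x 0 * y 3 - x 3 * y 0) +
      c12 * (x 1 * y 2 - x 2 * y 1) +
      c13 * (x 1 * y 3 - x 3 * y 1) +
      c23 * (x 2 * y 3 - x 3 * y 2)) :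
    Nonempty (L ≃ₗ⁅ℝ⁆ StrAlg β γ) := by
  let B : Module.Basis (Fin 6) ℝ L := basisOfTopLeSpanOfCardEqFinrank _ hf (by simp [hdim])
  have hB : ∀ i, B i = ![f0, f1, f2, f3, f4, f5] i := fun i => by simp [B]
  let e : (Fin 6 → ℝ) ≃ₗ[ℝ] L := B.equivFun.symm
  have he : ∀ x : Fin 6 → ℝ, e x = x 0 • f0 + x 1 • f1 + x 2 • f2 + x 3 • f3 + x 4 • f4 +
      x 5 • f5 := fun x => by
    simp only [e, Module.Basis.equivFun_symm_apply, hB, Fin.sum_univ_six]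
    rfl
  have h4' : ∀ v, ⁅v, f4⁆ = 0 := fun v => by rw [← lie_skew, h4, neg_zero]
  have h5' : ∀ v, ⁅v, f5⁆ = 0 := fun v => by rw [← lie_skew, h5, neg_zero]
  have k10 : ⁅f1, f0⁆ = -(-b01 • f4 - c01 • f5) := by rw [← k01, lie_skew]
  have k20 : ⁅f2, f0⁆ = -(-b02 • f4 - c02 • f5) := by rw [← k02, lie_skew]
  have k30 : ⁅f3, f0⁆ = -(-b03 • f4 - c03 • f5) := by rw [← k03, lie_skew]
  have k21 : ⁅f2, f1⁆ = -(-b12 • f4 - c12 • f5) := by rw [← k12, lie_skew]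
  have k31 : ⁅f3, f1⁆ = -(-b13 • f4 - c13 • f5) := by rw [← k13, lie_skew]
  have k32 : ⁅f3, f2⁆ = -(-b23 • f4 - c23 • f5) := by rw [← k23, lie_skew]
  have hbr : ∀ x y : Fin 6 → ℝ, e (StrAlg.br β γ x y) = ⁅e x, e y⁆ := by
    intro x y
    rw [he (StrAlg.br β γ x y), he x, he y]
    simp only [add_lie, lie_add, smul_lie, lie_smul, h4, h5, h4', h5', k01, k02, k03, k12, k13,
      k23, k10, k20, k30, k21, k31, k32, lie_self]
    simp only [StrAlg.br, hβ, hγ, Matrix.cons_val]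
    module
  have hbr' : ∀ u v : L, e.symm ⁅u, v⁆ = StrAlg.br β γ (e.symm u) (e.symm v) := by
    intro u v
    apply e.injective
    rw [hbr, e.apply_symm_apply, e.apply_symm_apply, e.apply_symm_apply]
  exact ⟨{ e.symm with
    map_lie' := fun {u v} => hbr' u v }⟩

theorem range_subset_of_six {a0 a1 a2 a3 a4 a5 : L} {S : Submodule ℝ L} (h0 : a0 ∈ S)
    (h1 : a1 ∈ S) (h2 : a2 ∈ S) (h3 : a3 ∈ S) (h4 : a4 ∈ S) (h5 : a5 ∈ S) :
    Submodule.span ℝ (Set.range ![a0, a1, a2, a3, a4, a5]) ≤ S := by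
  rw [Submodule.span_le]
  rintro _ ⟨i, rfl⟩
  fin_cases i <;> assumption

theorem mem_span_six (a0 a1 a2 a3 a4 a5 : L) :
    a0 ∈ Submodule.span ℝ (Set.range ![a0, a1, a2, a3, a4, a5]) ∧
    a1 ∈ Submodule.span ℝ (Set.range ![a0, a1, a2, a3, a4, a5]) ∧
    a2 ∈ Submodule.span ℝ (Set.range ![a0, a1, a2, a3, a4, a5]) ∧
    a3 ∈ Submodule.span ℝ (Set.range ![a0, a1, a2, a3, a4, a5]) ∧
    a4 ∈ Submodule.span ℝ (Set.range ![a0, a1, a2, a3, a4, a5]) ∧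
    a5 ∈ Submodule.span ℝ (Set.range ![a0, a1, a2, a3, a4, a5]) :=
  ⟨Submodule.subset_span ⟨0, rfl⟩, Submodule.subset_span ⟨1, rfl⟩, Submodule.subset_span ⟨2, rfl⟩,
    Submodule.subset_span ⟨3, rfl⟩, Submodule.subset_span ⟨4, rfl⟩, Submodule.subset_span ⟨5, rfl⟩⟩

/-- Criterion for `L` to be one of the first three algebras. -/
theorem isOneOfFour_of_pencil (hdim : Module.finrank ℝ L = 6) {e e' h h' w z : L} {κ : ℝ}
    (hs : ⊤ ≤ Submodule.span ℝ (Set.range ![e, e', h, h', w, z])) (hw : ∀ v : L, ⁅w, v⁆ = 0)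
    (hz : ∀ v : L, ⁅z, v⁆ = 0) (h1 : ⁅e, e'⁆ = 0) (h2 : ⁅h, h'⁆ = 0) (h3 : ⁅e, h⁆ = z)
    (h4 : ⁅e, h'⁆ = w) (h5 : ⁅e', h⁆ = w) (h6 : ⁅e', h'⁆ = κ • z) : IsOneOfFour L := by
  have h1' : ⁅e', e⁆ = 0 := by rw [← lie_skew, h1, neg_zero]
  have h2' : ⁅h', h⁆ = 0 := by rw [← lie_skew, h2, neg_zero]
  have h3' : ⁅h, e⁆ = -z := by rw [← lie_skew, h3]
  have h4' : ⁅h', e⁆ = -w := by rw [← lie_skew, h4]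
  have h5' : ⁅h, e'⁆ = -w := by rw [← lie_skew, h5]
  have h6' : ⁅h', e'⁆ = -κ • z := by rw [← lie_skew, h6, neg_smul]
  -- With e' = εe, h' = εh, w = εz and ε² = κ, the relations say that L is the Heisenberg algebra
  -- over ℝ[ε]/(ε² = κ): complex, dual or split numbers according to the sign of κ. The signs on z
  -- and w below come from dα(x, y) = −α([x, y]).
  rcases lt_trichotomy κ 0 with hκ | hκ | hκ
  · obtain ⟨k, hk, hk2⟩ : ∃ k : ℝ, k ≠ 0 ∧ κ = -(k * k) :=
      ⟨√(-κ), (Real.sqrt_pos.2 (by linarith)).ne', by rw [Real.mul_self_sqrt (by linarith)]; ring⟩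
    refine Or.inl (nonempty_equiv_strAlg hdim (f0 := e) (f1 := k⁻¹ • e') (f2 := h)
      (f3 := k⁻¹ • h') (f4 := -z) (f5 := -k⁻¹ • w) ?_ ?_ ?_ 0 1 0 0 (-1) 0 0 0 1 1 0 0
      ?_ ?_ ?_ ?_ ?_ ?_ ?_ ?_)
    · refine hs.trans ?_
      set S := Submodule.span ℝ (Set.range ![e, k⁻¹ • e', h, k⁻¹ • h', -z, -k⁻¹ • w])
      obtain ⟨m0, m1, m2, m3, m4, m5⟩ := mem_span_six e (k⁻¹ • e') h (k⁻¹ • h') (-z) (-k⁻¹ • w)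
      have hk' := inv_ne_zero hk
      exact range_subset_of_six m0 ((S.smul_mem_iff hk').1 m1) m2 ((S.smul_mem_iff hk').1 m3)
        ((S.smul_mem_iff (neg_ne_zero.2 hk')).1 m5) (S.neg_mem_iff.1 m4)
    · intro v; rw [neg_lie, hz, neg_zero]
    · intro v; rw [smul_lie, hw, smul_zero]
    · rw [lie_smul, h1]; simp
    · rw [h3]; module
    · rw [lie_smul, h4]; module
    · rw [smul_lie, h5]; module
    · rw [smul_lie, lie_smul, h6, hk2]
      match_scalars
      · field_simp
      · simp
    · rw [lie_smul, h2]; simp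
    · intro x y; simp [twoForm]
    · intro x y; simp [twoForm]
  · subst hκ
    refine Or.inr (Or.inl (nonempty_equiv_strAlg hdim (f0 := e) (f1 := h) (f2 := -e')
      (f3 := h') (f4 := -z) (f5 := -w) ?_ ?_ ?_ 1 0 0 0 0 0 0 0 1 1 0 0
      ?_ ?_ ?_ ?_ ?_ ?_ ?_ ?_))
    · refine hs.trans ?_
      set S := Submodule.span ℝ (Set.range ![e, h, -e', h', -z, -w])
      obtain ⟨m0, m1, m2, m3, m4, m5⟩ := mem_span_six e h (-e') h' (-z) (-w)
      exact range_subset_of_six m0 (S.neg_mem_iff.1 m2) m1 m3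
        (S.neg_mem_iff.1 m5) (S.neg_mem_iff.1 m4)
    · intro v; rw [neg_lie, hz, neg_zero]
    · intro v; rw [neg_lie, hw, neg_zero]
    · rw [h3]; module
    · rw [lie_neg, h1]; module
    · rw [h4]; module
    · rw [lie_neg, h5']; module
    · rw [h2]; module
    · rw [neg_lie, h6]; module
    · intro x y; simp [twoForm]
    · intro x y; simp [twoForm]
  · obtain ⟨k, hk, hk2⟩ : ∃ k : ℝ, k ≠ 0 ∧ κ = k * k :=
      ⟨√κ, (Real.sqrt_pos.2 hκ).ne', by rw [Real.mul_self_sqrt hκ.le]⟩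
    -- For κ = k² the elements 1 ± ε/k are multiples of orthogonal idempotents; multiplying e and h
    -- by them splits L into two real Heisenberg algebras.
    refine Or.inr (Or.inr (Or.inl (nonempty_equiv_strAlg hdim (f0 := e + k⁻¹ • e')
      (f1 := h + k⁻¹ • h') (f2 := e - k⁻¹ • e') (f3 := h - k⁻¹ • h')
      (f4 := -((2 : ℝ) • z + (2 * k⁻¹) • w)) (f5 := -((2 : ℝ) • z - (2 * k⁻¹) • w))
      ?_ ?_ ?_ 1 0 0 0 0 0 0 0 0 0 0 1 ?_ ?_ ?_ ?_ ?_ ?_ ?_ ?_)))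
    · refine hs.trans ?_
      set S := Submodule.span ℝ (Set.range ![e + k⁻¹ • e', h + k⁻¹ • h', e - k⁻¹ • e',
        h - k⁻¹ • h', -((2 : ℝ) • z + (2 * k⁻¹) • w), -((2 : ℝ) • z - (2 * k⁻¹) • w)])
      obtain ⟨m0, m1, m2, m3, m4, m5⟩ := mem_span_six (e + k⁻¹ • e') (h + k⁻¹ • h')
        (e - k⁻¹ • e') (h - k⁻¹ • h') (-((2 : ℝ) • z + (2 * k⁻¹) • w))
        (-((2 : ℝ) • z - (2 * k⁻¹) • w))
      refine range_subset_of_six ?_ ?_ ?_ ?_ ?_ ?_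
      · have := S.smul_mem (1 / 2 : ℝ) (S.add_mem m0 m2)
        convert this using 1
        module
      · have := S.smul_mem (k / 2 : ℝ) (S.sub_mem m0 m2)
        convert this using 1
        match_scalars <;> field_simp <;> norm_num
      · have := S.smul_mem (1 / 2 : ℝ) (S.add_mem m1 m3)
        convert this using 1
        module
      · have := S.smul_mem (k / 2 : ℝ) (S.sub_mem m1 m3)
        convert this using 1
        match_scalars <;> field_simp <;> norm_num
      · have := S.smul_mem (-k / 4 : ℝ) (S.sub_mem m4 m5)
        convert this using 1
        match_scalars <;> field_simp <;> norm_num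
      · have := S.smul_mem (-1 / 4 : ℝ) (S.add_mem m4 m5)
        convert this using 1
        match_scalars <;> field_simp <;> norm_num
    · intro v; simp [add_lie, hz, hw]
    · intro v; simp [sub_lie, hz, hw]
    all_goals try
      simp only [add_lie, sub_lie, lie_add, lie_sub, smul_lie, lie_smul, h1, h2, h3, h4, h5, h6,
        h1', h2', h3', h4', h5', h6', hk2, lie_self]
      match_scalars <;> field_simp <;> norm_num
    · intro x y; simp [twoForm]
    · intro x y; simp [twoForm]

/-- The algebras with `de⁵ = 0`. -/
theorem isOneOfFour_of_single (hdim : Module.finrank ℝ L = 6) {f0 f1 f2 f3 f4 f5 : L}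
    (hs : ⊤ ≤ Submodule.span ℝ (Set.range ![f0, f1, f2, f3, f4, f5])) (k01 : ⁅f0, f1⁆ = f5)
    (k02 : ⁅f0, f2⁆ = 0) (k03 : ⁅f0, f3⁆ = 0) (k12 : ⁅f1, f2⁆ = 0) (k13 : ⁅f1, f3⁆ = 0)
    (k23 : ⁅f2, f3⁆ = 0) (h4 : ∀ v : L, ⁅f4, v⁆ = 0) (h5 : ∀ v : L, ⁅f5, v⁆ = 0) :
    IsOneOfFour L := by
  refine Or.inr (Or.inr (Or.inr (nonempty_equiv_strAlg hdim (f0 := f0) (f1 := f1) (f2 := f2)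
    (f3 := f3) (f4 := f4) (f5 := -f5) ?_ h4 ?_ 0 0 0 0 0 0 1 0 0 0 0 0 ?_ ?_ ?_ ?_ ?_ ?_ ?_ ?_)))
  · refine hs.trans ?_
    obtain ⟨m0, m1, m2, m3, m4, m5⟩ := mem_span_six f0 f1 f2 f3 f4 (-f5)
    exact range_subset_of_six m0 m1 m2 m3 m4 (Submodule.neg_mem_iff _ |>.1 m5)
  · intro v; rw [neg_lie, h5, neg_zero]
  · rw [k01]; module
  · rw [k02]; module
  · rw [k03]; module
  · rw [k12]; module
  · rw [k13]; module
  · rw [k23]; module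
  · intro x y; simp [twoForm]
  · intro x y; simp [twoForm]

/-- The algebra with `de⁵ = 12`, `de⁶ = 34`. -/
theorem isOneOfFour_of_split (hdim : Module.finrank ℝ L = 6) {f0 f1 f2 f3 f4 f5 : L}
    (hs : ⊤ ≤ Submodule.span ℝ (Set.range ![f0, f1, f2, f3, f4, f5])) (k01 : ⁅f0, f1⁆ = f4)
    (k02 : ⁅f0, f2⁆ = 0) (k03 : ⁅f0, f3⁆ = 0) (k12 : ⁅f1, f2⁆ = 0) (k13 : ⁅f1, f3⁆ = 0)
    (k23 : ⁅f2, f3⁆ = f5) (h4 : ∀ v : L, ⁅f4, v⁆ = 0) (h5 : ∀ v : L, ⁅f5, v⁆ = 0) :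
    IsOneOfFour L := by
  refine Or.inr (Or.inr (Or.inl (nonempty_equiv_strAlg hdim (f0 := f0) (f1 := f1) (f2 := f2)
    (f3 := f3) (f4 := -f4) (f5 := -f5) ?_ ?_ ?_ 1 0 0 0 0 0 0 0 0 0 0 1 ?_ ?_ ?_ ?_ ?_ ?_ ?_ ?_)))
  · refine hs.trans ?_
    obtain ⟨m0, m1, m2, m3, m4, m5⟩ := mem_span_six f0 f1 f2 f3 (-f4) (-f5)
    exact range_subset_of_six m0 m1 m2 m3 (Submodule.neg_mem_iff _ |>.1 m4)
      (Submodule.neg_mem_iff _ |>.1 m5)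
  · intro v; rw [neg_lie, h4, neg_zero]
  · intro v; rw [neg_lie, h5, neg_zero]
  · rw [k01]; module
  · rw [k02]; module
  · rw [k03]; module
  · rw [k12]; module
  · rw [k13]; module
  · rw [k23]; module
  · intro x y; simp [twoForm]
  · intro x y; simp [twoForm]

/-- Criterion for `L` to be one of the four algebras, when `a ≠ 0`. -/
theorem isOneOfFour_of_ne_zero (hdim : Module.finrank ℝ L = 6) {x1 x2 y1 y2 w z : L}
    {a b c d p : ℝ} (hs : ⊤ ≤ Submodule.span ℝ (Set.range ![x1, x2, y1, y2, w, z]))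
    (hw : ∀ v : L, ⁅w, v⁆ = 0) (hz : ∀ v : L, ⁅z, v⁆ = 0) (hx : ⁅x1, x2⁆ = w + p • z)
    (hy : ⁅y1, y2⁆ = w) (h11 : ⁅x1, y1⁆ = a • z) (h12 : ⁅x1, y2⁆ = b • z)
    (h21 : ⁅x2, y1⁆ = c • z) (h22 : ⁅x2, y2⁆ = d • z) (ha : a ≠ 0) : IsOneOfFour L := by
  have hx' : ⁅x2, x1⁆ = -(w + p • z) := by rw [← lie_skew, hx]
  have hy' : ⁅y2, y1⁆ = -w := by rw [← lie_skew, hy]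
  have h11' : ⁅y1, x1⁆ = -(a • z) := by rw [← lie_skew, h11]
  have h12' : ⁅y2, x1⁆ = -(b • z) := by rw [← lie_skew, h12]
  have h21' : ⁅y1, x2⁆ = -(c • z) := by rw [← lie_skew, h21]
  have h22' : ⁅y2, x2⁆ = -(d • z) := by rw [← lie_skew, h22]
  -- The y-part of e' makes ⁅x1, e'⁆ = 0 and the x-part of h' makes ⁅y1, h'⁆ = 0; the shifts by p/2
  -- make ⁅e, h'⁆ and ⁅e', h⁆ equal. The constant κ is a quarter of the discriminant p² + 4(ad − bc)
  -- of the Pfaffian s² + pst − (ad − bc)t² of the pencil of 2-forms dual to w and z.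
  refine isOneOfFour_of_pencil hdim (e := x1) (e' := (p / 2) • x1 + b • y1 - a • y2) (h := y1)
    (h' := -(p / 2) • y1 - c • x1 + a • x2) (w := a • (w + (p / 2) • z)) (z := a • z)
    (κ := (p / 2) ^ 2 + a * d - b * c) ?_ ?_ ?_ ?_ ?_ ?_ ?_ ?_ ?_
  · refine hs.trans ?_
    set S := Submodule.span ℝ (Set.range ![x1, (p / 2) • x1 + b • y1 - a • y2, y1,
      -(p / 2) • y1 - c • x1 + a • x2, a • (w + (p / 2) • z), a • z])
    obtain ⟨m0, m1, m2, m3, m4, m5⟩ := mem_span_six x1 ((p / 2) • x1 + b • y1 - a • y2) y1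
      (-(p / 2) • y1 - c • x1 + a • x2) (a • (w + (p / 2) • z)) (a • z)
    have m5' : z ∈ S := (S.smul_mem_iff ha).1 m5
    have m4' : w + (p / 2) • z ∈ S := (S.smul_mem_iff ha).1 m4
    refine range_subset_of_six m0 ?_ m2 ?_ ?_ m5'
    · refine (S.smul_mem_iff ha).1 ?_
      have := S.add_mem (S.add_mem m3 (S.smul_mem (p / 2) m2)) (S.smul_mem c m0)
      convert this using 1
      module
    · refine (S.smul_mem_iff ha).1 ?_
      have := S.sub_mem (S.add_mem (S.smul_mem (p / 2) m0) (S.smul_mem b m2)) m1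
      convert this using 1
      module
    · have := S.sub_mem m4' (S.smul_mem (p / 2) m5')
      convert this using 1
      module
  · intro v; simp [hw, hz]
  · intro v; simp [hz]
  all_goals
    simp only [add_lie, sub_lie, lie_add, lie_sub, smul_lie, lie_smul, hx, hy, h11, h12, h21, h22,
      hx', hy', h11', h12', h21', h22', lie_self] <;> module

theorem span_six_swap_smul {x1 x2 y1 y2 w z : L} {s : ℝ} (h0 : s ≠ 0)
    (hs : ⊤ ≤ Submodule.span ℝ (Set.range ![x1, x2, y1, y2, w, z])) :
    ⊤ ≤ Submodule.span ℝ (Set.range ![s • x1, s • x2, y1, y2, w, z]) := by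
  refine hs.trans ?_
  obtain ⟨m0, m1, m2, m3, m4, m5⟩ := mem_span_six (s • x1) (s • x2) y1 y2 w z
  exact range_subset_of_six ((Submodule.smul_mem_iff _ h0).1 m0)
    ((Submodule.smul_mem_iff _ h0).1 m1) m2 m3 m4 m5

/-- Criterion for `L` to be one of the four algebras. -/
theorem isOneOfFour_of_brackets (hdim : Module.finrank ℝ L = 6) {x1 x2 y1 y2 w z : L}
    {a b c d p t : ℝ} (hs : ⊤ ≤ Submodule.span ℝ (Set.range ![x1, x2, y1, y2, w, z]))
    (hw : ∀ v : L, ⁅w, v⁆ = 0) (hz : ∀ v : L, ⁅z, v⁆ = 0) (hx : ⁅x1, x2⁆ = t • w + p • z)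
    (hy : ⁅y1, y2⁆ = w) (h11 : ⁅x1, y1⁆ = a • z) (h12 : ⁅x1, y2⁆ = b • z)
    (h21 : ⁅x2, y1⁆ = c • z) (h22 : ⁅x2, y2⁆ = d • z)
    (ht : 2 * t = (b + c) ^ 2 + (d - a) ^ 2 + a ^ 2 + b ^ 2 + c ^ 2 + d ^ 2) : IsOneOfFour L := by
  have hx' : ⁅x2, x1⁆ = -(t • w + p • z) := by rw [← lie_skew, hx]
  have hy' : ⁅y2, y1⁆ = -w := by rw [← lie_skew, hy]
  -- By `ht`, t is nonnegative and vanishes exactly when all four mixed brackets do.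
  by_cases hM : a ^ 2 + b ^ 2 + c ^ 2 + d ^ 2 = 0
  · have ha : a = 0 := by nlinarith [sq_nonneg a, sq_nonneg b, sq_nonneg c, sq_nonneg d]
    have hb : b = 0 := by nlinarith [sq_nonneg a, sq_nonneg b, sq_nonneg c, sq_nonneg d]
    have hc : c = 0 := by nlinarith [sq_nonneg a, sq_nonneg b, sq_nonneg c, sq_nonneg d]
    have hd : d = 0 := by nlinarith [sq_nonneg a, sq_nonneg b, sq_nonneg c, sq_nonneg d]
    subst ha hb hc hd
    have ht0 : t = 0 := by linarith
    subst ht0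
    rw [zero_smul] at h11 h12 h21 h22
    rw [zero_smul, zero_add] at hx
    have hflip : ∀ {u v : L}, ⁅u, v⁆ = 0 → ⁅v, u⁆ = 0 := fun {u v} h => by
      rw [← lie_skew, h, neg_zero]
    by_cases hp : p = 0
    · subst hp
      rw [zero_smul] at hx
      refine isOneOfFour_of_single hdim (f0 := y1) (f1 := y2) (f2 := x1) (f3 := x2) (f4 := z)
        (f5 := w) (hs.trans ?_) hy (hflip h11) (hflip h21) (hflip h12) (hflip h22) hx hz hw
      obtain ⟨m0, m1, m2, m3, m4, m5⟩ := mem_span_six y1 y2 x1 x2 z w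
      exact range_subset_of_six m2 m3 m0 m1 m5 m4
    · refine isOneOfFour_of_split hdim (f0 := x1) (f1 := x2) (f2 := y1) (f3 := y2)
        (f4 := p • z) (f5 := w) (hs.trans ?_) hx h11 h12 h21 h22 hy (fun v => by simp [hz]) hw
      obtain ⟨m0, m1, m2, m3, m4, m5⟩ := mem_span_six x1 x2 y1 y2 (p • z) w
      exact range_subset_of_six m0 m1 m2 m3 m5
        ((Submodule.smul_mem_iff _ hp).1 m4)
  · have ht0 : 0 < t := by
      have : 0 < a ^ 2 + b ^ 2 + c ^ 2 + d ^ 2 := lt_of_le_of_ne (by positivity) (Ne.symm hM)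
      nlinarith [sq_nonneg (b + c), sq_nonneg (d - a)]
    -- Scaling x1 and x2 by s = 1/√t turns the coefficient t of w into 1; this is where positivity
    -- of t is needed.
    obtain ⟨s, hs0, hst⟩ : ∃ s : ℝ, s ≠ 0 ∧ s * s * t = 1 := by
      refine ⟨(√t)⁻¹, by positivity, ?_⟩
      rw [← mul_inv, Real.mul_self_sqrt ht0.le, inv_mul_cancel₀ ht0.ne']
    have hss := span_six_swap_smul hs0 hs
    have e1 : ⁅s • x1, s • x2⁆ = w + (s * s * p) • z := by
      rw [smul_lie, lie_smul, hx, smul_add, smul_add, smul_smul, smul_smul, smul_smul, smul_smul, hst,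
        one_smul]
    have e1' : ⁅s • x2, -(s • x1)⁆ = w + (s * s * p) • z := by
      rw [lie_neg, lie_skew, e1]
    have e2' : ⁅y2, -y1⁆ = w := by rw [lie_neg, lie_skew, hy]
    have f11 : ⁅s • x1, y1⁆ = (s * a) • z := by rw [smul_lie, h11, smul_smul]
    have f12 : ⁅s • x1, y2⁆ = (s * b) • z := by rw [smul_lie, h12, smul_smul]
    have f21 : ⁅s • x2, y1⁆ = (s * c) • z := by rw [smul_lie, h21, smul_smul]
    have f22 : ⁅s • x2, y2⁆ = (s * d) • z := by rw [smul_lie, h22, smul_smul]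
    have f11' : ⁅s • x1, -y1⁆ = (-(s * a)) • z := by rw [lie_neg, f11, neg_smul]
    have f21' : ⁅s • x2, -y1⁆ = (-(s * c)) • z := by rw [lie_neg, f21, neg_smul]
    -- The quarter turns (x1, x2) ↦ (x2, −x1) and (y1, y2) ↦ (y2, −y1) preserve ⁅x1, x2⁆ and ⁅y1,
    -- y2⁆ and move any nonzero coefficient into the place of a.
    by_cases ha : a = 0
    · by_cases hb : b = 0
      · by_cases hc : c = 0
        · have hd : d ≠ 0 := by rintro rfl; simp [ha, hb, hc] at hM
          refine isOneOfFour_of_ne_zero hdim (x1 := s • x2) (x2 := -(s • x1)) (y1 := y2)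
            (y2 := -y1) (hss.trans ?_) hw hz e1' e2' f22 f21' (c := -(s * b)) (d := s * a)
            (by rw [neg_lie, f12, neg_smul]) (by rw [neg_lie, f11', neg_smul, neg_neg])
            (mul_ne_zero hs0 hd)
          obtain ⟨m0, m1, m2, m3, m4, m5⟩ := mem_span_six (s • x2) (-(s • x1)) y2 (-y1) w z
          exact range_subset_of_six (Submodule.neg_mem_iff _ |>.1 m1) m0
            (Submodule.neg_mem_iff _ |>.1 m3) m2 m4 m5
        · refine isOneOfFour_of_ne_zero hdim (x1 := s • x2) (x2 := -(s • x1)) (y1 := y1)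
            (y2 := y2) (hss.trans ?_) hw hz e1' hy f21 f22 (c := -(s * a)) (d := -(s * b))
            (by rw [neg_lie, f11, neg_smul]) (by rw [neg_lie, f12, neg_smul])
            (mul_ne_zero hs0 hc)
          obtain ⟨m0, m1, m2, m3, m4, m5⟩ := mem_span_six (s • x2) (-(s • x1)) y1 y2 w z
          exact range_subset_of_six (Submodule.neg_mem_iff _ |>.1 m1) m0 m2 m3
            m4 m5
      · refine isOneOfFour_of_ne_zero hdim (x1 := s • x1) (x2 := s • x2) (y1 := y2)
          (y2 := -y1) (hss.trans ?_) hw hz e1 e2' f12 f11' f22 f21' (mul_ne_zero hs0 hb)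
        obtain ⟨m0, m1, m2, m3, m4, m5⟩ := mem_span_six (s • x1) (s • x2) y2 (-y1) w z
        exact range_subset_of_six m0 m1 (Submodule.neg_mem_iff _ |>.1 m3) m2 m4
          m5
    · exact isOneOfFour_of_ne_zero hdim hss hw hz e1 hy f11 f12 f21 f22 (mul_ne_zero hs0 ha)

end NormalForm

/-! ### Nilpotent commuting matrices with the integrability relation -/

section MatrixLemmas

open Matrix

theorem Matrix.trace_eq_zero_of_isNilpotent {m : Type*} [Fintype m] [DecidableEq m]
    {A : Matrix m m ℝ} (h : IsNilpotent A) : A.trace = 0 :=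
  (Matrix.isNilpotent_trace_of_isNilpotent h).eq_zero

/-- Nilpotent commuting `A`, `B` on a plane with the integrability relation vanish. -/
theorem eq_zero_of_integrable_two {A B : Matrix (Fin 2) (Fin 2) ℝ} (hA : IsNilpotent A)
    (hB : IsNilpotent B) (hAB : A * B = B * A)
    (hN : B * !![0, -1; 1, 0] - !![0, -1; 1, 0] * B =
      !![0, -1; 1, 0] * A * !![0, -1; 1, 0] + A) : A = 0 ∧ B = 0 := by
  have tA := Matrix.trace_eq_zero_of_isNilpotent hA
  have tB := Matrix.trace_eq_zero_of_isNilpotent hB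
  have tA2 := Matrix.trace_eq_zero_of_isNilpotent (hA.pow_of_pos (n := 2) (by simp))
  have tB2 := Matrix.trace_eq_zero_of_isNilpotent (hB.pow_of_pos (n := 2) (by simp))
  rw [Matrix.eta_fin_two A, Matrix.eta_fin_two B] at *
  generalize A 0 0 = a at *
  generalize A 0 1 = b at *
  generalize A 1 0 = c at *
  generalize A 1 1 = d at *
  generalize B 0 0 = a' at *
  generalize B 0 1 = b' at *
  generalize B 1 0 = c' at *
  generalize B 1 1 = d' at *
  simp [Matrix.trace_fin_two, pow_two] at tA tB tA2 tB2
  have n00 := congrFun (congrFun hN 0) 0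
  have n01 := congrFun (congrFun hN 0) 1
  have m01 := congrFun (congrFun hAB 0) 1
  have m10 := congrFun (congrFun hAB 1) 0
  have m00 := congrFun (congrFun hAB 0) 0
  simp [Matrix.mul_apply, Fin.sum_univ_two] at n00 n01 m01 m10 m00
  obtain rfl : d = -a := by linarith
  obtain rfl : d' = -a' := by linarith
  obtain rfl : c = -2 * a' - b := by linarith
  obtain rfl : c' = 2 * a - b' := by linarith
  -- Integrability gives b + c = −2a' and b' + c' = 2a; commutation gives a'(b + c) = a(b' + c').
  -- Together −2a'² = 2a².
  have h : a ^ 2 + a' ^ 2 = 0 := by nlinarith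
  obtain rfl : a = 0 := by nlinarith [sq_nonneg a, sq_nonneg a']
  obtain rfl : a' = 0 := by nlinarith [sq_nonneg a']
  obtain rfl : b = 0 := by nlinarith [sq_nonneg b]
  obtain rfl : b' = 0 := by nlinarith [sq_nonneg b']
  constructor <;> ext i j <;> fin_cases i <;> fin_cases j <;> simp

variable {m : Type*} [Fintype m] [DecidableEq m]

/-- Nilpotency, commutation and integrability give tr(JAJA) = tr(JBJB) = 0; with these, the trace of
the SKT equation against J is −2(|A|² + |B|²). The relation `hS` is the SKT equation for ad X, ad JX
acting on an abelian ideal. -/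
theorem eq_zero_of_integrable_skt {A B J : Matrix m m ℝ} (hA : IsNilpotent A)
    (hB : IsNilpotent B) (hAB : A * B = B * A) (hJ : J * J = -1) (hJt : Jᵀ = -J)
    (hN : B * J - J * B = J * A * J + A)
    (hS : (A * J * A + B * J * B) - (A * J * A + B * J * B)ᵀ + (Aᵀ * A * J - Jᵀ * Aᵀ * A)
      + (Bᵀ * B * J - Jᵀ * Bᵀ * B) = 0) : A = 0 ∧ B = 0 := by
  have tA2 : (A * A).trace = 0 := by
    rw [← pow_two]
    exact Matrix.trace_eq_zero_of_isNilpotent (hA.pow_of_pos (n := 2) (by simp))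
  have tB2 : (B * B).trace = 0 := by
    rw [← pow_two]
    exact Matrix.trace_eq_zero_of_isNilpotent (hB.pow_of_pos (n := 2) (by simp))
  have key : ∀ X Y : Matrix m m ℝ, (X * Y).trace = (Y * X).trace := Matrix.trace_mul_comm
  have hJl : ∀ X : Matrix m m ℝ, J * (J * X) = -X := fun X => by
    rw [← mul_assoc, hJ, neg_mul, one_mul]
  -- the square of `C = A + JAJ = BJ - JB` has trace zero
  have c1 : ((J * A * J + A) * (J * A * J + A)).trace = 2 * (J * A * J * A).trace := by
    have e : (J * A * J + A) * (J * A * J + A) =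
      -(J * (A * A * J)) + J * A * J * A + (A * J * A) * J + A * A := by
      simp only [mul_add, add_mul, mul_assoc, hJl]
      simp only [mul_neg]
      abel
    rw [e]
    simp only [trace_add, trace_neg]
    rw [key J, key (A * J * A) J, mul_assoc (A * A), hJ, tA2]
    simp only [mul_neg, mul_one, trace_neg, tA2, mul_assoc]
    ring
  have c2 : ((B * J - J * B) * (B * J - J * B)).trace = 2 * (J * B * J * B).trace := by
    have e : (B * J - J * B) * (B * J - J * B) =
      (B * J * B) * J + B * B - J * (B * B * J) + J * B * J * B := by
      simp only [mul_sub, sub_mul, mul_assoc, hJl]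
      simp only [mul_neg]
      abel
    rw [e]
    simp only [trace_add, trace_sub]
    rw [key J (B * B * J), key (B * J * B) J, mul_assoc (B * B), hJ, tB2]
    simp only [mul_neg, mul_one, trace_neg, tB2, mul_assoc]
    ring
  have c3 : ((J * A * J + A) * (B * J - J * B)).trace = 0 := by
    have e : (J * A * J + A) * (B * J - J * B) =
      (J * A * J * B) * J + J * (A * B) + A * B * J - A * (J * B) := by
      simp only [mul_sub, add_mul, mul_assoc, hJl]
      simp only [mul_neg]
      abel
    rw [e]
    simp only [trace_add, trace_sub]
    have e2 : ((J * A * J * B) * J).trace = -(A * (J * B)).trace := by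
      rw [key]
      simp only [mul_assoc, hJl, trace_neg]
    have e3 : (A * (J * B)).trace = (J * (B * A)).trace := by
      rw [key]; simp only [mul_assoc]
    rw [e2, key (A * B) J, e3, hAB]
    ring
  -- For C = JAJ + A = BJ − JB the trace of C² has been computed three times: as 2tr(JAJA), as
  -- 2tr(JBJB), and, mixing the two expressions and using AB = BA, as 0.
  have t1 : (J * A * J * A).trace = 0 := by
    rw [hN] at c3
    linarith
  have t2 : (J * B * J * B).trace = 0 := by
    rw [← hN] at c3
    linarith
  -- Against J, the terms AJA − (AJA)ᵀ contribute 2tr(JAJA) = 0 and the terms AᵀAJ − JᵀAᵀA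
  -- contribute −2|A|²; likewise for B.
  have hS2 := congrArg (fun X => (X * J).trace) hS
  have hT : ∀ X : Matrix m m ℝ, (Xᵀ * J).trace = -(J * X).trace := by
    intro X
    rw [← Matrix.trace_transpose, Matrix.transpose_mul, hJt, Matrix.transpose_transpose, neg_mul,
      trace_neg]
  have hU : ∀ X : Matrix m m ℝ, ((Xᵀ * X * J - Jᵀ * Xᵀ * X) * J).trace = -2 * (Xᵀ * X).trace := by
    intro X
    rw [sub_mul, mul_assoc _ J J, hJ, trace_sub, hJt, key (-J * Xᵀ * X)]
    simp only [mul_assoc, neg_mul, mul_neg, hJl, mul_one, trace_neg]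
    ring
  simp only [add_mul, sub_mul, trace_add, trace_sub, hT, zero_mul, trace_zero] at hS2
  have hUA := hU A
  have hUB := hU B
  simp only [sub_mul, trace_sub] at hUA hUB
  rw [key (A * J * A) J, key (B * J * B) J] at hS2
  simp only [mul_add, trace_add] at hS2
  simp only [mul_assoc] at hS2 t1 t2 hUA hUB
  have hp : ∀ X : Matrix m m ℝ, 0 ≤ (Xᵀ * X).trace := fun X => by
    simp only [trace, diag_apply, mul_apply, transpose_apply]
    exact Finset.sum_nonneg fun i _ => Finset.sum_nonneg fun j _ => mul_self_nonneg _
  have h0 : ∀ X : Matrix m m ℝ, (Xᵀ * X).trace = 0 → X = 0 := fun X hX => by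
    have h := Matrix.trace_conjTranspose_mul_self_eq_zero_iff (A := X)
    rw [Matrix.conjTranspose_eq_transpose_of_trivial] at h
    exact h.1 hX
  have := hp A
  have := hp B
  exact ⟨h0 A (by linarith), h0 B (by linarith)⟩

end MatrixLemmas

/-! ### Closed complex 1-forms on nilpotent algebras with a complex structure -/

namespace IsLieSKT

variable {L : Type*} [LieRing L] [LieAlgebra ℝ L] {J : L →ₗ[ℝ] L} {g : L →ₗ[ℝ] L →ₗ[ℝ] ℝ}
  (h : IsLieSKT J g)
include h

theorem g_J_left (x y : L) : g (J x) y = -g x (J y) := by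
  have := h.g_J x (J y)
  rw [h.J_J, map_neg] at this
  linarith

theorem g_J_self (x : L) : g x (J x) = 0 := by
  have h1 := h.g_J_left x x
  rw [h.symm (J x)] at h1
  linarith

theorem torsion_eq (x y z : L) :
    torsion J g x y z = -(g ⁅J x, J y⁆ z - g ⁅J x, J z⁆ y + g ⁅J y, J z⁆ x) := by
  simp only [torsion, dOmega, h.g_J]

theorem lie_J_J (x y : L) : ⁅J x, J y⁆ = ⁅x, y⁆ + J ⁅J x, y⁆ + J ⁅x, J y⁆ := by
  have := h.integrable x y
  rw [sub_sub, sub_sub, sub_eq_zero] at this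
  rw [this]; abel

/-- In a `J`-invariant subalgebra `K` of a nilpotent algebra, `[K, K] + J[K, K]` is proper. -/
theorem exists_orthogonal [FiniteDimensional ℝ L] [LieRing.IsNilpotent L] {K : Submodule ℝ L}
    (hK : K ≠ ⊥) (hJ : ∀ x ∈ K, J x ∈ K) (hbr : ∀ x ∈ K, ∀ y ∈ K, ⁅x, y⁆ ∈ K) :
    ∃ X ∈ K, g X X = 1 ∧ ∀ a ∈ K, ∀ b ∈ K, g X ⁅a, b⁆ = 0 ∧ g (J X) ⁅a, b⁆ = 0 := by
  obtain ⟨br, hbr_apply⟩ : ∃ br : L →ₗ[ℝ] L →ₗ[ℝ] L, ∀ x y, br x y = ⁅x, y⁆ :=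
    ⟨(LieModule.toEnd ℝ L L : L →ₗ[ℝ] Module.End ℝ L), fun _ _ => rfl⟩
  -- C is the descending central series of K, computed inside L, so that nilpotency of L bounds its
  -- length.
  obtain ⟨C, hC0, hCs⟩ : ∃ C : ℕ → Submodule ℝ L, C 0 = K ∧
      ∀ k, C (k + 1) = Submodule.map₂ br K (C k) :=
    ⟨fun k => Nat.rec K (fun _ D => Submodule.map₂ br K D) k, rfl, fun _ => rfl⟩
  have hCK : ∀ k, C k ≤ K := by
    intro k
    induction k with
    | zero => exact hC0.le
    | succ k ih =>
      rw [hCs]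
      exact Submodule.map₂_le.2 fun x hx y hy => hbr_apply x y ▸ hbr x hx y (ih hy)
  have hCl : ∀ k, C k ≤ (LieModule.lowerCentralSeries ℝ L L k : Submodule ℝ L) := by
    intro k
    induction k with
    | zero => simp
    | succ k ih =>
      rw [hCs]
      refine Submodule.map₂_le.2 fun x hx y hy => ?_
      rw [hbr_apply, LieModule.lowerCentralSeries_succ]
      exact LieSubmodule.lie_mem_lie trivial (ih hy)
  have hmem : ∀ k, ∀ x ∈ K, ∀ y ∈ C k, ⁅x, y⁆ ∈ C (k + 1) := fun k x hx y hy => by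
    rw [hCs, ← hbr_apply]; exact Submodule.apply_mem_map₂ br hx hy
  have hmem' : ∀ k, ∀ x ∈ K, ∀ y ∈ C k, ⁅y, x⁆ ∈ C (k + 1) := fun k x hx y hy => by
    rw [← lie_skew]; exact Submodule.neg_mem _ (hmem k x hx y hy)
  obtain ⟨P, hP⟩ : ∃ P : ℕ → Submodule ℝ L, ∀ k, P k = C k ⊔ (C k).map J := ⟨_, fun _ => rfl⟩
  have hPC : ∀ k, ∀ x ∈ C k, x ∈ P k := fun k x hx => hP k ▸ Submodule.mem_sup_left hx
  have hPJ : ∀ k, ∀ x ∈ C k, J x ∈ P k := fun k x hx =>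
    hP k ▸ Submodule.mem_sup_right (Submodule.mem_map_of_mem hx)
  have hPle : ∀ k, ∀ S : Submodule ℝ L, C k ≤ S → (∀ x ∈ C k, J x ∈ S) → P k ≤ S :=
    fun k S h1 h2 => hP k ▸ sup_le h1 (by rintro _ ⟨x, hx, rfl⟩; exact h2 x hx)
  have hPK : ∀ k, P k ≤ K := fun k => hPle k K (hCK k) fun x hx => hJ x (hCK k hx)
  have hPmem : ∀ k, ∀ x ∈ P k, ∃ a ∈ C k, ∃ b ∈ C k, a + J b = x := by
    intro k x hx
    rw [hP] at hx
    obtain ⟨a, ha, _, ⟨b, hb, rfl⟩, rfl⟩ := Submodule.mem_sup.1 hx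
    exact ⟨a, ha, b, hb, rfl⟩
  have hPinv : ∀ k, ∀ x ∈ P k, J x ∈ P k := by
    intro k x hx
    obtain ⟨a, ha, b, hb, rfl⟩ := hPmem k x hx
    rw [map_add, h.J_J]
    exact Submodule.add_mem _ (hPJ k a ha) (Submodule.neg_mem _ (hPC k b hb))
  have hne : P 1 ≠ K := by
    intro h1
    -- If C₁ + JC₁ = K, then C_k + JC_k = K for all k: write elements of K as a + Jb with a, b ∈
    -- C_k. Integrability replaces [Jb, Jb'] by [b, b'] + J[Jb, b'] + J[b, Jb'], so all brackets
    -- fall in C_{k+1} + JC_{k+1}. Nilpotency then gives K = 0.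
    have hall : ∀ k, P k = K := by
      intro k
      induction k with
      | zero => exact le_antisymm (hPK 0) fun x hx => hPC 0 x (hC0 ▸ hx)
      | succ k ih =>
        refine le_antisymm (hPK _) ?_
        have h2 : C 1 ≤ P (k + 1) := by
          rw [hCs]
          refine Submodule.map₂_le.2 fun x hx y hy => ?_
          rw [hbr_apply]
          rw [hC0] at hy
          rw [← ih] at hx hy
          obtain ⟨a, ha, b, hb, rfl⟩ := hPmem k x hx
          obtain ⟨a', ha', b', hb', rfl⟩ := hPmem k y hy
          rw [add_lie, lie_add, lie_add, h.lie_J_J b b']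
          have q1 : ⁅a, a'⁆ ∈ P (k + 1) := hPC _ _ (hmem k a (hCK k ha) a' ha')
          have q2 : ⁅a, J b'⁆ ∈ P (k + 1) := hPC _ _ (hmem' k _ (hJ _ (hCK k hb')) a ha)
          have q3 : ⁅J b, a'⁆ ∈ P (k + 1) := hPC _ _ (hmem k _ (hJ _ (hCK k hb)) a' ha')
          have q4 : ⁅b, b'⁆ ∈ P (k + 1) := hPC _ _ (hmem k b (hCK k hb) b' hb')
          have q5 : J ⁅J b, b'⁆ ∈ P (k + 1) := hPJ _ _ (hmem k _ (hJ _ (hCK k hb)) b' hb')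
          have q6 : J ⁅b, J b'⁆ ∈ P (k + 1) := hPJ _ _ (hmem' k _ (hJ _ (hCK k hb')) b hb)
          exact Submodule.add_mem _ (Submodule.add_mem _ q1 q2)
            (Submodule.add_mem _ q3 (Submodule.add_mem _ (Submodule.add_mem _ q4 q5) q6))
        rw [← h1]
        exact hPle 1 _ h2 fun x hx => hPinv _ _ (h2 hx)
    obtain ⟨N, hN⟩ := LieModule.IsNilpotent.nilpotent ℝ L L
    have h3 : C N = ⊥ := by
      have := hCl N
      rw [hN] at this
      exact le_bot_iff.1 (this.trans (by simp))
    have h4 : P N = ⊥ := by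
      rw [hP, h3]; simp
    exact hK ((hall N).symm.trans h4)
  have hlt : P 1 < K := lt_of_le_of_ne (hPK 1) hne
  -- Since dim P₁ < dim K, pairing with P₁ has a kernel on K. P₁ is J-invariant, so JX is orthogonal
  -- to it along with X.
  let φ : K →ₗ[ℝ] Module.Dual ℝ (P 1) :=
    { toFun := fun x => (g x).domRestrict (P 1)
      map_add' := fun x y => by ext; simp
      map_smul' := fun c x => by ext; simp }
  have hφ : LinearMap.ker φ ≠ ⊥ := by
    refine LinearMap.ker_ne_bot_of_finrank_lt ?_
    rw [Subspace.dual_finrank_eq]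
    exact Submodule.finrank_lt_finrank_of_lt hlt
  obtain ⟨X, hX, hX0⟩ := Submodule.exists_mem_ne_zero_of_ne_bot hφ
  have hXP : ∀ v ∈ P 1, g (X : L) v = 0 := fun v hv =>
    congrArg (fun α : Module.Dual ℝ (P 1) => α ⟨v, hv⟩) (LinearMap.mem_ker.1 hX)
  have hXX : 0 < g (X : L) X := h.pos _ fun h0 => hX0 (Subtype.ext h0)
  refine ⟨(√(g (X : L) X))⁻¹ • (X : L), K.smul_mem _ X.2, ?_, ?_⟩
  · rw [map_smul, map_smul, LinearMap.smul_apply, smul_smul, ← mul_inv,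
      Real.mul_self_sqrt hXX.le, smul_eq_mul, inv_mul_cancel₀ hXX.ne']
  · intro a ha b hb
    have h1 : ⁅a, b⁆ ∈ C 1 := hmem 0 a ha b (hC0.symm ▸ hb)
    rw [map_smul, map_smul, map_smul, LinearMap.smul_apply, LinearMap.smul_apply, h.g_J_left,
      hXP _ (hPC 1 _ h1), hXP _ (hPJ 1 _ h1)]
    simp

/-- The matrix of `P` modulo the orthogonal complement of an orthonormal family `y`. -/
def _root_.frameMatrix {m : Type*} (g : L →ₗ[ℝ] L →ₗ[ℝ] ℝ) (y : m → L) (P : L →ₗ[ℝ] L) :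
    Matrix m m ℝ := Matrix.of fun i j => g (y i) (P (y j))

end IsLieSKT

/-! ### Matrices of endomorphisms modulo an invariant subspace -/

section FrameMatrix

variable {L : Type*} [LieRing L] [LieAlgebra ℝ L] {g : L →ₗ[ℝ] L →ₗ[ℝ] ℝ}
  {m : Type*} [Fintype m] [DecidableEq m] {y : m → L} {C : Submodule ℝ L}

/-- `P` preserves `C` and `C + span y`. -/
structure PreservesFrame (g : L →ₗ[ℝ] L →ₗ[ℝ] ℝ) (y : m → L) (C : Submodule ℝ L)
    (P : L →ₗ[ℝ] L) : Prop where
  map_mem : ∀ c ∈ C, P c ∈ C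
  sub_mem : ∀ j, P (y j) - ∑ i, g (y i) (P (y j)) • y i ∈ C

theorem frameMatrix_apply (y : m → L) (P : L →ₗ[ℝ] L) (i j : m) :
    frameMatrix g y P i j = g (y i) (P (y j)) := rfl

/-- The frame is orthogonal to C, so errors in C are invisible to the matrix; it represents the
induced map on (C + span y)/C and is multiplicative. -/
theorem PreservesFrame.mul {P Q : L →ₗ[ℝ] L} (hP : PreservesFrame g y C P)
    (hQ : PreservesFrame g y C Q) (hC : ∀ i, ∀ c ∈ C, g (y i) c = 0) :
    frameMatrix g y (P ∘ₗ Q) = frameMatrix g y P * frameMatrix g y Q := by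
  ext i j
  have h1 := hC i _ (hP.map_mem _ (hQ.sub_mem j))
  rw [map_sub, map_sub, sub_eq_zero, map_sum, map_sum] at h1
  rw [frameMatrix_apply, LinearMap.comp_apply, h1, Matrix.mul_apply]
  refine Finset.sum_congr rfl fun k _ => ?_
  rw [map_smul, map_smul, smul_eq_mul, mul_comm]
  rfl

theorem PreservesFrame.comp {P Q : L →ₗ[ℝ] L} (hP : PreservesFrame g y C P)
    (hQ : PreservesFrame g y C Q) (hC : ∀ i, ∀ c ∈ C, g (y i) c = 0) :
    PreservesFrame g y C (P ∘ₗ Q) := by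
  refine ⟨fun c hc => hP.map_mem _ (hQ.map_mem _ hc), fun j => ?_⟩
  have h1 := hP.map_mem _ (hQ.sub_mem j)
  rw [map_sub, map_sum] at h1
  have h2 : ∑ i, frameMatrix g y (P ∘ₗ Q) i j • y i =
      ∑ k, g (y k) (Q (y j)) • ∑ i, g (y i) (P (y k)) • y i := by
    rw [hP.mul hQ hC]
    simp only [Matrix.mul_apply, Finset.sum_smul, Finset.smul_sum, frameMatrix_apply]
    rw [Finset.sum_comm]
    refine Finset.sum_congr rfl fun k _ => Finset.sum_congr rfl fun i _ => ?_
    rw [smul_smul, mul_comm]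
  change P (Q (y j)) - ∑ i, frameMatrix g y (P ∘ₗ Q) i j • y i ∈ C
  rw [h2]
  have h3 : ∑ k, g (y k) (Q (y j)) • (P (y k) - ∑ i, g (y i) (P (y k)) • y i) ∈ C :=
    C.sum_mem fun k _ => C.smul_mem _ (hP.sub_mem k)
  have h4 := C.add_mem h1 h3
  simp only [smul_sub, Finset.sum_sub_distrib, map_smul] at h4
  convert h4 using 1
  abel

theorem PreservesFrame.isNilpotent {P : L →ₗ[ℝ] L} (hP : PreservesFrame g y C P)
    (hC : ∀ i, ∀ c ∈ C, g (y i) c = 0) (hy : ∀ i j, g (y i) (y j) = if i = j then 1 else 0)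
    (hn : IsNilpotent P) : IsNilpotent (frameMatrix g y P) := by
  have h1 : ∀ n : ℕ, PreservesFrame g y C (P ^ n) ∧
      frameMatrix g y (P ^ n) = frameMatrix g y P ^ n := by
    intro n
    induction n with
    | zero =>
      refine ⟨⟨fun c hc => by simpa using hc, fun j => ?_⟩, ?_⟩
      · simp [hy]
      · ext i j
        simp [frameMatrix_apply, hy, Matrix.one_apply]
    | succ n ih =>
      rw [pow_succ, pow_succ, Module.End.mul_eq_comp]
      exact ⟨ih.1.comp hP hC, by rw [ih.1.mul hP hC, ih.2]⟩
  obtain ⟨n, hn⟩ := hn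
  refine ⟨n, ?_⟩
  rw [← (h1 n).2, hn]
  ext i j
  simp [frameMatrix_apply]

theorem frameMatrix_add (y : m → L) (P Q : L →ₗ[ℝ] L) :
    frameMatrix g y (P + Q) = frameMatrix g y P + frameMatrix g y Q := by
  ext i j; simp [frameMatrix_apply]

theorem frameMatrix_sub (y : m → L) (P Q : L →ₗ[ℝ] L) :
    frameMatrix g y (P - Q) = frameMatrix g y P - frameMatrix g y Q := by
  ext i j; simp [frameMatrix_apply]

theorem frameMatrix_eq {P Q : L →ₗ[ℝ] L} (hC : ∀ i, ∀ c ∈ C, g (y i) c = 0)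
    (hPQ : ∀ j, P (y j) - Q (y j) ∈ C) : frameMatrix g y P = frameMatrix g y Q := by
  ext i j
  have := hC i _ (hPQ j)
  rw [map_sub, sub_eq_zero] at this
  exact this

theorem PreservesFrame.mem_of_eq_zero {P : L →ₗ[ℝ] L} (hP : PreservesFrame g y C P)
    (h0 : frameMatrix g y P = 0) (j : m) : P (y j) ∈ C := by
  have h1 := hP.sub_mem j
  have h2 : ∀ i, g (y i) (P (y j)) = 0 := fun i => congrFun (congrFun h0 i) j
  simpa [h2] using h1

end FrameMatrix

/-! ### The adapted orthonormal frame -/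

section SKTFrame

variable {L : Type*} [LieRing L] [LieAlgebra ℝ L] {J : L →ₗ[ℝ] L} {g : L →ₗ[ℝ] L →ₗ[ℝ] ℝ}

/-- The orthogonal complement of the span of `X` and `JX`. -/
def complexPerp (J : L →ₗ[ℝ] L) (g : L →ₗ[ℝ] L →ₗ[ℝ] ℝ) (X : L) : Submodule ℝ L :=
  LinearMap.ker (g X) ⊓ LinearMap.ker (g (J X))

theorem mem_complexPerp {X v : L} : v ∈ complexPerp J g X ↔ g X v = 0 ∧ g (J X) v = 0 := by
  simp [complexPerp]

theorem expand_of_orthonormal [FiniteDimensional ℝ L] {ι : Type*} [Fintype ι] [DecidableEq ι]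
    (hι : Fintype.card ι = Module.finrank ℝ L) {e : ι → L}
    (he : ∀ i j, g (e i) (e j) = if i = j then 1 else 0) (v : L) :
    v = ∑ i, g (e i) v • e i := by
  have hli : LinearIndependent ℝ e := by
    rw [Fintype.linearIndependent_iff]
    intro c hc i
    have := congrArg (g (e i)) hc
    simpa [he] using this
  have hv : v ∈ Submodule.span ℝ (Set.range e) := by
    rw [hli.span_eq_top_of_card_eq_finrank' hι]; trivial
  obtain ⟨c, rfl⟩ := (Submodule.mem_span_range_iff_exists_fun ℝ).1 hv
  refine Finset.sum_congr rfl fun i _ => ?_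
  simp [he]

theorem finrank_le_finrank_inf_ker_add_two [FiniteDimensional ℝ L] (a b : L) {K : Submodule ℝ L} :
    Module.finrank ℝ K ≤
      Module.finrank ℝ (K ⊓ (LinearMap.ker (g a) ⊓ LinearMap.ker (g b)) : Submodule ℝ L) + 2 := by
  have hk : ∀ (f : L →ₗ[ℝ] ℝ) (S : Submodule ℝ L), Module.finrank ℝ S ≤
      Module.finrank ℝ (S ⊓ LinearMap.ker f : Submodule ℝ L) + 1 := by
    intro f S
    have h1 := LinearMap.finrank_range_add_finrank_ker (f.domRestrict S)
    have h2 : Module.finrank ℝ (LinearMap.range (f.domRestrict S)) ≤ 1 := by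
      have := Submodule.finrank_le (LinearMap.range (f.domRestrict S))
      simpa using this
    have h3 : Module.finrank ℝ (LinearMap.ker (f.domRestrict S)) =
        Module.finrank ℝ (S ⊓ LinearMap.ker f : Submodule ℝ L) := by
      have h4 : (LinearMap.ker (f.domRestrict S)).map S.subtype = S ⊓ LinearMap.ker f := by
        ext x
        simp [LinearMap.domRestrict_apply]
        tauto
      rw [← h4, Submodule.finrank_map_subtype_eq]
    omega
  have h1 := hk (g a) K
  have h2 := hk (g b) (K ⊓ LinearMap.ker (g a))
  rw [inf_assoc] at h2
  omega

/-- An orthonormal frame `X, JX, Y, JY, Z, JZ` adapted to a filtration by subalgebras. -/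
structure SKTFrame (J : L →ₗ[ℝ] L) (g : L →ₗ[ℝ] L →ₗ[ℝ] ℝ) (X Y Z : L) : Prop where
  XX : g X X = 1
  YY : g Y Y = 1
  ZZ : g Z Z = 1
  XY : g X Y = 0
  XJY : g (J X) Y = 0
  XZ : g X Z = 0
  XJZ : g (J X) Z = 0
  YZ : g Y Z = 0
  YJZ : g (J Y) Z = 0
  lie_mem : ∀ a b : L, ⁅a, b⁆ ∈ complexPerp J g X
  lie_mem_Y : ∀ a ∈ complexPerp J g X, ∀ b ∈ complexPerp J g X, ⁅a, b⁆ ∈ complexPerp J g Y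
  lie_eq : ∀ a ∈ complexPerp J g X, a ∈ complexPerp J g Y → ∀ b ∈ complexPerp J g X,
    b ∈ complexPerp J g Y → ⁅a, b⁆ = 0
  expand : ∀ v, v = g X v • X + g (J X) v • J X + g Y v • Y + g (J Y) v • J Y + g Z v • Z
    + g (J Z) v • J Z

theorem IsLieSKT.J_mem_complexPerp (h : IsLieSKT J g) {X v : L} (hv : v ∈ complexPerp J g X) :
    J v ∈ complexPerp J g X := by
  rw [mem_complexPerp] at hv ⊢
  refine ⟨?_, ?_⟩
  · have := h.g_J_left X v
    rw [hv.2] at this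
    linarith
  · rw [h.g_J]; exact hv.1

/-- `exists_orthogonal` is applied to L, to H = {X, JX}^⊥ and to the part C of H orthogonal to Y,
JY. Containing the brackets makes each next space a subalgebra, and dim ≥ 4, 2 makes it nonzero.
Brackets of elements of C are orthogonal to all six frame vectors, hence zero. -/
theorem IsLieSKT.exists_frame [FiniteDimensional ℝ L] [LieRing.IsNilpotent L]
    (hdim : Module.finrank ℝ L = 6) (h : IsLieSKT J g) : ∃ X Y Z, SKTFrame J g X Y Z := by
  have hne : ∀ K : Submodule ℝ L, 0 < Module.finrank ℝ K → K ≠ ⊥ := by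
    rintro K hK rfl
    simp at hK
  have d0 : Module.finrank ℝ (⊤ : Submodule ℝ L) = 6 := by rw [finrank_top, hdim]
  obtain ⟨X, -, hXX, hX⟩ := h.exists_orthogonal (hne ⊤ (by omega)) (fun _ _ => trivial)
    (fun _ _ _ _ => trivial)
  set H := complexPerp J g X with hH
  have dH : 4 ≤ Module.finrank ℝ H := by
    have := finrank_le_finrank_inf_ker_add_two (g := g) X (J X) (K := ⊤)
    rw [top_inf_eq, d0] at this
    exact (by omega : 4 ≤ Module.finrank ℝ
      (LinearMap.ker (g X) ⊓ LinearMap.ker (g (J X)) : Submodule ℝ L))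
  have lie_mem : ∀ a b : L, ⁅a, b⁆ ∈ H := fun a b =>
    mem_complexPerp.2 (hX a trivial b trivial)
  obtain ⟨Y, hYH, hYY, hY⟩ := h.exists_orthogonal (hne H (by omega))
    (fun _ hx => h.J_mem_complexPerp hx) (fun a _ b _ => lie_mem a b)
  have dC : 2 ≤ Module.finrank ℝ (H ⊓ complexPerp J g Y : Submodule ℝ L) := by
    have := finrank_le_finrank_inf_ker_add_two (g := g) Y (J Y) (K := H)
    rw [complexPerp]
    omega
  obtain ⟨Z, hZC, hZZ, hZ⟩ := h.exists_orthogonal (hne _ (by omega : 0 < Module.finrank ℝ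
      (H ⊓ complexPerp J g Y : Submodule ℝ L)))
    (fun _ hx => ⟨h.J_mem_complexPerp hx.1, h.J_mem_complexPerp hx.2⟩)
    (fun a ha b hb => ⟨lie_mem a b, mem_complexPerp.2 (hY a ha.1 b hb.1)⟩)
  have kY := mem_complexPerp.1 hYH
  have kZ := mem_complexPerp.1 hZC.1
  have kZ' := mem_complexPerp.1 hZC.2
  have kJY := mem_complexPerp.1 (h.J_mem_complexPerp hYH)
  have kJZ := mem_complexPerp.1 (h.J_mem_complexPerp hZC.1)
  have kJZ' := mem_complexPerp.1 (h.J_mem_complexPerp hZC.2)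
  have hexp : ∀ v, v = g X v • X + g (J X) v • J X + g Y v • Y + g (J Y) v • J Y + g Z v • Z
      + g (J Z) v • J Z := by
    intro v
    have := expand_of_orthonormal (g := g) (ι := Fin 6) (by simp [hdim])
      (e := ![X, J X, Y, J Y, Z, J Z]) (by
        have s := h.symm
        intro i j
        fin_cases i <;> fin_cases j <;>
          simp [hXX, hYY, hZZ, kY, kZ, kZ', kJY, kJZ, kJZ', h.g_J, h.g_J_self, s Y X, s Z X,
            s Z Y, s Y (J X), s Z (J X), s Z (J Y), s (J X) X, s (J Y) Y, s (J Z) Z, s (J Y) X,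
            s (J Z) X, s (J Z) Y]) v
    simpa [Fin.sum_univ_six] using this
  refine ⟨X, Y, Z, hXX, hYY, hZZ, kY.1, kY.2, kZ.1, kZ.2, kZ'.1, kZ'.2, lie_mem,
    fun a ha b hb => mem_complexPerp.2 (hY a ha b hb), ?_, hexp⟩
  intro a ha ha' b hb hb'
  have h1 := mem_complexPerp.1 (lie_mem a b)
  have h2 := hY a ha b hb
  have h3 := hZ a ⟨ha, ha'⟩ b ⟨hb, hb'⟩
  rw [hexp ⁅a, b⁆, h1.1, h1.2, h2.1, h2.2, h3.1, h3.2]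
  simp

end SKTFrame

/-! ### Consequences of integrability and of the strong KT equation for ad X and ad JX -/

namespace IsLieSKT

variable {L : Type*} [LieRing L] [LieAlgebra ℝ L] {J : L →ₗ[ℝ] L} {g : L →ₗ[ℝ] L →ₗ[ℝ] ℝ}
  (h : IsLieSKT J g) {m : Type*} [Fintype m] [DecidableEq m] {y : m → L} {C : Submodule ℝ L}

theorem _root_.lie_swap_eq_zero {u v : L} (huv : ⁅u, v⁆ = 0) : ⁅v, u⁆ = 0 := by
  rw [← lie_skew, huv, neg_zero]

/-- Jacobi: the commutator of ad A and ad B is ad ⁅A, B⁆, which dies in the quotient by `hAB`. -/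
theorem _root_.frameMatrix_comm {A B : L}
    (hA : PreservesFrame g y C (LieAlgebra.ad ℝ L A))
    (hB : PreservesFrame g y C (LieAlgebra.ad ℝ L B))
    (hC : ∀ i, ∀ c ∈ C, g (y i) c = 0) (hAB : ∀ j, ⁅⁅A, B⁆, y j⁆ ∈ C) :
    frameMatrix g y (LieAlgebra.ad ℝ L A) * frameMatrix g y (LieAlgebra.ad ℝ L B) =
      frameMatrix g y (LieAlgebra.ad ℝ L B) * frameMatrix g y (LieAlgebra.ad ℝ L A) := by
  rw [← hA.mul hB hC, ← hB.mul hA hC]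
  refine frameMatrix_eq hC fun j => ?_
  have := hAB j
  rw [lie_lie] at this
  exact this

include h

/-- Integrability applied to A and v, rearranged as [JA, Jv] − J[JA, v] = J[A, Jv] + [A, v] and read
in the quotient. -/
theorem frameMatrix_integrable {A : L}
    (hA : PreservesFrame g y C (LieAlgebra.ad ℝ L A))
    (hB : PreservesFrame g y C (LieAlgebra.ad ℝ L (J A)))
    (hJ : PreservesFrame g y C J) (hC : ∀ i, ∀ c ∈ C, g (y i) c = 0) :
    frameMatrix g y (LieAlgebra.ad ℝ L (J A)) * frameMatrix g y J -
      frameMatrix g y J * frameMatrix g y (LieAlgebra.ad ℝ L (J A)) =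
    frameMatrix g y J * frameMatrix g y (LieAlgebra.ad ℝ L A) * frameMatrix g y J +
      frameMatrix g y (LieAlgebra.ad ℝ L A) := by
  rw [← hB.mul hJ hC, ← hJ.mul hB hC, ← hJ.mul hA hC, ← (hJ.comp hA hC).mul hJ hC,
    ← frameMatrix_sub, ← frameMatrix_add]
  refine frameMatrix_eq hC fun j => ?_
  have h1 := h.lie_J_J A (y j)
  have h2 : ((LieAlgebra.ad ℝ L (J A)) ∘ₗ J - J ∘ₗ (LieAlgebra.ad ℝ L (J A)))
      (y j) - ((J ∘ₗ (LieAlgebra.ad ℝ L A)) ∘ₗ J + (LieAlgebra.ad ℝ L A)) (y j)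
      = ⁅J A, J (y j)⁆ - J ⁅J A, y j⁆ - (J ⁅A, J (y j)⁆ + ⁅A, y j⁆) := rfl
  rw [h2, h1]
  convert C.zero_mem using 1
  abel

/-- W/C is at most the complex line of U, on which A and JA act by commuting nilpotent 2×2 matrices
bound by integrability; `eq_zero_of_integrable_two` kills both. The lemma pushes brackets one step
down the filtration. -/
theorem lie_mem_of_pair [LieRing.IsNilpotent L] {A U : L} {W : Submodule ℝ L} (hU : g U U = 1)
    (hUW : U ∈ W) (hJW : ∀ v ∈ W, J v ∈ W) (hJC : ∀ c ∈ C, J c ∈ C)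
    (hCU : C ≤ complexPerp J g U) (hW : ∀ v ∈ W, v - (g U v • U + g (J U) v • J U) ∈ C)
    (hAC : ∀ c ∈ C, ⁅A, c⁆ ∈ C) (hJAC : ∀ c ∈ C, ⁅J A, c⁆ ∈ C) (hAW : ∀ v ∈ W, ⁅A, v⁆ ∈ W)
    (hJAW : ∀ v ∈ W, ⁅J A, v⁆ ∈ W) (hcomm : ∀ v ∈ W, ⁅⁅A, J A⁆, v⁆ ∈ C) :
    ∀ v ∈ W, ⁅A, v⁆ ∈ C ∧ ⁅J A, v⁆ ∈ C := by
  set y : Fin 2 → L := ![U, J U] with hy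
  have y0 : y 0 = U := rfl
  have y1 : y 1 = J U := rfl
  have hyW : ∀ j, y j ∈ W := by
    intro j; fin_cases j
    · exact hUW
    · exact hJW _ hUW
  have hC : ∀ i, ∀ c ∈ C, g (y i) c = 0 := by
    intro i c hc
    have := mem_complexPerp.1 (hCU hc)
    fin_cases i
    · exact this.1
    · exact this.2
  have hpres : ∀ P : L →ₗ[ℝ] L, (∀ c ∈ C, P c ∈ C) → (∀ v ∈ W, P v ∈ W) →
      PreservesFrame g y C P := by
    intro P h1 h2
    refine ⟨h1, fun j => ?_⟩
    have := hW _ (h2 _ (hyW j))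
    simpa [Fin.sum_univ_two, y0, y1] using this
  have hPA := hpres (LieAlgebra.ad ℝ L A) hAC hAW
  have hPB := hpres (LieAlgebra.ad ℝ L (J A)) hJAC hJAW
  have hPJ := hpres J hJC hJW
  have horth : ∀ i j, g (y i) (y j) = if i = j then 1 else 0 := by
    intro i j
    fin_cases i <;> fin_cases j <;> simp [y0, y1, hU, h.g_J, h.g_J_self, h.symm (J U) U]
  have hJm : frameMatrix g y J = !![0, -1; 1, 0] := by
    ext i j
    fin_cases i <;> fin_cases j <;>
      simp [frameMatrix_apply, y0, y1, hU, h.g_J, h.g_J_self, h.J_J, h.symm (J U) U]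
  have hN := h.frameMatrix_integrable hPA hPB hPJ hC
  rw [hJm] at hN
  have hz := eq_zero_of_integrable_two
    (hPA.isNilpotent hC horth (LieModule.isNilpotent_toEnd_of_isNilpotent ℝ L L A))
    (hPB.isNilpotent hC horth (LieModule.isNilpotent_toEnd_of_isNilpotent ℝ L L (J A)))
    (frameMatrix_comm hPA hPB hC fun j => hcomm _ (hyW j)) hN
  have hA0 := hPA.mem_of_eq_zero hz.1
  have hB0 := hPB.mem_of_eq_zero hz.2
  intro v hv
  have hv' := hW v hv
  have e : ∀ B : L, ⁅B, v⁆ = ⁅B, v - (g U v • U + g (J U) v • J U)⁆ + (g U v • ⁅B, U⁆ +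
      g (J U) v • ⁅B, J U⁆) := by
    intro B
    simp only [lie_sub, lie_add, lie_smul]; abel
  rw [e A, e (J A)]
  exact ⟨C.add_mem (hAC _ hv') (C.add_mem (C.smul_mem _ (hA0 0)) (C.smul_mem _ (hA0 1))),
    C.add_mem (hJAC _ hv') (C.add_mem (C.smul_mem _ (hB0 0)) (C.smul_mem _ (hB0 1)))⟩

/-- The strong KT equation for an abelian ideal `H` of codimension two. -/
theorem closed_abelian {X : L} {H : Submodule ℝ L} (hH : ∀ v : L, ∀ w : L, ⁅v, w⁆ ∈ H)
    (hJH : ∀ v ∈ H, J v ∈ H) (hab : ∀ v ∈ H, ∀ w ∈ H, ⁅v, w⁆ = 0) {u v : L} (hu : u ∈ H)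
    (hv : v ∈ H) :
    g ⁅X, J ⁅X, u⁆⁆ v - g ⁅X, J v⁆ ⁅X, u⁆ - g ⁅X, J ⁅X, v⁆⁆ u + g ⁅X, J u⁆ ⁅X, v⁆ +
    (g ⁅J X, J ⁅J X, u⁆⁆ v - g ⁅J X, J v⁆ ⁅J X, u⁆ - g ⁅J X, J ⁅J X, v⁆⁆ u +
      g ⁅J X, J u⁆ ⁅J X, v⁆) = 0 := by
  have hc := h.closed X (J X) u v
  have z1 : ∀ a b : L, a ∈ H → b ∈ H → ⁅J a, J b⁆ = 0 := fun a b ha hb =>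
    hab _ (hJH a ha) _ (hJH b hb)
  simp only [h.torsion_eq] at hc
  have hsw : ∀ a b : L, ⁅J a, X⁆ = -⁅X, J a⁆ := fun a b => (lie_skew _ _).symm
  simp only [h.J_J, z1 _ _ (hH X (J X)) hu, z1 _ _ (hH X (J X)) hv, z1 _ _ hu hv,
    z1 _ _ (hH X u) hv, z1 _ _ (hH X v) hu, z1 _ _ (hH (J X) u) hv, z1 _ _ (hH (J X) v) hu,
    hab _ hu _ hv, map_zero, zero_lie, lie_zero, LinearMap.zero_apply, neg_lie, lie_neg, map_neg,
    LinearMap.neg_apply] at hc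
  have s1 : ∀ a b : L, ⁅a, b⁆ = -⁅b, a⁆ := fun a b => (lie_skew _ _).symm
  rw [s1 (J ⁅X, u⁆) X, s1 (J ⁅X, v⁆) X, s1 (J ⁅J X, u⁆) (J X), s1 (J ⁅J X, v⁆) (J X)] at hc
  simp only [map_neg, LinearMap.neg_apply] at hc
  linarith

/-- If `H` is an abelian ideal with an orthonormal frame, then it is central. -/
theorem abelian_central [LieRing.IsNilpotent L] {X : L} {H : Submodule ℝ L}
    (hH : ∀ v : L, ∀ w : L, ⁅v, w⁆ ∈ H) (hJH : ∀ v ∈ H, J v ∈ H)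
    (hab : ∀ v ∈ H, ∀ w ∈ H, ⁅v, w⁆ = 0)
    (hy : ∀ i j, g (y i) (y j) = if i = j then 1 else 0) (hyH : ∀ i, y i ∈ H)
    (hexp : ∀ v ∈ H, v = ∑ i, g (y i) v • y i) :
    ∀ v ∈ H, ⁅X, v⁆ = 0 ∧ ⁅J X, v⁆ = 0 := by
  have hC : ∀ i, ∀ c ∈ (⊥ : Submodule ℝ L), g (y i) c = 0 := by
    rintro i c hc
    rw [(Submodule.mem_bot ℝ).1 hc, map_zero]
  have hpres : ∀ P : L →ₗ[ℝ] L, (∀ v ∈ H, P v ∈ H) → PreservesFrame g y ⊥ P := by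
    intro P h1
    refine ⟨fun c hc => by rw [(Submodule.mem_bot ℝ).1 hc, map_zero]; exact Submodule.zero_mem _,
      fun j => (Submodule.mem_bot ℝ).2 ?_⟩
    rw [sub_eq_zero]
    exact hexp _ (h1 _ (hyH j))
  have hPA := hpres (LieAlgebra.ad ℝ L X) fun v _ => hH X v
  have hPB := hpres (LieAlgebra.ad ℝ L (J X)) fun v _ => hH (J X) v
  have hPJ := hpres J hJH
  have hN := h.frameMatrix_integrable hPA hPB hPJ hC
  have hJJ : frameMatrix g y J * frameMatrix g y J = -1 := by
    rw [← hPJ.mul hPJ hC]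
    ext i j
    rw [frameMatrix_apply, LinearMap.comp_apply, h.J_J, map_neg, hy, Matrix.neg_apply,
      Matrix.one_apply]
  have hJt : (frameMatrix g y J).transpose = -frameMatrix g y J := by
    ext i j
    rw [Matrix.transpose_apply, Matrix.neg_apply, frameMatrix_apply, frameMatrix_apply, h.symm,
      h.g_J_left]
  have hpair : ∀ P Q : L →ₗ[ℝ] L, (∀ v ∈ H, P v ∈ H) → ∀ i j, g (P (y i)) (Q (y j)) =
      ((frameMatrix g y P).transpose * frameMatrix g y Q) i j := by
    intro P Q hP i j
    have h1 := hexp _ (hP _ (hyH i))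
    rw [Matrix.mul_apply]
    conv_lhs => rw [h1]
    rw [map_sum, LinearMap.sum_apply]
    refine Finset.sum_congr rfl fun k _ => ?_
    rw [map_smul, LinearMap.smul_apply, smul_eq_mul]
    rfl
  have hent : ∀ (B : L), PreservesFrame g y ⊥ (LieAlgebra.ad ℝ L B) → ∀ i j,
      g ⁅B, J ⁅B, y j⁆⁆ (y i) - g ⁅B, J (y i)⁆ ⁅B, y j⁆ - g ⁅B, J ⁅B, y i⁆⁆ (y j) +
        g ⁅B, J (y j)⁆ ⁅B, y i⁆ =
      ((frameMatrix g y (LieAlgebra.ad ℝ L B) * frameMatrix g y J *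
        frameMatrix g y (LieAlgebra.ad ℝ L B)) -
      (frameMatrix g y (LieAlgebra.ad ℝ L B) * frameMatrix g y J *
        frameMatrix g y (LieAlgebra.ad ℝ L B)).transpose +
      ((frameMatrix g y (LieAlgebra.ad ℝ L B)).transpose * frameMatrix g y (LieAlgebra.ad ℝ L B) *
        frameMatrix g y J - (frameMatrix g y J).transpose *
        (frameMatrix g y (LieAlgebra.ad ℝ L B)).transpose *
          frameMatrix g y (LieAlgebra.ad ℝ L B))) i j := by
    intro B hB i j
    have e1 : ∀ i j, g ⁅B, J ⁅B, y j⁆⁆ (y i) = (frameMatrix g y (LieAlgebra.ad ℝ L B) *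
        frameMatrix g y J * frameMatrix g y (LieAlgebra.ad ℝ L B)) i j := by
      intro i j
      rw [← hB.mul hPJ hC, ← (hB.comp hPJ hC).mul hB hC, h.symm]
      rfl
    have e2 : ∀ i j, g ⁅B, J (y i)⁆ ⁅B, y j⁆ = ((frameMatrix g y J).transpose *
        (frameMatrix g y (LieAlgebra.ad ℝ L B)).transpose *
          frameMatrix g y (LieAlgebra.ad ℝ L B)) i j := by
      intro i j
      rw [← Matrix.transpose_mul, ← hB.mul hPJ hC]
      exact hpair (LieAlgebra.ad ℝ L B ∘ₗ J) (LieAlgebra.ad ℝ L B) (fun v _ => hH B _) i j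
    have e3 : ∀ i j, g ⁅B, J (y j)⁆ ⁅B, y i⁆ = ((frameMatrix g y (LieAlgebra.ad ℝ L B)).transpose *
        frameMatrix g y (LieAlgebra.ad ℝ L B) * frameMatrix g y J) i j := by
      intro i j
      rw [Matrix.mul_assoc, ← hB.mul hPJ hC, h.symm]
      exact hpair (LieAlgebra.ad ℝ L B) (LieAlgebra.ad ℝ L B ∘ₗ J) (fun v _ => hH B _) i j
    rw [e1 i j, e1 j i, e2, e3]
    simp only [Matrix.add_apply, Matrix.sub_apply, Matrix.transpose_apply]
    ring
  have hz := eq_zero_of_integrable_skt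
    (hPA.isNilpotent hC hy (LieModule.isNilpotent_toEnd_of_isNilpotent ℝ L L X))
    (hPB.isNilpotent hC hy (LieModule.isNilpotent_toEnd_of_isNilpotent ℝ L L (J X)))
    (frameMatrix_comm hPA hPB hC fun j => by
      rw [hab _ (hH X (J X)) _ (hyH j)]; exact Submodule.zero_mem _) hJJ hJt hN (by
      ext i j
      have h1 := h.closed_abelian (X := X) hH hJH hab (hyH j) (hyH i)
      rw [hent X hPA, hent (J X) hPB] at h1
      simp only [Matrix.add_apply, Matrix.sub_apply, Matrix.transpose_apply,
        Matrix.zero_apply] at h1 ⊢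
      linarith)
  intro v hv
  have hA0 : ∀ j, ⁅X, y j⁆ = 0 := fun j => (Submodule.mem_bot ℝ).1 (hPA.mem_of_eq_zero hz.1 j)
  have hB0 : ∀ j, ⁅J X, y j⁆ = 0 := fun j => (Submodule.mem_bot ℝ).1 (hPB.mem_of_eq_zero hz.2 j)
  rw [hexp v hv, lie_sum, lie_sum]
  simp [hA0, hB0]

end IsLieSKT

/-! ### The case [Y, JY] = 0 -/

namespace SKTFrame

variable {L : Type*} [LieRing L] [LieAlgebra ℝ L] {J : L →ₗ[ℝ] L} {g : L →ₗ[ℝ] L →ₗ[ℝ] ℝ}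
  {X Y Z : L} (F : SKTFrame J g X Y Z) (h : IsLieSKT J g)
include F

theorem expand_H {v : L} (hv : v ∈ complexPerp J g X) :
    v = g Y v • Y + g (J Y) v • J Y + g Z v • Z + g (J Z) v • J Z := by
  have h1 := mem_complexPerp.1 hv
  have := F.expand v
  rw [h1.1, h1.2] at this
  simpa using this

theorem expand_C {v : L} (hv : v ∈ complexPerp J g X) (hv' : v ∈ complexPerp J g Y) :
    v = g Z v • Z + g (J Z) v • J Z := by
  have h1 := mem_complexPerp.1 hv'
  have := F.expand_H hv
  rw [h1.1, h1.2] at this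
  simpa using this

theorem Y_mem : Y ∈ complexPerp J g X := mem_complexPerp.2 ⟨F.XY, F.XJY⟩

theorem Z_mem : Z ∈ complexPerp J g X := mem_complexPerp.2 ⟨F.XZ, F.XJZ⟩

theorem Z_mem' : Z ∈ complexPerp J g Y := mem_complexPerp.2 ⟨F.YZ, F.YJZ⟩

theorem span_frame : ⊤ ≤ Submodule.span ℝ (Set.range ![X, J X, Y, J Y, Z, J Z]) := by
  intro v _
  obtain ⟨m0, m1, m2, m3, m4, m5⟩ := mem_span_six X (J X) Y (J Y) Z (J Z)
  rw [F.expand v]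
  have sm := fun (c : ℝ) {u : L} => Submodule.smul_mem
    (Submodule.span ℝ (Set.range ![X, J X, Y, J Y, Z, J Z])) (x := u) c
  exact Submodule.add_mem _ (Submodule.add_mem _ (Submodule.add_mem _ (Submodule.add_mem _
    (Submodule.add_mem _ (sm _ m0) (sm _ m1)) (sm _ m2)) (sm _ m3)) (sm _ m4)) (sm _ m5)

include h

/-- The last complex line of the frame is central in the ideal `{X, JX}^⊥`. -/
theorem lie_C_eq_zero [LieRing.IsNilpotent L] {v : L} (hv : v ∈ complexPerp J g X)
    (hv' : v ∈ complexPerp J g Y) {u : L} (hu : u ∈ complexPerp J g X) : ⁅u, v⁆ = 0 := by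
  have h1 := h.lie_mem_of_pair (A := Y) (U := Z) (C := ⊥)
    (W := complexPerp J g X ⊓ complexPerp J g Y) F.ZZ ⟨F.Z_mem, F.Z_mem'⟩
    (fun v hv => ⟨h.J_mem_complexPerp hv.1, h.J_mem_complexPerp hv.2⟩)
    (fun c hc => by rw [(Submodule.mem_bot ℝ).1 hc, map_zero]; exact Submodule.zero_mem _) bot_le
    (fun v hv => (Submodule.mem_bot ℝ).2 (sub_eq_zero.2 (F.expand_C hv.1 hv.2)))
    (fun c hc => by rw [(Submodule.mem_bot ℝ).1 hc, lie_zero]; exact Submodule.zero_mem _)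
    (fun c hc => by rw [(Submodule.mem_bot ℝ).1 hc, lie_zero]; exact Submodule.zero_mem _)
    (fun v hv => ⟨F.lie_mem _ _, F.lie_mem_Y _ F.Y_mem _ hv.1⟩)
    (fun v hv => ⟨F.lie_mem _ _, F.lie_mem_Y _ (h.J_mem_complexPerp F.Y_mem) _ hv.1⟩)
    (fun v hv => (Submodule.mem_bot ℝ).2 (F.lie_eq _ (F.lie_mem _ _)
      (F.lie_mem_Y _ F.Y_mem _ (h.J_mem_complexPerp F.Y_mem)) _ hv.1 hv.2)) v ⟨hv, hv'⟩
  have h2 := (Submodule.mem_bot ℝ).1 h1.1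
  have h3 := (Submodule.mem_bot ℝ).1 h1.2
  have h4 : ⁅Z, v⁆ = 0 := F.lie_eq _ F.Z_mem F.Z_mem' _ hv hv'
  have h5 : ⁅J Z, v⁆ = 0 := F.lie_eq _ (h.J_mem_complexPerp F.Z_mem)
    (h.J_mem_complexPerp F.Z_mem') _ hv hv'
  rw [F.expand_H hu]
  simp [add_lie, h2, h3, h4, h5]

/-- Only ⁅X, JX⁆ survives, and it lies in the central space {X, JX}^⊥; it is exchanged for a frame
vector along which it has a nonzero coordinate. -/
theorem isOneOfFour_of_central (hdim : Module.finrank ℝ L = 6)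
    (hc : ∀ v ∈ complexPerp J g X, ∀ u : L, ⁅v, u⁆ = 0) (hXX : ⁅X, J X⁆ ≠ 0) :
    IsOneOfFour L := by
  have hJY := h.J_mem_complexPerp F.Y_mem
  have hJZ := h.J_mem_complexPerp F.Z_mem
  have hW := F.lie_mem X (J X)
  have hexp := F.expand_H hW
  have key : ∀ {u1 u2 u3 u4 : L} {a1 a2 a3 a4 : ℝ}, u1 ∈ complexPerp J g X →
      u2 ∈ complexPerp J g X → u3 ∈ complexPerp J g X → u4 ∈ complexPerp J g X → a1 ≠ 0 →
      ⁅X, J X⁆ = a1 • u1 + a2 • u2 + a3 • u3 + a4 • u4 →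
      ⊤ ≤ Submodule.span ℝ (Set.range ![X, J X, u1, u2, u3, u4]) → IsOneOfFour L := by
    intro u1 u2 u3 u4 a1 a2 a3 a4 k1 k2 k3 k4 ha he hs
    refine isOneOfFour_of_single hdim (f0 := X) (f1 := J X) (f2 := u2) (f3 := u3) (f4 := u4)
      (f5 := ⁅X, J X⁆) (hs.trans ?_) rfl (lie_swap_eq_zero (hc _ k2 _))
      (lie_swap_eq_zero (hc _ k3 _)) (lie_swap_eq_zero (hc _ k2 _))
      (lie_swap_eq_zero (hc _ k3 _)) (hc _ k2 _) (hc _ k4) (hc _ hW)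
    obtain ⟨m0, m1, m2, m3, m4, m5⟩ := mem_span_six X (J X) u2 u3 u4 ⁅X, J X⁆
    refine range_subset_of_six m0 m1 ?_ m2 m3 m4
    refine (Submodule.smul_mem_iff _ ha).1 ?_
    have e : a1 • u1 = ⁅X, J X⁆ - a2 • u2 - a3 • u3 - a4 • u4 := by rw [he]; abel
    rw [e]
    exact Submodule.sub_mem _ (Submodule.sub_mem _ (Submodule.sub_mem _ m5
      (Submodule.smul_mem _ _ m2)) (Submodule.smul_mem _ _ m3)) (Submodule.smul_mem _ _ m4)
  have hs := F.span_frame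
  by_cases h1 : g Y ⁅X, J X⁆ = 0
  · by_cases h2 : g (J Y) ⁅X, J X⁆ = 0
    · by_cases h3 : g Z ⁅X, J X⁆ = 0
      · have h4 : g (J Z) ⁅X, J X⁆ ≠ 0 := by
          intro h4
          rw [h1, h2, h3, h4] at hexp
          exact hXX (by simpa using hexp)
        refine key (u1 := J Z) (u2 := Y) (u3 := J Y) (u4 := Z) hJZ F.Y_mem hJY F.Z_mem h4
          (hexp.trans (by abel)) (hs.trans ?_)
        obtain ⟨m0, m1, m2, m3, m4, m5⟩ := mem_span_six X (J X) (J Z) Y (J Y) Z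
        exact range_subset_of_six m0 m1 m3 m4 m5 m2
      · refine key (u1 := Z) (u2 := Y) (u3 := J Y) (u4 := J Z) F.Z_mem F.Y_mem hJY hJZ h3
          (hexp.trans (by abel)) (hs.trans ?_)
        obtain ⟨m0, m1, m2, m3, m4, m5⟩ := mem_span_six X (J X) Z Y (J Y) (J Z)
        exact range_subset_of_six m0 m1 m3 m4 m2 m5
    · refine key (u1 := J Y) (u2 := Y) (u3 := Z) (u4 := J Z) hJY F.Y_mem F.Z_mem hJZ h2
        (hexp.trans (by abel)) (hs.trans ?_)
      obtain ⟨m0, m1, m2, m3, m4, m5⟩ := mem_span_six X (J X) (J Y) Y Z (J Z)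
      exact range_subset_of_six m0 m1 m3 m2 m4 m5
  · exact key (u1 := Y) (u2 := J Y) (u3 := Z) (u4 := J Z) F.Y_mem hJY F.Z_mem hJZ h1 hexp hs

/-- Since Z and JZ are central in H = {X, JX}^⊥, the vanishing of ⁅Y, JY⁆ makes H abelian;
`abelian_central` then makes it central. -/
theorem isOneOfFour_of_abelian [FiniteDimensional ℝ L] [LieRing.IsNilpotent L]
    (hdim : Module.finrank ℝ L = 6) (hw : ⁅Y, J Y⁆ = 0) : IsOneOfFour L := by
  have hJ : ∀ v ∈ complexPerp J g X, J v ∈ complexPerp J g X := fun v => h.J_mem_complexPerp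
  have hJY := hJ _ F.Y_mem
  have hJZ := hJ _ F.Z_mem
  have hJZ' := h.J_mem_complexPerp F.Z_mem'
  have hab : ∀ v ∈ complexPerp J g X, ∀ w ∈ complexPerp J g X, ⁅v, w⁆ = 0 := by
    intro v hv w hw'
    rw [F.expand_H hv, F.expand_H hw']
    have z1 : ∀ {a : L}, a ∈ complexPerp J g X → ⁅a, Z⁆ = 0 := fun ha =>
      F.lie_C_eq_zero h F.Z_mem F.Z_mem' ha
    have z2 : ∀ {a : L}, a ∈ complexPerp J g X → ⁅a, J Z⁆ = 0 := fun ha =>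
      F.lie_C_eq_zero h hJZ hJZ' ha
    simp [add_lie, lie_add, hw, lie_swap_eq_zero hw, z1 F.Y_mem, z1 hJY, z1 hJZ, z2 F.Y_mem,
      z2 hJY, z2 F.Z_mem, lie_swap_eq_zero (z1 F.Y_mem), lie_swap_eq_zero (z1 hJY),
      lie_swap_eq_zero (z2 F.Y_mem), lie_swap_eq_zero (z2 hJY)]
  have hcen := h.abelian_central (X := X) (y := ![Y, J Y, Z, J Z]) (H := complexPerp J g X)
    F.lie_mem hJ hab (by
      have s := h.symm
      intro i j
      fin_cases i <;> fin_cases j <;>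
        simp [F.YY, F.ZZ, F.YZ, F.YJZ, h.g_J, h.g_J_self, s Z Y, s (J Y) Y, s (J Z) Z, s Z (J Y),
          s (J Z) Y, (mem_complexPerp.1 hJZ').1])
    (by
      intro i
      fin_cases i
      · exact F.Y_mem
      · exact hJY
      · exact F.Z_mem
      · exact hJZ)
    (fun v hv => by simpa [Fin.sum_univ_four] using F.expand_H hv)
  have hc : ∀ v ∈ complexPerp J g X, ∀ u : L, ⁅v, u⁆ = 0 := by
    intro v hv u
    apply lie_swap_eq_zero
    have e : u = g X u • X + g (J X) u • J X + (u - (g X u • X + g (J X) u • J X)) := by abel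
    have hu : u - (g X u • X + g (J X) u • J X) ∈ complexPerp J g X := by
      have e1 := F.expand u
      have e2 : u - (g X u • X + g (J X) u • J X) =
          g Y u • Y + g (J Y) u • J Y + g Z u • Z + g (J Z) u • J Z := by
        rw [sub_eq_iff_eq_add]
        exact e1.trans (by abel)
      rw [e2]
      exact Submodule.add_mem _ (Submodule.add_mem _ (Submodule.add_mem _
        (Submodule.smul_mem _ _ F.Y_mem) (Submodule.smul_mem _ _ hJY))
        (Submodule.smul_mem _ _ F.Z_mem)) (Submodule.smul_mem _ _ hJZ)
    rw [e, add_lie, add_lie, smul_lie, smul_lie, (hcen v hv).1, (hcen v hv).2, hab _ hu _ hv]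
    simp
  -- If ⁅X, JX⁆ vanished too, the algebra would be abelian and dΩ = 0, contrary to the strong KT
  -- assumption.
  refine F.isOneOfFour_of_central h hdim hc fun h0 => ?_
  obtain ⟨x, y, z, hxyz⟩ := h.nonclosed
  apply hxyz
  have hall : ∀ u v : L, ⁅u, v⁆ = 0 := by
    intro u v
    have c : ∀ {a : L}, a ∈ complexPerp J g X → ∀ b : L, ⁅a, b⁆ = 0 := fun ha b => hc _ ha b
    have c' : ∀ {a : L}, a ∈ complexPerp J g X → ∀ b : L, ⁅b, a⁆ = 0 := fun ha b =>
      lie_swap_eq_zero (hc _ ha b)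
    rw [F.expand u, F.expand v]
    simp [add_lie, lie_add, c F.Y_mem, c hJY, c F.Z_mem, c hJZ, c' F.Y_mem, c' hJY, c' F.Z_mem,
      c' hJZ, h0, lie_swap_eq_zero h0]
  simp [dOmega, hall]

end SKTFrame

/-! ### The case [Y, JY] ≠ 0 -/

namespace SKTFrame

variable {L : Type*} [LieRing L] [LieAlgebra ℝ L] {J : L →ₗ[ℝ] L} {g : L →ₗ[ℝ] L →ₗ[ℝ] ℝ}
  {X Y Z : L} (F : SKTFrame J g X Y Z) (h : IsLieSKT J g) [LieRing.IsNilpotent L]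
include F h

/-- In the non-abelian case the last complex line of the frame is central. -/
theorem C_central (hw : ⁅Y, J Y⁆ ≠ 0) :
    ∀ v ∈ complexPerp J g X ⊓ complexPerp J g Y, ∀ u : L, ⁅v, u⁆ = 0 := by
  have hJY := h.J_mem_complexPerp F.Y_mem
  have hideal : ∀ (A : L), ∀ v ∈ complexPerp J g X ⊓ complexPerp J g Y,
      ⁅A, v⁆ ∈ complexPerp J g X ⊓ complexPerp J g Y := by
    intro A v hv
    refine ⟨F.lie_mem _ _, ?_⟩
    -- ⁅A, v⁆ commutes with the ideal H = {X, JX}^⊥ by Jacobi, because v does.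
    have hcomm : ∀ u ∈ complexPerp J g X, ⁅u, ⁅A, v⁆⁆ = 0 := by
      intro u hu
      rw [leibniz_lie, F.lie_C_eq_zero h hv.1 hv.2 (F.lie_mem u A),
        F.lie_C_eq_zero h hv.1 hv.2 hu, lie_zero, add_zero]
    have hexp := F.expand_H (F.lie_mem A v)
    have z1 : ∀ {a : L}, a ∈ complexPerp J g X → ⁅a, Z⁆ = 0 := fun ha =>
      F.lie_C_eq_zero h F.Z_mem F.Z_mem' ha
    have z2 : ∀ {a : L}, a ∈ complexPerp J g X → ⁅a, J Z⁆ = 0 := fun ha =>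
      F.lie_C_eq_zero h (h.J_mem_complexPerp F.Z_mem) (h.J_mem_complexPerp F.Z_mem') ha
    -- Bracketing with Y isolates the JY-coordinate and bracketing with JY the Y-coordinate, both
    -- times a multiple of ⁅Y, JY⁆ ≠ 0; so both coordinates vanish.
    have h1 := hcomm Y F.Y_mem
    have h2 := hcomm (J Y) hJY
    have hw' : ⁅J Y, Y⁆ = -⁅Y, J Y⁆ := (lie_skew _ _).symm
    rw [hexp] at h1 h2
    simp only [lie_add, lie_smul, lie_self, smul_zero, zero_add, z1 F.Y_mem, z2 F.Y_mem, z1 hJY,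
      z2 hJY, add_zero, hw', smul_neg, neg_eq_zero, smul_eq_zero, hw, or_false] at h1 h2
    exact mem_complexPerp.2 ⟨h2, h1⟩
  have hp := h.lie_mem_of_pair (A := X) (U := Z) (C := ⊥)
    (W := complexPerp J g X ⊓ complexPerp J g Y) F.ZZ ⟨F.Z_mem, F.Z_mem'⟩
    (fun v hv => ⟨h.J_mem_complexPerp hv.1, h.J_mem_complexPerp hv.2⟩)
    (fun c hc => by rw [(Submodule.mem_bot ℝ).1 hc, map_zero]; exact Submodule.zero_mem _) bot_le
    (fun v hv => (Submodule.mem_bot ℝ).2 (sub_eq_zero.2 (F.expand_C hv.1 hv.2)))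
    (fun c hc => by rw [(Submodule.mem_bot ℝ).1 hc, lie_zero]; exact Submodule.zero_mem _)
    (fun c hc => by rw [(Submodule.mem_bot ℝ).1 hc, lie_zero]; exact Submodule.zero_mem _)
    (hideal X) (hideal (J X))
    (fun v hv => (Submodule.mem_bot ℝ).2 (F.lie_C_eq_zero h hv.1 hv.2 (F.lie_mem _ _)))
  intro v hv u
  apply lie_swap_eq_zero
  have h1 := hp v hv
  rw [Submodule.mem_bot, Submodule.mem_bot] at h1
  have c : ∀ {a : L}, a ∈ complexPerp J g X → ⁅a, v⁆ = 0 := fun ha =>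
    F.lie_C_eq_zero h hv.1 hv.2 ha
  rw [F.expand u]
  simp [add_lie, h1.1, h1.2, c F.Y_mem, c hJY, c F.Z_mem, c (h.J_mem_complexPerp F.Z_mem)]

/-- In the non-abelian case all brackets lie in the last complex line of the frame. -/
theorem lie_mem_C (hw : ⁅Y, J Y⁆ ≠ 0) (u v : L) :
    ⁅u, v⁆ ∈ complexPerp J g X ⊓ complexPerp J g Y := by
  have hcen := F.C_central h hw
  have hJY := h.J_mem_complexPerp F.Y_mem
  have hJZ := h.J_mem_complexPerp F.Z_mem
  have hJZ' := h.J_mem_complexPerp F.Z_mem'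
  have hJC : ∀ v ∈ complexPerp J g X ⊓ complexPerp J g Y,
      J v ∈ complexPerp J g X ⊓ complexPerp J g Y := fun v hv =>
    ⟨h.J_mem_complexPerp hv.1, h.J_mem_complexPerp hv.2⟩
  have hZC : ∀ a b : ℝ, a • Z + b • J Z ∈ complexPerp J g X ⊓ complexPerp J g Y := fun a b =>
    Submodule.add_mem _ (Submodule.smul_mem _ _ ⟨F.Z_mem, F.Z_mem'⟩)
      (Submodule.smul_mem _ _ ⟨hJZ, hJZ'⟩)
  have hz : ∀ {c : L}, c ∈ complexPerp J g X ⊓ complexPerp J g Y → ∀ u : L, ⁅u, c⁆ = 0 :=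
    fun hc u => lie_swap_eq_zero (hcen _ hc u)
  -- X and JX commute on H/C, as ⁅X, JX⁆ ∈ H and ⁅H, H⁆ ⊂ C; hence both send H into C.
  have hp := h.lie_mem_of_pair (A := X) (U := Y) (C := complexPerp J g X ⊓ complexPerp J g Y)
    (W := complexPerp J g X) F.YY F.Y_mem (fun v hv => h.J_mem_complexPerp hv) hJC
    inf_le_right
    (fun v hv => by
      have e : v - (g Y v • Y + g (J Y) v • J Y) = g Z v • Z + g (J Z) v • J Z := by
        rw [sub_eq_iff_eq_add]
        exact (F.expand_H hv).trans (by abel)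
      rw [e]; exact hZC _ _)
    (fun c hc => by rw [hz hc]; exact Submodule.zero_mem _)
    (fun c hc => by rw [hz hc]; exact Submodule.zero_mem _)
    (fun v _ => F.lie_mem _ _) (fun v _ => F.lie_mem _ _)
    (fun v hv => ⟨F.lie_mem _ _, F.lie_mem_Y _ (F.lie_mem _ _) _ hv⟩)
  -- the component of `[X, JX]` along `Y, JY` vanishes
  set W := g Y ⁅X, J X⁆ • Y + g (J Y) ⁅X, J X⁆ • J Y with hW
  obtain ⟨c0, hc0, hXJX⟩ : ∃ c0 ∈ complexPerp J g X ⊓ complexPerp J g Y, ⁅X, J X⁆ = W + c0 :=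
    ⟨_, hZC (g Z ⁅X, J X⁆) (g (J Z) ⁅X, J X⁆), (F.expand_H (F.lie_mem _ _)).trans
      (by rw [hW]; abel)⟩
  have hWH : W ∈ complexPerp J g X := Submodule.add_mem _ (Submodule.smul_mem _ _ F.Y_mem)
    (Submodule.smul_mem _ _ hJY)
  have hJWH := h.J_mem_complexPerp hWH
  have hWW : ∀ ζ ∈ complexPerp J g X ⊓ complexPerp J g Y, g ⁅W, J W⁆ ζ = 0 := by
    intro ζ hζ
    -- With ζ and Jζ central, the only surviving term is the torsion of ⁅X, JX⁆, ζ, JW, which equals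
    -- ±g(⁅W, JW⁆, ζ).
    have h1 := h.closed ζ X (J X) (J W)
    have k1 := hcen _ hζ
    have k2 := hcen _ (hJC _ hζ)
    have k3 := hz (hJC _ hζ)
    have k4 := hcen _ (hJC _ (hp _ hJWH).1)
    have k5 := hcen _ (hJC _ (hp _ hJWH).2)
    have k6 := hcen _ (hJC _ hc0)
    have k7 : ⁅J W, W⁆ = -⁅W, J W⁆ := (lie_skew _ _).symm
    simp only [k1, h.torsion_eq, map_zero, zero_lie, lie_zero, LinearMap.zero_apply, k2, k3, k4,
      k5, hXJX, map_add, add_lie, k6, h.J_J, lie_neg, k7, map_neg, LinearMap.neg_apply] at h1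
    simpa using h1
  have hWW0 : ⁅W, J W⁆ = 0 := by
    have hm : ⁅W, J W⁆ ∈ complexPerp J g X ⊓ complexPerp J g Y :=
      ⟨F.lie_mem _ _, F.lie_mem_Y _ hWH _ hJWH⟩
    by_contra hne
    exact (h.pos _ hne).ne' (hWW _ hm)
  -- ⁅W, JW⁆ is |W|² times ⁅Y, JY⁆.
  have hWeq : W = 0 := by
    have e : ⁅W, J W⁆ = (g Y ⁅X, J X⁆ ^ 2 + g (J Y) ⁅X, J X⁆ ^ 2) • ⁅Y, J Y⁆ := by
      have s : ⁅J Y, Y⁆ = -⁅Y, J Y⁆ := (lie_skew _ _).symm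
      simp only [hW, map_add, map_smul, h.J_J, add_lie, lie_add, smul_lie, lie_smul, lie_neg,
        lie_self, s]
      module
    rw [e, smul_eq_zero] at hWW0
    have h2 := hWW0.resolve_right hw
    have aux : ∀ a b : ℝ, a ^ 2 + b ^ 2 = 0 → a = 0 ∧ b = 0 := fun a b hab =>
      ⟨by nlinarith [sq_nonneg a, sq_nonneg b], by nlinarith [sq_nonneg a, sq_nonneg b]⟩
    obtain ⟨e1, e2⟩ := aux _ _ h2
    rw [hW, e1, e2]; simp
  have kXJX : ⁅X, J X⁆ ∈ complexPerp J g X ⊓ complexPerp J g Y := by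
    rw [hXJX, hWeq, zero_add]; exact hc0
  have kX : ∀ v : L, ⁅X, v⁆ ∈ complexPerp J g X ⊓ complexPerp J g Y := by
    intro v
    rw [F.expand v]
    simp only [lie_add, lie_smul, lie_self, smul_zero, zero_add]
    have sm := fun (c : ℝ) {u : L} => Submodule.smul_mem
      (complexPerp J g X ⊓ complexPerp J g Y) (x := u) c
    exact Submodule.add_mem _ (Submodule.add_mem _ (Submodule.add_mem _ (Submodule.add_mem _
      (sm _ kXJX) (sm _ (hp _ F.Y_mem).1)) (sm _ (hp _ hJY).1)) (sm _ (hp _ F.Z_mem).1))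
      (sm _ (hp _ hJZ).1)
  have kJX : ∀ v : L, ⁅J X, v⁆ ∈ complexPerp J g X ⊓ complexPerp J g Y := by
    intro v
    rw [F.expand v]
    simp only [lie_add, lie_smul, lie_self, smul_zero, add_zero]
    have sm := fun (c : ℝ) {u : L} => Submodule.smul_mem
      (complexPerp J g X ⊓ complexPerp J g Y) (x := u) c
    have kk : ⁅J X, X⁆ ∈ complexPerp J g X ⊓ complexPerp J g Y := by
      rw [← lie_skew]; exact Submodule.neg_mem _ kXJX
    exact Submodule.add_mem _ (Submodule.add_mem _ (Submodule.add_mem _ (Submodule.add_mem _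
      (sm _ kk) (sm _ (hp _ F.Y_mem).2)) (sm _ (hp _ hJY).2)) (sm _ (hp _ F.Z_mem).2))
      (sm _ (hp _ hJZ).2)
  have kH : ∀ a ∈ complexPerp J g X, ∀ v : L, ⁅a, v⁆ ∈ complexPerp J g X ⊓ complexPerp J g Y := by
    intro a ha v
    have e : v = g X v • X + g (J X) v • J X + (g Y v • Y + g (J Y) v • J Y + (g Z v • Z
      + g (J Z) v • J Z)) := (F.expand v).trans (by abel)
    have k3 : g Y v • Y + g (J Y) v • J Y + (g Z v • Z + g (J Z) v • J Z) ∈ complexPerp J g X :=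
      Submodule.add_mem _ (Submodule.add_mem _ (Submodule.smul_mem _ _ F.Y_mem)
        (Submodule.smul_mem _ _ hJY)) (hZC _ _).1
    rw [e, lie_add, lie_add, lie_smul, lie_smul, ← lie_skew, ← lie_skew a (J X)]
    refine Submodule.add_mem _ (Submodule.add_mem _ (Submodule.smul_mem _ _
      (Submodule.neg_mem _ (kX a))) (Submodule.smul_mem _ _ (Submodule.neg_mem _ (kJX a))))
      ⟨F.lie_mem _ _, F.lie_mem_Y _ ha _ k3⟩
  rw [F.expand u]
  simp only [add_lie, smul_lie]
  have sm := fun (c : ℝ) {u : L} => Submodule.smul_mem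
    (complexPerp J g X ⊓ complexPerp J g Y) (x := u) c
  exact Submodule.add_mem _ (Submodule.add_mem _ (Submodule.add_mem _ (Submodule.add_mem _
    (Submodule.add_mem _ (sm _ (kX v)) (sm _ (kJX v))) (sm _ (kH _ F.Y_mem v)))
    (sm _ (kH _ hJY v))) (sm _ (kH _ F.Z_mem v))) (sm _ (kH _ hJZ v))

/-- All brackets are combinations of the central vectors w = ⁅Y, JY⁆ and Jw. Integrability and SKT
become scalar relations between the coefficients, which feed `isOneOfFour_of_brackets`. -/
theorem isOneOfFour_of_nonabelian (hdim : Module.finrank ℝ L = 6) (hw : ⁅Y, J Y⁆ ≠ 0) :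
    IsOneOfFour L := by
  have hcen := F.C_central h hw
  have hmem := F.lie_mem_C h hw
  have hJC : ∀ v ∈ complexPerp J g X ⊓ complexPerp J g Y,
      J v ∈ complexPerp J g X ⊓ complexPerp J g Y := fun v hv =>
    ⟨h.J_mem_complexPerp hv.1, h.J_mem_complexPerp hv.2⟩
  obtain ⟨w, hwdef⟩ : ∃ w, w = ⁅Y, J Y⁆ := ⟨_, rfl⟩
  rw [← hwdef] at hw
  have hwC : w ∈ complexPerp J g X ⊓ complexPerp J g Y := hwdef ▸ hmem _ _
  have hG : 0 < g w w := h.pos _ hw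
  -- coordinates with respect to `w` and `J w`
  have hco : ∀ v ∈ complexPerp J g X ⊓ complexPerp J g Y, ∃ a b : ℝ, v = a • w + b • J w := by
    intro v hv
    have e1 := F.expand_C hv.1 hv.2
    have e2 := F.expand_C hwC.1 hwC.2
    set α := g Z w
    set β := g (J Z) w
    have e3 : J w = α • J Z - β • Z := by
      rw [e2]; simp only [map_add, map_smul, h.J_J]; module
    have hαβ : α ^ 2 + β ^ 2 ≠ 0 := by
      intro h0
      have hα : α = 0 := by nlinarith [sq_nonneg α, sq_nonneg β]
      have hβ : β = 0 := by nlinarith [sq_nonneg α, sq_nonneg β]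
      rw [hα, hβ] at e2
      exact hw (by simpa using e2)
    refine ⟨(g Z v * α + g (J Z) v * β) / (α ^ 2 + β ^ 2),
      (g (J Z) v * α - g Z v * β) / (α ^ 2 + β ^ 2), ?_⟩
    rw [e3, e2]
    nth_rewrite 1 [e1]
    match_scalars <;> field_simp <;> ring
  obtain ⟨t0, p, e0⟩ := hco _ (hmem X (J X))
  obtain ⟨a', a, e11⟩ := hco _ (hmem X Y)
  obtain ⟨b', b, e12⟩ := hco _ (hmem X (J Y))
  obtain ⟨c', c, e21⟩ := hco _ (hmem (J X) Y)
  obtain ⟨d', d, e22⟩ := hco _ (hmem (J X) (J Y))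
  have hlin : ∀ a b : ℝ, a • w + b • J w = 0 → a = 0 ∧ b = 0 := by
    intro a b hab
    have h1 := congrArg (g w) hab
    have h2 := congrArg (g (J w)) hab
    simp only [map_add, map_smul, h.g_J_self, h.g_J, h.symm (J w) w, smul_eq_mul, map_zero,
      mul_zero, add_zero, zero_add, mul_eq_zero, hG.ne', or_false] at h1 h2
    exact ⟨h1, h2⟩
  have hN := h.integrable X Y
  rw [e11, e12, e21, e22] at hN
  simp only [map_add, map_smul, h.J_J] at hN
  have hN' := hlin (d' - a' + (b + c)) (d - a - (b' + c')) (by rw [← hN]; module)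
  -- As J of every bracket is central, SKT on the frame says that 2g(⁅X, JX⁆, w) is the sum of the
  -- squared lengths of ⁅X, Y⁆, ⁅X, JY⁆, ⁅JX, Y⁆ and ⁅JX, JY⁆.
  have hcl := h.closed X (J X) Y (J Y)
  have s : ∀ x y : L, ⁅J x, y⁆ = -⁅y, J x⁆ := fun x y => (lie_skew _ _).symm
  have hT : ∀ x y z u : L, torsion J g ⁅x, y⁆ z u = -g ⁅J z, J u⁆ ⁅x, y⁆ := by
    intro x y z u
    have k1 := hcen _ (hJC _ (hmem x y))
    simp only [h.torsion_eq, k1, map_zero, LinearMap.zero_apply]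
    ring
  simp only [hT, h.J_J, neg_lie, lie_neg, neg_neg, map_neg, LinearMap.neg_apply] at hcl
  have hw2 : ⁅J Y, Y⁆ = -w := by rw [hwdef]; exact (lie_skew _ _).symm
  have e0' : ⁅J X, X⁆ = -(t0 • w + p • J w) := by rw [← e0]; exact (lie_skew _ _).symm
  rw [hw2, e0', e0, e11, e12, e21, e22, ← hwdef] at hcl
  simp only [map_add, map_smul, map_neg, LinearMap.add_apply, LinearMap.smul_apply,
    LinearMap.neg_apply, h.g_J, h.g_J_self, h.symm (J w) w, smul_eq_mul, mul_zero, add_zero,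
    zero_add] at hcl
  have ht0 : 2 * t0 = a ^ 2 + b ^ 2 + c ^ 2 + d ^ 2 + a' ^ 2 + b' ^ 2 + c' ^ 2 + d' ^ 2 := by
    have : (2 * t0 - (a ^ 2 + b ^ 2 + c ^ 2 + d ^ 2 + a' ^ 2 + b' ^ 2 + c' ^ 2 + d' ^ 2)) *
        g w w = 0 := by linarith
    have := (mul_eq_zero.1 this).resolve_right hG.ne'
    linarith
  have e11' : ⁅Y, X⁆ = -(a' • w + a • J w) := by rw [← e11]; exact (lie_skew _ _).symm
  have e12' : ⁅J Y, X⁆ = -(b' • w + b • J w) := by rw [← e12]; exact (lie_skew _ _).symm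
  have e21' : ⁅Y, J X⁆ = -(c' • w + c • J w) := by rw [← e21]; exact (lie_skew _ _).symm
  have e22' : ⁅J Y, J X⁆ = -(d' • w + d • J w) := by rw [← e22]; exact (lie_skew _ _).symm
  -- Because ⁅Y, JY⁆ = w, adding multiples of Y and JY to X and JX removes the w-components of the
  -- mixed brackets. The new t gives 2t = a² + b² + c² + d² + (d' − a')² + (b' + c')², and
  -- integrability replaces the last two squares by (b + c)² + (d − a)².
  refine isOneOfFour_of_brackets hdim (x1 := X - b' • Y + a' • J Y) (x2 := J X - d' • Y + c' • J Y)
    (y1 := Y) (y2 := J Y) (w := w) (z := J w) (a := a) (b := b) (c := c) (d := d)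
    (t := t0 - a' * d' + b' * c') (p := p - d' * a + c' * b + b' * c - a' * d)
    (F.span_frame.trans ?_) (hcen _ hwC) (hcen _ (hJC _ hwC)) ?_ hwdef.symm ?_ ?_ ?_ ?_ ?_
  · obtain ⟨m0, m1, m2, m3, m4, m5⟩ := mem_span_six (X - b' • Y + a' • J Y)
      (J X - d' • Y + c' • J Y) Y (J Y) w (J w)
    set S := Submodule.span ℝ (Set.range ![X - b' • Y + a' • J Y, J X - d' • Y + c' • J Y, Y, J Y,
      w, J w])
    have hSC : ∀ v ∈ complexPerp J g X ⊓ complexPerp J g Y, v ∈ S := by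
      intro v hv
      obtain ⟨a, b, rfl⟩ := hco v hv
      exact S.add_mem (S.smul_mem _ m4) (S.smul_mem _ m5)
    refine range_subset_of_six ?_ ?_ m2 m3 (hSC _ ⟨F.Z_mem, F.Z_mem'⟩)
      (hSC _ (hJC _ ⟨F.Z_mem, F.Z_mem'⟩))
    · have := S.sub_mem (S.add_mem m0 (S.smul_mem b' m2)) (S.smul_mem a' m3)
      convert this using 1
      module
    · have := S.sub_mem (S.add_mem m1 (S.smul_mem d' m2)) (S.smul_mem c' m3)
      convert this using 1
      module
  · simp only [add_lie, sub_lie, lie_add, lie_sub, smul_lie, lie_smul, lie_self, e0, e11, e12,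
      e21', e22', hw2, ← hwdef]
    module
  · simp only [add_lie, sub_lie, smul_lie, lie_self, e11, hw2]
    module
  · simp only [add_lie, sub_lie, smul_lie, lie_self, e12, ← hwdef]
    module
  · simp only [add_lie, sub_lie, smul_lie, lie_self, e21, hw2]
    module
  · simp only [add_lie, sub_lie, smul_lie, lie_self, e22, ← hwdef]
    module
  · have h1 : d' - a' = -(b + c) := by linarith [hN'.1]
    have h2 : b' + c' = d - a := by linarith [hN'.2]
    have h3 : (d' - a') ^ 2 + (b' + c') ^ 2 = (b + c) ^ 2 + (d - a) ^ 2 := by rw [h1, h2]; ring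
    nlinarith

end SKTFrame

theorem IsLieSKT.isOneOfFour {L : Type*} [LieRing L] [LieAlgebra ℝ L] {J : L →ₗ[ℝ] L}
    {g : L →ₗ[ℝ] L →ₗ[ℝ] ℝ} (h : IsLieSKT J g) [FiniteDimensional ℝ L] [LieRing.IsNilpotent L]
    (hdim : Module.finrank ℝ L = 6) : IsOneOfFour L := by
  obtain ⟨X, Y, Z, F⟩ := h.exists_frame hdim
  by_cases hw : ⁅Y, J Y⁆ = 0
  · exact F.isOneOfFour_of_abelian h hdim hw
  · exact F.isOneOfFour_of_nonabelian h hdim hw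

/-! ### Gluing local functions with locally constant differences -/

section Glue

/-- The bundle of local integration constants of a family of local functions `f i` on `U i` whose
differences are locally constant. -/
def constantsBundle {X A : Type*} [TopologicalSpace X] [AddCommGroup A] [TopologicalSpace A]
    [DiscreteTopology A] (U : X → Set X) (hU : ∀ x, IsOpen (U x)) (hxU : ∀ x, x ∈ U x)
    (f : X → X → A)
    (h : ∀ i j, ∀ x ∈ U i ∩ U j, ∀ᶠ y in 𝓝 x, f i y - f j y = f i x - f j x) :
    FiberBundleCore X X A where
  baseSet := U
  isOpen_baseSet := hU
  indexAt := id
  mem_baseSet_at := hxU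
  coordChange i j x c := c + (f i x - f j x)
  coordChange_self i x _ v := by simp
  continuousOn_coordChange i j := by
    rintro ⟨x, c⟩ ⟨hx, -⟩
    refine ContinuousAt.continuousWithinAt ?_
    have h1 : ∀ᶠ p : X × A in 𝓝 (x, c), p.2 + (f i p.1 - f j p.1) = c + (f i x - f j x) := by
      have h2 : ∀ᶠ p : X × A in 𝓝 (x, c), p.2 = c :=
        (continuous_snd.tendsto (x, c)).eventually ((isOpen_discrete {c}).mem_nhds rfl)
      have h3 : ∀ᶠ p : X × A in 𝓝 (x, c), f i p.1 - f j p.1 = f i x - f j x :=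
        (continuous_fst.tendsto (x, c)).eventually (h i j x hx)
      filter_upwards [h2, h3] with p hp hp'
      rw [hp, hp']
    exact continuousAt_const.congr (h1.mono fun p hp => hp.symm)
  coordChange_comp i j k x _ v := by abel

/-- The admissible integration constants form a covering space of X, with A discrete as fibre, and
over a simply connected base it has a section. -/
theorem exists_glue {X A : Type*} [TopologicalSpace X] [SimplyConnectedSpace X]
    [LocallyPathConnectedSpace X] [AddCommGroup A] (U : X → Set X) (hU : ∀ x, IsOpen (U x))
    (hxU : ∀ x, x ∈ U x) (f : X → X → A)
    (h : ∀ i j, ∀ x ∈ U i ∩ U j, ∀ᶠ y in 𝓝 x, f i y - f j y = f i x - f j x) :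
    ∃ F : X → A, ∀ x, ∀ᶠ y in 𝓝 x, F y - f x y = F x - f x x := by
  let _ : TopologicalSpace A := ⊥
  have : DiscreteTopology A := ⟨rfl⟩
  set Z := constantsBundle U hU hxU f h with hZ
  have hc : IsCoveringMap (Bundle.TotalSpace.proj : Bundle.TotalSpace A Z.Fiber → X) :=
    FiberBundle.isCoveringMap
  obtain ⟨x₀⟩ : Nonempty X := inferInstance
  -- A lift of the identity of X is a global section, that is, a coherent choice of constants.
  obtain ⟨s, ⟨-, hs⟩, -⟩ := hc.existsUnique_continuousMap_lifts (ContinuousMap.id X) x₀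
    (⟨x₀, (0 : A)⟩ : Bundle.TotalSpace A Z.Fiber) rfl
  have hs1 : ∀ x, (s x).proj = x := fun x => congrFun hs x
  refine ⟨fun x => f (s x).proj (s x).proj + (show A from (s x).2), fun x => ?_⟩
  have key : ∀ y, (Z.localTriv x (s y)).2 =
      f (s y).proj (s y).proj + (show A from (s y).2) - f x y := by
    intro y
    have : (Z.localTriv x (s y)).2 =
      (show A from (s y).2) + (f (s y).proj (s y).proj - f x (s y).proj) := rfl
    rw [this]
    have e : f x (s y).proj = f x y := by rw [hs1]
    rw [e]; abel
  have hcont : ContinuousAt (fun y => (Z.localTriv x (s y)).2) x := by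
    have hm : s x ∈ (Z.localTriv x).source := by
      rw [Z.mem_localTriv_source, hs1]
      exact hxU x
    exact continuous_snd.continuousAt.comp
      (((Z.localTriv x).continuousAt hm).comp (f := s) s.continuous.continuousAt)
  have := hcont.eventually ((isOpen_discrete {(Z.localTriv x (s x)).2}).mem_nhds rfl)
  filter_upwards [this] with y hy
  have hy' : (Z.localTriv x (s y)).2 = (Z.localTriv x (s x)).2 := hy
  rwa [key, key] at hy'

end Glue

/-! ### Closed 1-forms on simply connected manifolds are exact -/

section Primitive

variable {E : Type*} [NormedAddCommGroup E] [NormedSpace ℝ E]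
  {N : Type*} [TopologicalSpace N] [ChartedSpace E N] [IsManifold 𝓘(ℝ, E) ∞ N]
  {F : Type*} [NormedAddCommGroup F] [NormedSpace ℝ F]

theorem hasFDerivAt_comp_extChartAt_symm {h : N → F} {x : N} {y : E}
    (hy : y ∈ (extChartAt 𝓘(ℝ, E) x).target)
    (hh : MDifferentiableAt 𝓘(ℝ, E) 𝓘(ℝ, F) h ((extChartAt 𝓘(ℝ, E) x).symm y)) :
    HasFDerivAt (h ∘ (extChartAt 𝓘(ℝ, E) x).symm)
      ((show E →L[ℝ] F from mfderiv 𝓘(ℝ, E) 𝓘(ℝ, F) h ((extChartAt 𝓘(ℝ, E) x).symm y)).comp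
        (show E →L[ℝ] E from mfderiv 𝓘(ℝ, E) 𝓘(ℝ, E) (extChartAt 𝓘(ℝ, E) x).symm y)) y := by
  have h1 := (eventually_mdifferentiableAt_extChartAt_symm hy).self_of_nhds
  exact (hh.hasMFDerivAt.comp y h1.hasMFDerivAt).hasFDerivAt

theorem eventually_eq_of_mfderiv_eq_zero {h : N → F} {x : N}
    (hh : ∀ᶠ y in 𝓝 x, MDifferentiableAt 𝓘(ℝ, E) 𝓘(ℝ, F) h y ∧ mfderiv 𝓘(ℝ, E) 𝓘(ℝ, F) h y = 0) :
    ∀ᶠ y in 𝓝 x, h y = h x := by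
  set φ := extChartAt 𝓘(ℝ, E) x with hφ
  have h1 : ∀ᶠ z in 𝓝 (φ x), z ∈ φ.target ∧ (MDifferentiableAt 𝓘(ℝ, E) 𝓘(ℝ, F) h (φ.symm z) ∧
      mfderiv 𝓘(ℝ, E) 𝓘(ℝ, F) h (φ.symm z) = 0) := by
    refine Eventually.and (extChartAt_target_mem_nhds (I := 𝓘(ℝ, E)) x) ?_
    refine (continuousAt_extChartAt_symm (I := 𝓘(ℝ, E)) x).tendsto.eventually
      (p := fun y => MDifferentiableAt 𝓘(ℝ, E) 𝓘(ℝ, F) h y ∧ mfderiv 𝓘(ℝ, E) 𝓘(ℝ, F) h y = 0) ?_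
    rwa [extChartAt_to_inv]
  obtain ⟨r, hr, hB⟩ := Metric.eventually_nhds_iff_ball.1 h1
  have hconst : ∀ z ∈ Metric.ball (φ x) r, h (φ.symm z) = h (φ.symm (φ x)) := by
    intro z hz
    refine Metric.isOpen_ball.is_const_of_fderiv_eq_zero (𝕜 := ℝ) (f := h ∘ φ.symm)
      (convex_ball (φ x) r).isPreconnected
      (fun w hw => ?_) (fun w hw => ?_) hz (Metric.mem_ball_self hr)
    · exact (hasFDerivAt_comp_extChartAt_symm (hB w hw).1
        (hB w hw).2.1).differentiableAt.differentiableWithinAt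
    · rw [(hasFDerivAt_comp_extChartAt_symm (hB w hw).1 (hB w hw).2.1).fderiv, (hB w hw).2.2]
      exact ContinuousLinearMap.zero_comp _
  have h2 : ∀ᶠ y in 𝓝 x, φ y ∈ Metric.ball (φ x) r :=
    (continuousAt_extChartAt (I := 𝓘(ℝ, E)) x).eventually (Metric.ball_mem_nhds _ hr)
  filter_upwards [h2, extChartAt_source_mem_nhds (I := 𝓘(ℝ, E)) x] with y hy hys
  have := hconst _ hy
  rwa [φ.left_inv hys, extChartAt_to_inv] at this

theorem eq_of_mfderiv_eq_zero [PreconnectedSpace N] {h : N → F}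
    (hh : ∀ x, MDifferentiableAt 𝓘(ℝ, E) 𝓘(ℝ, F) h x) (h0 : ∀ x, mfderiv 𝓘(ℝ, E) 𝓘(ℝ, F) h x = 0)
    (x y : N) : h x = h y :=
  ((IsLocallyConstant.iff_eventually_eq h).2 fun _ => eventually_eq_of_mfderiv_eq_zero
    (Eventually.of_forall fun z => ⟨hh z, h0 z⟩)).apply_eq_of_preconnectedSpace x y

/-- A 1-form as a field of linear maps. -/
def oneFormMap (T : E [⋀^Fin 1]→L[ℝ] ℝ) : E →L[ℝ] ℝ :=
  (ContinuousAlternatingMap.ofSubsingleton ℝ E ℝ (0 : Fin 1)).symm T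

theorem contDiffOn_oneFormMap [FiniteDimensional ℝ E] {τ : E → E [⋀^Fin 1]→L[ℝ] ℝ} {s : Set E}
    (h : ContDiffOn ℝ ∞ τ s) :
    ContDiffOn ℝ ∞ (fun y => oneFormMap (τ y)) s := by
  rw [contDiffOn_clm_apply]
  intro v
  exact (ContinuousAlternatingMap.apply ℝ E ℝ (fun _ : Fin 1 => v)).contDiff.comp_contDiffOn h

theorem fderiv_oneFormMap_symmetric [FiniteDimensional ℝ E] {τ : E → E [⋀^Fin 1]→L[ℝ] ℝ} {s : Set E} {y : E}
    (hs : IsOpen s) (h : ContDiffOn ℝ ∞ τ s) (hy : y ∈ s) (hd : extDeriv τ y = 0) (u v : E) :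
    fderiv ℝ (fun y => oneFormMap (τ y)) y u v = fderiv ℝ (fun y => oneFormMap (τ y)) y v u := by
  have h1 := extDeriv_apply ((h.contDiffAt (hs.mem_nhds hy)).differentiableAt (by simp)) ![u, v]
  have hdiff : DifferentiableAt ℝ (fun y => oneFormMap (τ y)) y :=
    ((contDiffOn_oneFormMap h).contDiffAt (hs.mem_nhds hy)).differentiableAt (by simp)
  have h2 : ∀ u v : E, fderiv ℝ (fun y => oneFormMap (τ y)) y u v =
      fderiv ℝ (fun y => τ y fun _ => v) y u := by
    intro u v
    have := fderiv_clm_apply hdiff (differentiableAt_const v)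
    have h3 := congrArg (fun A => A u) this
    simp only [fderiv_fun_const, Pi.zero_apply, ContinuousLinearMap.comp_zero, zero_add,
      ContinuousLinearMap.flip_apply] at h3
    exact h3.symm
  rw [hd, Fin.sum_univ_two] at h1
  have e0 : (0 : Fin 2).removeNth ![u, v] = fun _ => v := by ext i; fin_cases i; rfl
  have e1 : (1 : Fin 2).removeNth ![u, v] = fun _ => u := by ext i; fin_cases i; rfl
  rw [e0, e1] at h1
  rw [h2, h2]
  have h0 : (0 : E [⋀^Fin 2]→L[ℝ] ℝ) ![u, v] = 0 := rfl
  rw [h0] at h1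
  simp only [Fin.val_zero, pow_zero, one_smul, Fin.val_one,
    pow_one, neg_smul, Matrix.cons_val_zero, Matrix.cons_val_one] at h1
  linarith

/-- The value of a 1-form at a point, as a linear map. -/
def FormField.lin (σ : FormField E N 1) (x : N) : E →L[ℝ] ℝ :=
  oneFormMap (show E [⋀^Fin 1]→L[ℝ] ℝ from σ x)

theorem FormField.lin_apply (σ : FormField E N 1) (x : N) (v : Fin 1 → TangentSpace 𝓘(ℝ, E) x) :
    σ x v = σ.lin x (v 0) := by
  change σ x v = σ x fun _ => v 0
  congr 1
  ext i
  rw [Subsingleton.elim i 0]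

theorem inChart_extChartAt (σ : FormField E N 1) {x y : N}
    (hy : y ∈ (extChartAt 𝓘(ℝ, E) x).source) (v : E) :
    oneFormMap (σ.inChart x (extChartAt 𝓘(ℝ, E) x y))
      (mfderiv 𝓘(ℝ, E) 𝓘(ℝ, E) (extChartAt 𝓘(ℝ, E) x) y (show TangentSpace 𝓘(ℝ, E) y from v)) =
      σ.lin y v := by
  have : IsManifold 𝓘(ℝ, E) 1 N := IsManifold.of_le (n := ∞) (by simp)
  have h0 := mfderivWithin_extChartAt_symm_comp_mfderiv_extChartAt' (I := 𝓘(ℝ, E)) hy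
  rw [modelWithCornersSelf_coe, Set.range_id, mfderivWithin_univ] at h0
  have h1 := congrArg (fun A => A v) h0
  have key : ∀ y' : N, y' = y → ∀ w : E, w = v →
    σ.lin y' w = σ.lin y v := by
    rintro _ rfl _ rfl; rfl
  exact key _ ((extChartAt 𝓘(ℝ, E) x).left_inv hy) _ h1

/-- In a chart the derivative of f is the coefficient function of a smooth form, so
differentiability of f upgrades to smoothness. -/
theorem FormField.Smooth.contMDiff_of_mfderiv [FiniteDimensional ℝ E] {σ : FormField E N 1}
    (hσ : σ.Smooth) {f : N → ℝ} (hf : ∀ x, MDifferentiableAt 𝓘(ℝ, E) 𝓘(ℝ, ℝ) f x)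
    (h : ∀ x v, σ x v = mfderiv 𝓘(ℝ, E) 𝓘(ℝ, ℝ) f x (v 0)) : ContMDiff 𝓘(ℝ, E) 𝓘(ℝ, ℝ) ∞ f := by
  intro x
  have h1 : ContDiffOn ℝ ∞ (f ∘ (extChartAt 𝓘(ℝ, E) x).symm) (extChartAt 𝓘(ℝ, E) x).target := by
    rw [contDiffOn_infty_iff_fderiv_of_isOpen (isOpen_extChartAt_target x)]
    refine ⟨fun y hy => (hasFDerivAt_comp_extChartAt_symm hy
      (hf _)).differentiableAt.differentiableWithinAt, ?_⟩
    refine (contDiffOn_oneFormMap (hσ x)).congr fun y hy => ?_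
    rw [(hasFDerivAt_comp_extChartAt_symm hy (hf _)).fderiv]
    ext v
    exact (h ((extChartAt 𝓘(ℝ, E) x).symm y) (fun _ => mfderiv 𝓘(ℝ, E) 𝓘(ℝ, E)
      (extChartAt 𝓘(ℝ, E) x).symm y (show TangentSpace 𝓘(ℝ, E) y from v))).symm
  have h2 := (h1.contDiffAt (extChartAt_target_mem_nhds x)).contMDiffAt.comp x
    (contMDiffAt_extChartAt (I := 𝓘(ℝ, E)) (n := ∞) (x := x))
  refine h2.congr_of_eventuallyEq ?_
  filter_upwards [extChartAt_source_mem_nhds (I := 𝓘(ℝ, E)) x] with y hy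
  simp only [Function.comp_apply]
  rw [(extChartAt 𝓘(ℝ, E) x).left_inv hy]

theorem extDeriv_inChart [FiniteDimensional ℝ E] {σ : FormField E N 1} (hσ : σ.Smooth) (hd : σ.d = 0) (x : N) {y : E}
    (hy : y ∈ (extChartAt 𝓘(ℝ, E) x).target) : extDeriv (σ.inChart x) y = 0 := by
  have h1 := σ.extDeriv_pull (Ψ := (extChartAt 𝓘(ℝ, E) x).symm) (y := y)
    ((contMDiffOn_extChartAt_symm (n := ∞) x).contMDiffAt ((isOpen_extChartAt_target x).mem_nhds hy))
    (hσ.differentiableAt _)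
  rw [hd] at h1
  exact h1

/-- The Poincaré lemma on a ball in a chart: closedness is symmetry of the derivative of the
coefficient map. -/
theorem exists_local_primitive [FiniteDimensional ℝ E] {σ : FormField E N 1} (hσ : σ.Smooth)
    (hd : σ.d = 0) (x : N) : ∃ (U : Set N) (f : N → ℝ), IsOpen U ∧ x ∈ U ∧ ∀ y ∈ U,
      HasMFDerivAt 𝓘(ℝ, E) 𝓘(ℝ, ℝ) f y (σ.lin y) := by
  have : IsManifold 𝓘(ℝ, E) 1 N := IsManifold.of_le (n := ∞) (by simp)
  set φ := extChartAt 𝓘(ℝ, E) x with hφ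
  obtain ⟨r, hr, hB⟩ := Metric.mem_nhds_iff.1 (extChartAt_target_mem_nhds (I := 𝓘(ℝ, E)) x)
  obtain ⟨f, hf⟩ := (convex_ball (φ x) r).exists_forall_hasFDerivAt_of_fderiv_symmetric
    Metric.isOpen_ball
    (((contDiffOn_oneFormMap (hσ x)).mono hB).differentiableOn (by simp))
    (fun a ha u v => fderiv_oneFormMap_symmetric (isOpen_extChartAt_target x) (hσ x) (hB ha)
      (extDeriv_inChart hσ hd x (hB ha)) u v)
  refine ⟨φ.source ∩ φ ⁻¹' Metric.ball (φ x) r, f ∘ φ,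
    isOpen_extChartAt_preimage' x Metric.isOpen_ball,
    ⟨mem_extChartAt_source x, Metric.mem_ball_self hr⟩, fun y hy => ?_⟩
  have h1 := (hf _ hy.2).hasMFDerivAt.comp y
    (mdifferentiableAt_extChartAt (by simpa [hφ] using hy.1)).hasMFDerivAt
  refine h1.congr_mfderiv ?_
  ext v
  exact inChart_extChartAt σ hy.1 v

/-- Local primitives differ by locally constant functions, and `exists_glue` makes them agree. -/
theorem closedOneForms_le_exactOneForms [FiniteDimensional ℝ E] [SimplyConnectedSpace N] :
    closedOneForms E N ≤ exactOneForms E N := by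
  rintro σ ⟨hσ, hd⟩
  have : LocallyPathConnectedSpace N := ChartedSpace.locallyPathConnectedSpace E N
  choose U f hU hxU hf using exists_local_primitive hσ hd
  obtain ⟨F, hF⟩ := exists_glue U hU hxU f (by
    rintro i j x ⟨hi, hj⟩
    refine eventually_eq_of_mfderiv_eq_zero (E := E) (h := fun y => f i y - f j y) ?_
    filter_upwards [(hU i).mem_nhds hi, (hU j).mem_nhds hj] with y hyi hyj
    have := (hf i y hyi).sub (hf j y hyj)
    refine ⟨this.mdifferentiableAt, this.mfderiv.trans (sub_self _)⟩)
  have hFd : ∀ x, HasMFDerivAt 𝓘(ℝ, E) 𝓘(ℝ, ℝ) F x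
      (σ.lin x) := by
    intro x
    have h1 := (hf x x (hxU x)).add (hasMFDerivAt_const (F x - f x x) x)
    have h2 : F =ᶠ[𝓝 x] (f x + fun _ => F x - f x x) := by
      filter_upwards [hF x] with y hy
      simp only [Pi.add_apply]; linarith
    have h3 := h1.congr_of_eventuallyEq h2
    exact h3.congr_mfderiv (add_zero _)
  have h2 : ∀ x v, σ x v = mfderiv 𝓘(ℝ, E) 𝓘(ℝ, ℝ) F x (v 0) := by
    intro x v
    rw [(hFd x).mfderiv]
    exact σ.lin_apply x v
  exact ⟨F, hσ.contMDiff_of_mfderiv (fun x => (hFd x).mdifferentiableAt) h2, h2⟩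

end Primitive

/-! ### Pullback of closed 1-forms -/

section Pullback

variable {E : Type*} [NormedAddCommGroup E] [NormedSpace ℝ E] [FiniteDimensional ℝ E]
  {N : Type*} [TopologicalSpace N] [ChartedSpace E N] [IsManifold 𝓘(ℝ, E) ∞ N]
  {M : Type*} [TopologicalSpace M] [ChartedSpace E M] [IsManifold 𝓘(ℝ, E) ∞ M]

/-- The pullback of a form on `M` by a map `N → M`. -/
def FormField.pullback {k : ℕ} (π : N → M) (σ : FormField E M k) : FormField E N k := fun a =>
  (σ (π a)).compContinuousLinearMap (mfderiv 𝓘(ℝ, E) 𝓘(ℝ, E) π a)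

theorem pullback_inChart {k : ℕ} {π : N → M} (hπ : ContMDiff 𝓘(ℝ, E) 𝓘(ℝ, E) ∞ π)
    (σ : FormField E M k) {a : N} {y : E} (hy : y ∈ (extChartAt 𝓘(ℝ, E) a).target) :
    (σ.pullback π).inChart a y = σ.pull (π ∘ (extChartAt 𝓘(ℝ, E) a).symm) y := by
  have h1 := mfderiv_comp y ((hπ _).mdifferentiableAt (by simp))
    (eventually_mdifferentiableAt_extChartAt_symm hy).self_of_nhds
  unfold FormField.pull
  rw [h1]
  rfl

theorem pullback_mem_closedOneForms {π : N → M} (hπ : ContMDiff 𝓘(ℝ, E) 𝓘(ℝ, E) ∞ π)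
    {σ : FormField E M 1} (hσ : σ ∈ closedOneForms E M) : σ.pullback π ∈ closedOneForms E N := by
  have hc : ∀ (a : N) (y : E), y ∈ (extChartAt 𝓘(ℝ, E) a).target →
      ContMDiffAt 𝓘(ℝ, E) 𝓘(ℝ, E) ∞ (π ∘ (extChartAt 𝓘(ℝ, E) a).symm) y := fun a y hy =>
    (hπ _).comp y ((contMDiffOn_extChartAt_symm (n := ∞) a).contMDiffAt
      ((isOpen_extChartAt_target a).mem_nhds hy))
  refine ⟨fun a => ?_, funext fun a => ?_⟩
  · refine ContDiffOn.congr (fun y hy => ContDiffAt.contDiffWithinAt ?_)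
      fun y hy => pullback_inChart hπ σ hy
    set Ψ := π ∘ (extChartAt 𝓘(ℝ, E) a).symm with hΨ
    set ψ := extChartAt 𝓘(ℝ, E) (Ψ y)
    have hf : ContDiffAt ℝ ∞ (ψ ∘ Ψ) y :=
      (ContMDiffAt.comp y (contMDiffAt_extChartAt (n := ∞)) (hc a y hy)).contDiffAt
    refine σ.contDiffAt_pull_of_comp (Ψ := ψ.symm) (f := ψ ∘ Ψ) ?_
      (eventually_mdifferentiableAt_extChartAt_symm (mem_extChartAt_target (Ψ y))) hf
      ((hσ.1 (Ψ y)).contDiffAt (extChartAt_target_mem_nhds (Ψ y)))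
    filter_upwards [(hc a y hy).continuousAt.eventually
      (extChartAt_source_mem_nhds (I := 𝓘(ℝ, E)) (Ψ y))] with z hz
    exact (ψ.left_inv hz).symm
  · have h1 : (σ.pullback π).inChart a =ᶠ[𝓝 (extChartAt 𝓘(ℝ, E) a a)]
        σ.pull (π ∘ (extChartAt 𝓘(ℝ, E) a).symm) := by
      filter_upwards [extChartAt_target_mem_nhds (I := 𝓘(ℝ, E)) a] with y hy
      exact pullback_inChart hπ σ hy
    have h2 : extDeriv ((σ.pullback π).inChart a) (extChartAt 𝓘(ℝ, E) a a) = 0 := by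
      rw [h1.extDeriv_eq, σ.extDeriv_pull (hc a _ (mem_extChartAt_target a))
        (hσ.1.differentiableAt _), hσ.2]
      rfl
    unfold FormField.d
    rw [h2]
    rfl

end Pullback

/-! ### Derivatives along the left-invariant frame and primitives on the group -/

section FrameDeriv

variable {E : Type*} [NormedAddCommGroup E] [NormedSpace ℝ E]
  {G : Type*} [TopologicalSpace G] [ChartedSpace E G] [Group G] [LieGroup 𝓘(ℝ, E) ∞ G]
  {F F' : Type*} [NormedAddCommGroup F] [NormedSpace ℝ F] [NormedAddCommGroup F'] [NormedSpace ℝ F']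

/-- The derivatives of a function on a Lie group along the left-invariant vector fields. -/
def frameDeriv (f : G → F) (a : G) : E →L[ℝ] F :=
  (show E →L[ℝ] F from mfderiv 𝓘(ℝ, E) 𝓘(ℝ, F) f a).comp (frameMap a)

theorem frameDeriv_clm_comp {f : G → F} {a : G} (hf : MDifferentiableAt 𝓘(ℝ, E) 𝓘(ℝ, F) f a)
    (A : F →L[ℝ] F') : frameDeriv (E := E) (fun b => A (f b)) a = A.comp (frameDeriv f a) := by
  have h := (A.hasMFDerivAt (x := f a)).comp a hf.hasMFDerivAt
  have h' := h.mfderiv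
  unfold frameDeriv
  change (show E →L[ℝ] F' from mfderiv 𝓘(ℝ, E) 𝓘(ℝ, F') (A ∘ f) a).comp _ = _
  rw [h']
  rfl

theorem frameDeriv_add {f g : G → F} {a : G} (hf : MDifferentiableAt 𝓘(ℝ, E) 𝓘(ℝ, F) f a)
    (hg : MDifferentiableAt 𝓘(ℝ, E) 𝓘(ℝ, F) g a) :
    frameDeriv (E := E) (fun b => f b + g b) a = frameDeriv f a + frameDeriv g a := by
  have h := (hf.hasMFDerivAt.add hg.hasMFDerivAt).mfderiv
  unfold frameDeriv
  change (show E →L[ℝ] F from mfderiv 𝓘(ℝ, E) 𝓘(ℝ, F) (f + g) a).comp _ = _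
  rw [h]
  rfl

theorem frameDeriv_sub {f g : G → F} {a : G} (hf : MDifferentiableAt 𝓘(ℝ, E) 𝓘(ℝ, F) f a)
    (hg : MDifferentiableAt 𝓘(ℝ, E) 𝓘(ℝ, F) g a) :
    frameDeriv (E := E) (fun b => f b - g b) a = frameDeriv f a - frameDeriv g a := by
  have h := (hf.hasMFDerivAt.sub hg.hasMFDerivAt).mfderiv
  unfold frameDeriv
  change (show E →L[ℝ] F from mfderiv 𝓘(ℝ, E) 𝓘(ℝ, F) (f - g) a).comp _ = _
  rw [h]
  rfl

theorem frameDeriv_mul_left {f : G → F} (hf : ∀ a, MDifferentiableAt 𝓘(ℝ, E) 𝓘(ℝ, F) f a)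
    (c a : G) : frameDeriv (E := E) (fun b => f (c * b)) a = frameDeriv f (c * a) := by
  have hd : MDifferentiableAt 𝓘(ℝ, E) 𝓘(ℝ, E) (c * ·) a :=
    (contMDiff_mul_left (n := ∞)).contMDiffAt.mdifferentiableAt (by simp)
  have h := mfderiv_comp a (hf (c * a)) hd
  unfold frameDeriv
  change (show E →L[ℝ] F from mfderiv 𝓘(ℝ, E) 𝓘(ℝ, F) (f ∘ (c * ·)) a).comp _ = _
  rw [h, frameMap_mul]
  rfl

theorem eq_of_frameDeriv_eq_zero [PreconnectedSpace G] {f : G → F}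
    (hf : ∀ a, MDifferentiableAt 𝓘(ℝ, E) 𝓘(ℝ, F) f a) (h : ∀ a, frameDeriv (E := E) f a = 0)
    (a b : G) : f a = f b := by
  refine eq_of_mfderiv_eq_zero (E := E) hf (fun a => ?_) a b
  ext w
  obtain ⟨v, rfl⟩ := (frameMap_isInvertible (E := E) a).bijective.2 w
  exact congrArg (fun A => A v) (h a)

variable [FiniteDimensional ℝ E] [CompleteSpace E]

/-- The form on `G` with given values on the left-invariant frame. -/
def frameForm (τ : G → E →L[ℝ] ℝ) : FormField E G 1 := fun a =>
  ContinuousAlternatingMap.ofSubsingleton ℝ E ℝ (0 : Fin 1) ((τ a).comp (frameMap a).inverse)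

theorem frameForm_lin (τ : G → E →L[ℝ] ℝ) (a : G) (v : E) :
    (frameForm τ).lin a (frameMap a v) = τ a v :=
  congrArg (τ a) ((frameMap_isInvertible a).inverse_apply_self v)

theorem pushInvariant_id (a : G) (v : E) : pushInvariant (id : G → G) v a = frameMap a v := by
  unfold pushInvariant
  rw [mfderiv_id]
  rfl

/-- The hypothesis `hd` is dτ = 0 written by Cartan's formula on left-invariant fields. -/
theorem frameForm_mem_closedOneForms {τ : G → E →L[ℝ] ℝ}
    (hτ : ContMDiff 𝓘(ℝ, E) 𝓘(ℝ, E →L[ℝ] ℝ) ∞ τ)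
    (hd : ∀ a u v, frameDeriv (E := E) (fun b => τ b v) a u - frameDeriv (E := E) (fun b => τ b u) a v
      - τ a (groupBr E G u v) = 0) : frameForm τ ∈ closedOneForms E G := by
  have hid : IsLocalDiffeomorph 𝓘(ℝ, E) 𝓘(ℝ, E) ∞ (id : G → G) :=
    (Diffeomorph.refl 𝓘(ℝ, E) G ∞).isLocalDiffeomorph
  obtain ⟨T, hT⟩ : ∃ T : G → E → E [⋀^Fin 1]→L[ℝ] ℝ, T = fun a y =>
    ContinuousAlternatingMap.ofSubsingleton ℝ E ℝ (0 : Fin 1) (τ ((extChartAt 𝓘(ℝ, E) a).symm y)) :=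
    ⟨_, rfl⟩
  have hτc : ∀ (a : G) (y : E), y ∈ (extChartAt 𝓘(ℝ, E) a).target →
      ContDiffAt ℝ ∞ (τ ∘ (extChartAt 𝓘(ℝ, E) a).symm) y := fun a y hy =>
    ((hτ _).comp y ((contMDiffOn_extChartAt_symm (n := ∞) a).contMDiffAt
      ((isOpen_extChartAt_target a).mem_nhds hy))).contDiffAt
  have hTs : ∀ a, ∀ y ∈ (groupChart hid a).U, ContDiffAt ℝ ∞ (T a) y := by
    intro a y hy
    refine contDiffAt_alternating fun v => ?_
    rw [hT]
    exact (hτc a y hy).clm_apply contDiffAt_const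
  have hσ : ∀ a, ∀ y ∈ (groupChart hid a).U, ∀ v : Fin 1 → E,
      frameForm τ ((groupChart hid a).Ψ y) (fun i => (groupChart hid a).fr y (v i)) = T a y v := by
    intro a y hy v
    rw [FormField.lin_apply, groupChart_fr hid hy, pushInvariant_id, hT]
    exact frameForm_lin τ _ _
  refine ⟨fun x y hy => ContDiffAt.contDiffWithinAt ?_, funext fun a => ?_⟩
  · refine FrameChart.contDiffAt_inChart (F := groupChart hid x) (hTs x) (hσ x) (y := y) hy hy rfl
  · ext w
    have hy := mem_groupChart_U hid a
    obtain ⟨v, hv⟩ : ∃ v : Fin 2 → E, ∀ i, frameMap a (v i) = w i := by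
      choose v hv using fun i => (frameMap_isInvertible (E := E) a).bijective.2 (w i)
      exact ⟨v, hv⟩
    have h1 := FrameChart.d_apply (hTs a) (hσ a) hy v
    have h2 : ∀ (b : G) (_ : b = a), (show E [⋀^Fin 2]→L[ℝ] ℝ from (frameForm τ).d b)
        (fun i => frameMap b (v i)) =
        (show E [⋀^Fin 2]→L[ℝ] ℝ from (frameForm τ).d a) (fun i => frameMap a (v i)) := by
      rintro b rfl; rfl
    simp only [groupChart_fr hid hy, pushInvariant_id] at h1
    have h3 := (h2 _ (extChartAt_to_inv (I := 𝓘(ℝ, E)) a)).symm.trans h1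
    simp only [hv] at h3
    refine h3.trans ?_
    have h4 : ∀ u v : E, fderiv ℝ (fun z => τ ((extChartAt 𝓘(ℝ, E) a).symm z) v)
        (extChartAt 𝓘(ℝ, E) a a) ((groupChart hid a).Θ (extChartAt 𝓘(ℝ, E) a a) u) =
        frameDeriv (fun b => τ b v) a u := by
      intro u v
      have hm : ∀ b, MDifferentiableAt 𝓘(ℝ, E) 𝓘(ℝ, ℝ) (fun b => τ b v) b := fun b =>
        (((ContinuousLinearMap.apply ℝ ℝ v).contMDiff.comp hτ) b).mdifferentiableAt
          (n := ∞) (by simp)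
      have h5 := hasFDerivAt_comp_extChartAt_symm (E := E) (x := a) (mem_extChartAt_target a) (hm _)
      have h6 := h5.fderiv
      have h7 : fderiv ℝ (fun z => τ ((extChartAt 𝓘(ℝ, E) a).symm z) v)
        (extChartAt 𝓘(ℝ, E) a a) = _ := h6
      rw [h7]
      have h8 : mfderiv 𝓘(ℝ, E) 𝓘(ℝ, E) (extChartAt 𝓘(ℝ, E) a).symm (extChartAt 𝓘(ℝ, E) a a)
        ((groupChart hid a).Θ (extChartAt 𝓘(ℝ, E) a a) u) =
        frameMap ((extChartAt 𝓘(ℝ, E) a).symm (extChartAt 𝓘(ℝ, E) a a)) u :=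
        (groupChart_fr hid hy u).trans (pushInvariant_id _ u)
      have h9 : ∀ (b : G) (_ : b = a), frameDeriv (fun b => τ b v) b u =
        frameDeriv (E := E) (fun b => τ b v) a u := by rintro b rfl; rfl
      refine Eq.trans ?_ (h9 _ (extChartAt_to_inv (I := 𝓘(ℝ, E)) a))
      exact congrArg _ h8
    have e0 : (0 : Fin 2).removeNth v = fun _ => v 1 := by ext i; fin_cases i; rfl
    have e1 : (1 : Fin 2).removeNth v = fun _ => v 0 := by ext i; fin_cases i; rfl
    have e2 : Finset.Ici (0 : Fin 1) = {0} := by decide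
    rw [Fin.sum_univ_two, Fin.sum_univ_one, e2, Finset.sum_singleton, e0, e1, hT]
    have h10 := hd a (v 0) (v 1)
    rw [← h4, ← h4] at h10
    have h11 : τ ((extChartAt 𝓘(ℝ, E) a).symm (extChartAt 𝓘(ℝ, E) a a)) (groupBr E G (v 0) (v 1)) =
      τ a (groupBr E G (v 0) (v 1)) := by rw [extChartAt_to_inv]
    rw [← h11] at h10
    refine Eq.trans ?_ h10
    simp only [Fin.val_zero, pow_zero, one_smul, Fin.val_one, pow_one, neg_smul, add_zero]
    rw [← sub_eq_add_neg]
    rfl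

theorem exists_frame_primitive [SimplyConnectedSpace G] {τ : G → E →L[ℝ] ℝ}
    (hτ : ContMDiff 𝓘(ℝ, E) 𝓘(ℝ, E →L[ℝ] ℝ) ∞ τ)
    (hd : ∀ a u v, frameDeriv (E := E) (fun b => τ b v) a u - frameDeriv (E := E) (fun b => τ b u) a v
      - τ a (groupBr E G u v) = 0) :
    ∃ f : G → ℝ, ContMDiff 𝓘(ℝ, E) 𝓘(ℝ, ℝ) ∞ f ∧ ∀ a, frameDeriv f a = τ a := by
  obtain ⟨f, hf, h⟩ := closedOneForms_le_exactOneForms (frameForm_mem_closedOneForms hτ hd)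
  refine ⟨f, hf, fun a => ?_⟩
  ext v
  refine Eq.trans ?_ (frameForm_lin τ a v)
  exact (h a (fun _ => (show TangentSpace 𝓘(ℝ, E) a from frameMap (E := E) a v))).symm

/-- The scalar case is applied in coordinates of F; subtracting the value at 1 normalizes the
constant. -/
theorem exists_frame_primitive_vector [SimplyConnectedSpace G] [FiniteDimensional ℝ F]
    {τ : G → E →L[ℝ] F}
    (hτ : ContMDiff 𝓘(ℝ, E) 𝓘(ℝ, E →L[ℝ] F) ∞ τ)
    (hd : ∀ a u v, frameDeriv (E := E) (fun b => τ b v) a u - frameDeriv (E := E) (fun b => τ b u) a v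
      - τ a (groupBr E G u v) = 0) :
    ∃ f : G → F, ContMDiff 𝓘(ℝ, E) 𝓘(ℝ, F) ∞ f ∧ f 1 = 0 ∧ ∀ a, frameDeriv f a = τ a := by
  let b := Module.finBasis ℝ F
  let c : Fin (Module.finrank ℝ F) → F →L[ℝ] ℝ := fun i => LinearMap.toContinuousLinearMap (b.coord i)
  have hm : ∀ (v : E) a, MDifferentiableAt 𝓘(ℝ, E) 𝓘(ℝ, F) (fun b => τ b v) a := fun v a =>
    (((ContinuousLinearMap.apply ℝ F v).contMDiff.comp hτ) a).mdifferentiableAt (n := ∞) (by simp)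
  have h1 : ∀ i, ∃ f : G → ℝ, ContMDiff 𝓘(ℝ, E) 𝓘(ℝ, ℝ) ∞ f ∧
      ∀ a, frameDeriv f a = (c i).comp (τ a) := by
    intro i
    refine exists_frame_primitive
      ((ContinuousLinearMap.compL ℝ E F ℝ (c i)).contMDiff.comp hτ) fun a u v => ?_
    have h2 := congrArg (c i) (hd a u v)
    have h3 : ∀ u v : E, frameDeriv (E := E) (fun b => (c i).comp (τ b) v) a u =
        c i (frameDeriv (E := E) (fun b => τ b v) a u) := fun u v =>
      congrArg (fun A => A u) (frameDeriv_clm_comp (hm v a) (c i))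
    rw [h3, h3, ← map_sub]
    simpa using h2
  choose f hf hfd using h1
  have hf' : ContMDiff 𝓘(ℝ, E) 𝓘(ℝ, F) ∞ (fun a => b.equivFunL.symm fun i => f i a) :=
    b.equivFunL.symm.contDiff.contMDiff.comp (contMDiff_pi_space.2 hf)
  refine ⟨fun a => b.equivFunL.symm (fun i => f i a) - b.equivFunL.symm (fun i => f i 1),
    hf'.sub contMDiff_const, sub_self _, fun a => ?_⟩
  have hsub := frameDeriv_sub ((hf' a).mdifferentiableAt (by simp))
    (mdifferentiableAt_const (c := b.equivFunL.symm fun i => f i 1) (I := 𝓘(ℝ, E)) (x := a))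
  have hz : frameDeriv (E := E) (fun _ : G => b.equivFunL.symm fun i => f i 1) a = 0 := by
    unfold frameDeriv
    rw [mfderiv_const]
    rfl
  rw [hsub, hz, sub_zero]
  ext v
  refine b.ext_elem fun i => ?_
  have h4 := congrArg (fun A => A v) (frameDeriv_clm_comp ((hf' a).mdifferentiableAt (by simp)) (c i))
  have h5 : (fun b' => c i ((fun a => b.equivFunL.symm fun i => f i a) b')) = f i := by
    funext x
    exact congrFun (b.equivFunL.apply_symm_apply fun i => f i x) i
  rw [h5, hfd] at h4
  exact h4.symm

end FrameDeriv

/-! ### The logarithm of a simply connected 2-step nilpotent group -/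

section Logarithm

variable {E : Type*} [NormedAddCommGroup E] [NormedSpace ℝ E] [FiniteDimensional ℝ E]
  [CompleteSpace E]
  {G : Type*} [TopologicalSpace G] [ChartedSpace E G] [Group G] [LieGroup 𝓘(ℝ, E) ∞ G]
  {F : Type*} [NormedAddCommGroup F] [NormedSpace ℝ F]

variable (E G) in
/-- The bracket of the Lie algebra of `G`, as a continuous bilinear map on the model space. -/
def groupBrL : E →L[ℝ] E →L[ℝ] E :=
  LinearMap.toContinuousLinearMap ((LinearMap.toContinuousLinearMap (𝕜 := ℝ) (E := E)
    (F' := E)).toLinearMap ∘ₗ LinearMap.mk₂ ℝ (groupBr E G)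
      (fun u v w => add_lie (L := GroupLieAlgebra 𝓘(ℝ, E) G) (M := GroupLieAlgebra 𝓘(ℝ, E) G) u v w)
      (fun c u v => smul_lie (L := GroupLieAlgebra 𝓘(ℝ, E) G) (M := GroupLieAlgebra 𝓘(ℝ, E) G) c u v)
      (fun u v w => lie_add (L := GroupLieAlgebra 𝓘(ℝ, E) G) (M := GroupLieAlgebra 𝓘(ℝ, E) G) u v w)
      (fun c u v => lie_smul (L := GroupLieAlgebra 𝓘(ℝ, E) G) (M := GroupLieAlgebra 𝓘(ℝ, E) G) c u v))

theorem groupBrL_apply (u v : E) : groupBrL E G u v = groupBr E G u v := rfl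

theorem groupBrL_swap (u v : E) : groupBrL E G u v = -groupBrL E G v u :=
  (lie_skew (L := GroupLieAlgebra 𝓘(ℝ, E) G) u v).symm

theorem groupBrL_self (v : E) : groupBrL E G v v = 0 :=
  lie_self (L := GroupLieAlgebra 𝓘(ℝ, E) G) v

theorem frameDeriv_const (c : F) (a : G) : frameDeriv (E := E) (fun _ : G => c) a = 0 := by
  unfold frameDeriv
  rw [mfderiv_const]
  rfl

theorem frameDeriv_const_add {f : G → F} {a : G} (hf : MDifferentiableAt 𝓘(ℝ, E) 𝓘(ℝ, F) f a)
    (c : F) : frameDeriv (E := E) (fun b => c + f b) a = frameDeriv f a := by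
  rw [frameDeriv_add mdifferentiableAt_const hf, frameDeriv_const, zero_add]

variable (hz : ∀ u v w : E, groupBrL E G (groupBrL E G u v) w = 0)
include hz

/-- P projects along the span of the brackets onto a complement; as brackets are central, applying P
does not change brackets. -/
theorem exists_projection_killing_brackets : ∃ P : E →L[ℝ] E, (∀ u v, P (groupBrL E G u v) = 0) ∧
    ∀ u v, groupBrL E G (P u) v = groupBrL E G u v := by
  obtain ⟨D, hD⟩ : ∃ D, D = Submodule.span ℝ {x | ∃ u v, groupBrL E G u v = x} := ⟨_, rfl⟩
  have hDz : ∀ x ∈ D, ∀ w, groupBrL E G x w = 0 := by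
    intro x hx w
    rw [hD] at hx
    induction hx using Submodule.span_induction with
    | mem x h => obtain ⟨u, v, rfl⟩ := h; exact hz u v w
    | zero => simp
    | add x y _ _ h1 h2 => simp [h1, h2]
    | smul c x _ h => simp [h]
  obtain ⟨Q, hQ⟩ := D.exists_isCompl
  refine ⟨LinearMap.toContinuousLinearMap (Submodule.projection Q D hQ.symm), fun u v => ?_,
    fun u v => ?_⟩
  · exact (Submodule.projection_apply_eq_zero_iff hQ.symm).2 (hD ▸ Submodule.subset_span ⟨u, v, rfl⟩)
  · have h1 : u - Submodule.projection Q D hQ.symm u ∈ D := by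
      rw [← Submodule.projection_apply_eq_zero_iff hQ.symm, map_sub, sub_eq_zero]
      exact (Submodule.projectionOnto_apply_left hQ.symm (Submodule.projectionOnto Q D hQ.symm u)
        |> congrArg Subtype.val).symm
    have h2 := hDz _ h1 v
    rw [map_sub, sub_apply, sub_eq_zero] at h2
    exact h2.symm

/-- Uniqueness without a theorem on differential equations: P ∘ f has zero derivative, so it
vanishes, and then so does the bracket [f, v] = [P f, v] that drives f. -/
theorem eq_zero_of_frameDeriv_eq_bracket [PreconnectedSpace G] {f : G → E} (hf : ∀ a, MDifferentiableAt 𝓘(ℝ, E) 𝓘(ℝ, E) f a)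
    (hfd : ∀ a v, frameDeriv (E := E) f a v = (1 / 2 : ℝ) • groupBrL E G (f a) v) (h1 : f 1 = 0)
    (a : G) : f a = 0 := by
  obtain ⟨P, hP, hP'⟩ := exists_projection_killing_brackets hz
  have h2 : ∀ a, P (f a) = 0 := by
    intro a
    have h3 : ∀ a, frameDeriv (E := E) (fun b => P (f b)) a = 0 := by
      intro a
      rw [frameDeriv_clm_comp (hf a)]
      ext v
      simp [hfd, hP]
    have h4 := eq_of_frameDeriv_eq_zero (fun b => P.contMDiff.mdifferentiableAt one_ne_zero |>.comp b (hf b)) h3 a 1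
    simpa [h1] using h4
  have h3 : ∀ a, frameDeriv (E := E) f a = 0 := by
    intro a
    ext v
    rw [hfd, ← hP', h2]
    simp
  rw [eq_of_frameDeriv_eq_zero hf h3 a 1, h1]

/-- The logarithm of a simply connected 2-step nilpotent Lie group. -/
theorem exists_log [SimplyConnectedSpace G] : ∃ Φ : G → E, ContMDiff 𝓘(ℝ, E) 𝓘(ℝ, E) ∞ Φ ∧ Φ 1 = 0 ∧
    ∀ a v, frameDeriv Φ a v = v + (1 / 2 : ℝ) • groupBrL E G (Φ a) v := by
  obtain ⟨P, hP, hP'⟩ := exists_projection_killing_brackets hz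
  -- The equation is integrated in two stages. P kills brackets, so it is closed as an invariant
  -- form and has a primitive p, which will be P ∘ Φ. The form v + ½[p, v] is then closed: the
  -- derivative terms give ½[u, v] − ½[v, u], which cancels [u, v].
  obtain ⟨p, hp, hp1, hpd⟩ := exists_frame_primitive_vector (G := G) (τ := fun _ => P) contMDiff_const
    (fun a u v => by
      rw [frameDeriv_const, frameDeriv_const, ← groupBrL_apply, hP]; simp)
  have hpm : ∀ a, MDifferentiableAt 𝓘(ℝ, E) 𝓘(ℝ, E) p a := fun a =>
    (hp a).mdifferentiableAt (by simp)
  have hPr : ∀ u v, groupBrL E G u (P v) = groupBrL E G u v := fun u v => by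
    rw [groupBrL_swap, hP', groupBrL_swap, neg_neg]
  obtain ⟨Φ, hΦ, hΦ1, hΦd⟩ := exists_frame_primitive_vector (G := G)
    (τ := fun a => ContinuousLinearMap.id ℝ E + (1 / 2 : ℝ) • groupBrL E G (p a))
    (contMDiff_const.add (((1 / 2 : ℝ) • groupBrL E G).contMDiff.comp hp))
    (fun a u v => by
      have h1 : ∀ u v : E, frameDeriv (E := E) (fun b => (ContinuousLinearMap.id ℝ E +
          (1 / 2 : ℝ) • groupBrL E G (p b)) v) a u = (1 / 2 : ℝ) • groupBrL E G u v := by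
        intro u v
        have h2 := frameDeriv_const_add (E := E) (f := fun b => ((1 / 2 : ℝ) • (groupBrL E G).flip v) (p b))
          (a := a) (((((1 / 2 : ℝ) • (groupBrL E G).flip v).contMDiff.comp hp) a).mdifferentiableAt
            (n := ∞) (by simp)) v
        have h3 := congrArg (fun A => A u) h2
        rw [frameDeriv_clm_comp (hpm a), hpd] at h3
        refine h3.trans ?_
        simp [hP']
      rw [h1, h1, groupBrL_swap v u, ← groupBrL_apply]
      have h4 : groupBrL E G (p a) (groupBrL E G u v) = 0 := by
        rw [groupBrL_swap, hz, neg_zero]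
      simp only [add_apply, ContinuousLinearMap.id_apply,
        smul_apply, h4]
      module)
  have hΦm : ∀ a, MDifferentiableAt 𝓘(ℝ, E) 𝓘(ℝ, E) Φ a := fun a =>
    (hΦ a).mdifferentiableAt (by simp)
  refine ⟨Φ, hΦ, hΦ1, fun a v => ?_⟩
  -- This replaces p by Φ inside the bracket.
  have h5 : P (Φ a) = p a := by
    have hm : ∀ b, MDifferentiableAt 𝓘(ℝ, E) 𝓘(ℝ, E) (fun b => P (Φ b)) b := fun b =>
      ((P.contMDiff.comp hΦ) b).mdifferentiableAt (n := ∞) (by simp)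
    have h6 := eq_of_frameDeriv_eq_zero (E := E) (f := fun b => P (Φ b) - p b)
      (fun b => (hm b).sub (hpm b)) (fun b => by
        rw [frameDeriv_sub (hm b) (hpm b), frameDeriv_clm_comp (hΦm b), hΦd, hpd]
        ext v
        simp [hP]) a 1
    simpa [hΦ1, hp1, sub_eq_zero] using h6
  rw [hΦd, ← hP' (Φ a), h5]
  simp

/-- As functions of y both sides agree at 1, and their difference D satisfies dD(v) = ½[D, v]. -/
theorem log_mul [PreconnectedSpace G] {Φ : G → E} (hΦ : ContMDiff 𝓘(ℝ, E) 𝓘(ℝ, E) ∞ Φ)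
    (h1 : Φ 1 = 0) (hd : ∀ a v, frameDeriv Φ a v = v + (1 / 2 : ℝ) • groupBrL E G (Φ a) v)
    (x y : G) : Φ (x * y) = Φ x + Φ y + (1 / 2 : ℝ) • groupBrL E G (Φ x) (Φ y) := by
  have hm : ∀ a, MDifferentiableAt 𝓘(ℝ, E) 𝓘(ℝ, E) Φ a := fun a =>
    (hΦ a).mdifferentiableAt (by simp)
  have hm1 : ∀ a, MDifferentiableAt 𝓘(ℝ, E) 𝓘(ℝ, E) (fun y => Φ (x * y)) a := fun a =>
    ((hΦ.comp (contMDiff_mul_left (n := ∞) (a := x))) a).mdifferentiableAt (by simp)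
  obtain ⟨A, hA⟩ : ∃ A : E →L[ℝ] E, A = ContinuousLinearMap.id ℝ E +
    (1 / 2 : ℝ) • groupBrL E G (Φ x) := ⟨_, rfl⟩
  have hm2 : ∀ a, MDifferentiableAt 𝓘(ℝ, E) 𝓘(ℝ, E) (fun y => A (Φ y)) a := fun a =>
    ((A.contMDiff.comp hΦ) a).mdifferentiableAt (n := ∞) (by simp)
  have hm3 : ∀ a, MDifferentiableAt 𝓘(ℝ, E) 𝓘(ℝ, E) (fun y => Φ x + A (Φ y)) a := fun a =>
    mdifferentiableAt_const.add (hm2 a)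
  have hzr : ∀ u v w, groupBrL E G w (groupBrL E G u v) = 0 := fun u v w => by
    rw [groupBrL_swap, hz, neg_zero]
  have key := eq_zero_of_frameDeriv_eq_bracket hz (f := fun y => Φ (x * y) - (Φ x + A (Φ y)))
    (fun a => (hm1 a).sub (hm3 a)) (fun a v => by
      rw [frameDeriv_sub (hm1 a) (hm3 a), frameDeriv_const_add (hm2 a), frameDeriv_clm_comp (hm a),
        frameDeriv_mul_left hm, sub_apply, ContinuousLinearMap.comp_apply, hd, hd,
        hA]
      simp only [add_apply, ContinuousLinearMap.id_apply,
        smul_apply, map_add, map_sub, map_smul, hzr, hz,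
        sub_apply]
      module) (by simp [h1]) y
  rw [sub_eq_zero] at key
  rw [key, hA]
  simp [add_assoc]

-- The inverse function theorem at 1. Global bijectivity of Φ is never needed: connectedness of G
-- spreads local statements.
omit hz in
theorem log_localInverse {Φ : G → E} (hΦ : ContMDiff 𝓘(ℝ, E) 𝓘(ℝ, E) ∞ Φ) (h1 : Φ 1 = 0)
    (hd : frameDeriv Φ 1 = ContinuousLinearMap.id ℝ E) :
    ∃ s : E → G, ContinuousAt s 0 ∧ s 0 = 1 ∧ (∀ᶠ v in 𝓝 0, Φ (s v) = v) ∧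
      ∀ᶠ y in 𝓝 1, s (Φ y) = y := by
  set φ := extChartAt 𝓘(ℝ, E) (1 : G) with hφ
  have hg : ContDiffAt ℝ ∞ (Φ ∘ φ.symm) (φ 1) :=
    ((hΦ _).comp (φ 1) ((contMDiffOn_extChartAt_symm (n := ∞) (1 : G)).contMDiffAt
      (extChartAt_target_mem_nhds (1 : G)))).contDiffAt
  have hinv : ContinuousLinearMap.IsInvertible (show E →L[ℝ] E from
      mfderiv 𝓘(ℝ, E) 𝓘(ℝ, E) φ.symm (φ 1)) :=
    ⟨(isLocalDiffeomorphAt_extChartAt_symm (1 : G)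
      (mem_extChartAt_target 1)).mfderivToContinuousLinearEquiv (by simp), rfl⟩
  obtain ⟨e, he⟩ := hinv
  have hfd : fderiv ℝ (Φ ∘ φ.symm) (φ 1) = e := by
    rw [(hasFDerivAt_comp_extChartAt_symm (mem_extChartAt_target (1 : G))
      ((hΦ _).mdifferentiableAt (by simp))).fderiv]
    have h2 : ∀ b : G, b = 1 → (show E →L[ℝ] E from mfderiv 𝓘(ℝ, E) 𝓘(ℝ, E) Φ b) =
        ContinuousLinearMap.id ℝ E := by
      rintro _ rfl
      rw [← hd]
      unfold frameDeriv
      rw [frameMap_one]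
      rfl
    have h3 := h2 _ (extChartAt_to_inv (I := 𝓘(ℝ, E)) (1 : G))
    ext v
    have h4 := congrArg (fun A => A (e v)) h3
    have h5 := congrArg (fun A => A v) he
    exact (congrArg _ h5.symm).trans h4
  have hs : HasStrictFDerivAt (Φ ∘ φ.symm) (e : E →L[ℝ] E) (φ 1) :=
    hfd ▸ hg.hasStrictFDerivAt (by simp)
  have h0 : (Φ ∘ φ.symm) (φ 1) = 0 := by
    simp only [Function.comp_apply, hφ, extChartAt_to_inv, h1]
  have hli := hs.localInverse_apply_image
  have hr := hs.eventually_right_inverse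
  have hc := hs.localInverse_continuousAt
  rw [h0] at hli hr hc
  obtain ⟨ℓ, hℓ⟩ : ∃ ℓ : E → E, ℓ = hs.localInverse := ⟨_, rfl⟩
  have hl := hs.eventually_left_inverse
  rw [← hℓ] at hli hr hc hl
  refine ⟨φ.symm ∘ ℓ, ?_, ?_, hr, ?_⟩
  · refine ContinuousAt.comp ?_ hc
    rw [hli]
    exact continuousAt_extChartAt_symm 1
  · exact (congrArg φ.symm hli).trans (extChartAt_to_inv (1 : G))
  · have hl' := (continuousAt_extChartAt (I := 𝓘(ℝ, E)) (1 : G)).eventually hl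
    filter_upwards [hl', extChartAt_source_mem_nhds (I := 𝓘(ℝ, E)) (1 : G)] with y hy hys
    have hy' : ℓ (Φ (φ.symm (φ y))) = φ y := hy
    rw [φ.left_inv hys] at hy'
    exact (congrArg φ.symm hy').trans (φ.left_inv hys)

end Logarithm

/-! ### Homogenization of quasimorphisms on 2-step nilpotent groups -/

section Quasimorphism

open scoped commutatorElement

variable {G : Type*} [Group G]

/-- A quasimorphism which is nearly additive on powers is at bounded distance from a
homomorphism. -/
theorem exists_hom_of_quasimorphism {f : G → ℝ} {C C' : ℝ}
    (hf : ∀ x y, |f (x * y) - f x - f y| ≤ C)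
    (hpow : ∀ x y (n : ℕ), |f ((x * y) ^ n) - f (x ^ n * y ^ n)| ≤ C') :
    ∃ φ : G → ℝ, (∀ x y, φ (x * y) = φ x + φ y) ∧ (∀ x, |f x - φ x| ≤ C) ∧
      ∀ x, Tendsto (fun n : ℕ => f (x ^ 2 ^ n) / 2 ^ n) atTop (𝓝 (φ x)) := by
  -- Quasi-additivity on the square of x^(2ⁿ) makes the sequence Cauchy with geometric steps summing
  -- to C, which also gives |f − φ| ≤ C.
  have h1 : ∀ x, ∀ n : ℕ, dist (f (x ^ 2 ^ n) / 2 ^ n) (f (x ^ 2 ^ (n + 1)) / 2 ^ (n + 1)) ≤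
      C / 2 / 2 ^ n := by
    intro x n
    have h2 := hf (x ^ 2 ^ n) (x ^ 2 ^ n)
    rw [← pow_add, ← two_mul, ← pow_succ'] at h2
    have e : f (x ^ 2 ^ n) / 2 ^ n - f (x ^ 2 ^ (n + 1)) / 2 ^ (n + 1) =
      -(f (x ^ 2 ^ (n + 1)) - f (x ^ 2 ^ n) - f (x ^ 2 ^ n)) / 2 / 2 ^ n := by
      rw [pow_succ (2 : ℝ)]; field_simp; ring
    rw [Real.dist_eq, e, abs_div, abs_div, abs_neg, abs_of_pos (by positivity : (0 : ℝ) < 2 ^ n),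
      abs_of_pos (by norm_num : (0 : ℝ) < 2)]
    gcongr
  have h2 : ∀ x, ∃ l, Tendsto (fun n : ℕ => f (x ^ 2 ^ n) / 2 ^ n) atTop (𝓝 l) := fun x =>
    cauchySeq_tendsto_of_complete (cauchySeq_of_le_geometric_two (h1 x))
  choose φ hφ using h2
  refine ⟨φ, fun x y => ?_, fun x => ?_, hφ⟩
  · have h3 := ((hφ (x * y)).sub (hφ x)).sub (hφ y)
    have h4 : Tendsto (fun n : ℕ => (C + C') * (1 / 2 : ℝ) ^ n) atTop (𝓝 0) := by
      simpa using (tendsto_pow_atTop_nhds_zero_of_lt_one (by norm_num : (0 : ℝ) ≤ 1 / 2)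
        (by norm_num)).const_mul (C + C')
    have h5 := squeeze_zero_norm (a := fun n : ℕ => (C + C') * (1 / 2 : ℝ) ^ n)
      (f := fun n : ℕ => f ((x * y) ^ 2 ^ n) / 2 ^ n - f (x ^ 2 ^ n) / 2 ^ n
        - f (y ^ 2 ^ n) / 2 ^ n) (fun n => by
        have a1 := hf (x ^ 2 ^ n) (y ^ 2 ^ n)
        have a2 := hpow x y (2 ^ n)
        rw [Real.norm_eq_abs, ← sub_div, ← sub_div, abs_div,
          abs_of_pos (by positivity : (0 : ℝ) < 2 ^ n), div_le_iff₀ (by positivity), mul_assoc,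
          ← mul_pow]
        norm_num
        have a3 := abs_add_le (f (x ^ 2 ^ n * y ^ 2 ^ n) - f (x ^ 2 ^ n) - f (y ^ 2 ^ n))
          (f ((x * y) ^ 2 ^ n) - f (x ^ 2 ^ n * y ^ 2 ^ n))
        have e : f (x ^ 2 ^ n * y ^ 2 ^ n) - f (x ^ 2 ^ n) - f (y ^ 2 ^ n) +
          (f ((x * y) ^ 2 ^ n) - f (x ^ 2 ^ n * y ^ 2 ^ n)) =
          f ((x * y) ^ 2 ^ n) - f (x ^ 2 ^ n) - f (y ^ 2 ^ n) := by ring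
        rw [e] at a3
        linarith) h4
    have := tendsto_nhds_unique h3 h5
    linarith
  · have h3 := dist_le_of_le_geometric_two_of_tendsto₀ (h1 x) (hφ x)
    simpa [Real.dist_eq] using h3

variable {Γ : Subgroup G} {K : Set G} {F : G → ℝ} {C : ℝ}

/-- A function on a 2-step nilpotent group which is equivariant under a subgroup `Γ`, and changes
by a bounded amount under right translations, by elements of a set `K` with `Γ K = G`, is at bounded
distance from a homomorphism. -/
theorem exists_hom_of_equivariant (hcomm : ∀ a b x : G, ⁅a, b⁆ * x = x * ⁅a, b⁆)
    (hK : ∀ x, ∃ γ ∈ Γ, ∃ k ∈ K, x = γ * k) (h1 : F 1 = 0)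
    (hΓ : ∀ γ ∈ Γ, ∀ x, F (γ * x) = F γ + F x)
    (hFK : ∀ k ∈ K, ∀ x, |F (x * k) - F x| ≤ C)
    (hF : ∀ a, ∃ B, ∀ x, |F (x * a) - F x| ≤ B) :
    ∃ φ : G → ℝ, (∀ x y, φ (x * y) = φ x + φ y) ∧ (∃ B, ∀ x, |F x - φ x| ≤ B) ∧
      ∀ γ ∈ Γ, φ γ = F γ := by
  have hk : ∀ k ∈ K, |F k| ≤ C := fun k hk => by simpa [h1] using hFK k hk 1
  -- the defect is bounded when one of the arguments is central
  have hcen : ∀ x z, (∀ y, z * y = y * z) → |F (x * z) - F x - F z| ≤ 2 * C := by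
    intro x z hz
    obtain ⟨γ, hγ, k, hkK, rfl⟩ := hK x
    rw [mul_assoc, hΓ γ hγ, hΓ γ hγ, ← hz k]
    have a1 := abs_le.1 (hFK k hkK z)
    have a2 := abs_le.1 (hk k hkK)
    rw [abs_le]; constructor <;> linarith
  have hpow : ∀ a B, (∀ x, |F (x * a) - F x| ≤ B) → ∀ (n : ℕ) x, |F (x * a ^ n) - F x| ≤ n * B := by
    intro a B hB n
    induction n with
    | zero => simp
    | succ n ih =>
      intro x
      have a1 := ih x
      have a2 := hB (x * a ^ n)
      rw [mul_assoc, ← pow_succ] at a2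
      have a3 := abs_sub_le (F (x * a ^ (n + 1))) (F (x * a ^ n)) (F x)
      push_cast
      linarith
  have hinv : ∀ a B, (∀ x, |F (x * a) - F x| ≤ B) → ∀ x, |F (x * a⁻¹) - F x| ≤ B := by
    intro a B hB x
    have := hB (x * a⁻¹)
    rwa [inv_mul_cancel_right, abs_sub_comm] at this
  -- `F` on the centre
  obtain ⟨L, hL, hLF, hLt⟩ := exists_hom_of_quasimorphism (G := Subgroup.center G)
    (f := fun z => F z) (C := 2 * C) (C' := 0)
    (fun x y => hcen x y fun g => (Subgroup.mem_center_iff.1 y.2 g).symm)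
    (fun x y n => by
      have hxy : Commute x y := Subtype.ext (Subgroup.mem_center_iff.1 y.2 x)
      rw [hxy.mul_pow, sub_self, abs_zero])
  have hmem : ∀ a b : G, ⁅a, b⁆ ∈ Subgroup.center G := fun a b =>
    Subgroup.mem_center_iff.2 fun g => (hcomm a b g).symm
  have hcp : ∀ (a b : G) (m n : ℕ), ⁅a ^ m, b ^ n⁆ = ⁅a, b⁆ ^ (m * n) := by
    have e1 : ∀ (a b : G) (n : ℕ), ⁅a, b ^ n⁆ = ⁅a, b⁆ ^ n := by
      intro a b n
      induction n with
      | zero => simp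
      | succ n ih =>
        have : ⁅a, b ^ (n + 1)⁆ = ⁅a, b⁆ * (b * ⁅a, b ^ n⁆ * b⁻¹) := by
          rw [pow_succ']; simp only [commutatorElement_def]; group
        rw [this, ← hcomm a (b ^ n) b, mul_inv_cancel_right, ih, ← pow_succ']
    intro a b m n
    rw [e1]
    have e2 : ⁅a ^ m, b⁆ = ⁅a, b⁆ ^ m := by
      have h := e1 b a m
      rw [← commutatorElement_inv, h, ← inv_pow, commutatorElement_inv]
    rw [e2, ← pow_mul]
  -- ⁅a, b⁆ to the power n² is ⁅aⁿ, bⁿ⁆, a product of 4n factors a, b and inverses. So F grows at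
  -- most linearly in n there, while L is the limit of F divided by n² (with n a power of 2).
  have hL0 : ∀ a b : G, L ⟨⁅a, b⁆, hmem a b⟩ = 0 := by
    intro a b
    obtain ⟨A, hA⟩ := hF a
    obtain ⟨B, hB⟩ := hF b
    have h2 := (hLt ⟨⁅a, b⁆, hmem a b⟩).comp (tendsto_id.nsmul_atTop two_pos)
    have h4 : Tendsto (fun n : ℕ => (2 * (A + B)) * (1 / 2 : ℝ) ^ n) atTop (𝓝 0) := by
      simpa using (tendsto_pow_atTop_nhds_zero_of_lt_one (by norm_num : (0 : ℝ) ≤ 1 / 2)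
        (by norm_num)).const_mul (2 * (A + B))
    refine tendsto_nhds_unique h2 (squeeze_zero_norm (fun n => ?_) h4)
    simp only [Function.comp_apply, id_eq, smul_eq_mul, SubmonoidClass.mk_pow]
    have e : ⁅a, b⁆ ^ 2 ^ (2 * n) = a ^ 2 ^ n * b ^ 2 ^ n * a⁻¹ ^ 2 ^ n * b⁻¹ ^ 2 ^ n := by
      rw [two_mul, pow_add, ← hcp, commutatorElement_def, inv_pow, inv_pow]
    rw [e]
    have a1 := hpow a A hA (2 ^ n) 1
    have a2 := hpow b B hB (2 ^ n) (a ^ 2 ^ n)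
    have a3 := hpow a⁻¹ A (hinv a A hA) (2 ^ n) (a ^ 2 ^ n * b ^ 2 ^ n)
    have a4 := hpow b⁻¹ B (hinv b B hB) (2 ^ n) (a ^ 2 ^ n * b ^ 2 ^ n * a⁻¹ ^ 2 ^ n)
    rw [one_mul, h1] at a1
    push_cast at a1 a2 a3 a4
    rw [Real.norm_eq_abs, abs_div, abs_of_pos (by positivity : (0 : ℝ) < 2 ^ (2 * n)),
      div_le_iff₀ (by positivity)]
    have e2 : 2 * (A + B) * (1 / 2 : ℝ) ^ n * 2 ^ (2 * n) = 2 * (A + B) * 2 ^ n := by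
      rw [two_mul n, pow_add, mul_assoc, ← mul_assoc ((1 / 2 : ℝ) ^ n), ← mul_pow]
      norm_num
    rw [e2, abs_le]
    rw [abs_le] at a1 a2 a3 a4
    constructor <;> linarith
  have hcle : commutator G ≤ Subgroup.center G := by
    rw [commutator_def, Subgroup.commutator_le]
    exact fun a _ b _ => hmem a b
  have hLc : ∀ z (hz : z ∈ commutator G), L ⟨z, hcle hz⟩ = 0 := by
    have hL1 : L 1 = 0 := by have := hL 1 1; rw [mul_one] at this; linarith
    intro z hz
    have hz' := hz
    rw [commutator_eq_closure] at hz'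
    suffices ∃ h : z ∈ Subgroup.center G, L ⟨z, h⟩ = 0 from this.2
    clear hz
    induction hz' using Subgroup.closure_induction with
    | mem x h => obtain ⟨a, b, rfl⟩ := h; exact ⟨hmem a b, hL0 a b⟩
    | one => exact ⟨Subgroup.one_mem _, hL1⟩
    | mul x y _ _ hx hy =>
      obtain ⟨hx, hx0⟩ := hx
      obtain ⟨hy, hy0⟩ := hy
      refine ⟨Subgroup.mul_mem _ hx hy, ?_⟩
      have := hL ⟨x, hx⟩ ⟨y, hy⟩
      rwa [hx0, hy0, add_zero] at this
    | inv x _ hx =>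
      obtain ⟨hx, hx0⟩ := hx
      refine ⟨Subgroup.inv_mem _ hx, ?_⟩
      have := hL ⟨x, hx⟩ (⟨x, hx⟩⁻¹)
      rw [mul_inv_cancel, hL1, hx0, zero_add] at this
      exact this.symm
  have hb : ∀ z ∈ commutator G, |F z| ≤ 2 * C := fun z hz => by
    have := hLF ⟨z, hcle hz⟩
    rwa [hLc z hz, sub_zero] at this
  have hb2 : ∀ x, ∀ z ∈ commutator G, |F (x * z) - F x| ≤ 4 * C := by
    intro x z hz
    have a1 := abs_le.1 (hcen x z fun g => (Subgroup.mem_center_iff.1 (hcle hz) g).symm)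
    have a2 := abs_le.1 (hb z hz)
    rw [abs_le]; constructor <;> linarith
  -- For x = γk, equivariance removes γ. Then k is moved to the right of y at the price of a
  -- commutator, costing 4C, and C each pays for right translation by k and for F(k).
  have hquasi : ∀ x y, |F (x * y) - F x - F y| ≤ 6 * C := by
    intro x y
    obtain ⟨γ, hγ, k, hkK, rfl⟩ := hK x
    have e : k * y = y * k * ⁅k⁻¹, y⁻¹⁆ := by simp only [commutatorElement_def]; group
    rw [mul_assoc, hΓ γ hγ, hΓ γ hγ, e]
    have a1 := abs_le.1 (hFK k hkK y)
    have a2 := abs_le.1 (hk k hkK)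
    have a3 := abs_le.1 (hb2 (y * k) ⁅k⁻¹, y⁻¹⁆ (Subgroup.commutator_mem_commutator
      (Subgroup.mem_top _) (Subgroup.mem_top _)))
    rw [abs_le]; constructor <;> linarith
  obtain ⟨φ, hφ, hφF, hφt⟩ := exists_hom_of_quasimorphism hquasi (C' := 4 * C) (fun x y n => by
    have hc : (x ^ n * y ^ n)⁻¹ * (x * y) ^ n ∈ commutator G := by
      rw [← Abelianization.ker_of, MonoidHom.mem_ker]
      simp [mul_pow]
    have := hb2 (x ^ n * y ^ n) _ hc
    rwa [mul_inv_cancel_left] at this)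
  -- On Γ the function F is already additive, so homogenization does not change it.
  refine ⟨φ, hφ, ⟨_, hφF⟩, fun γ hγ => ?_⟩
  have hn : ∀ n : ℕ, F (γ ^ n) = n * F γ := by
    intro n
    induction n with
    | zero => simp [h1]
    | succ n ih => rw [pow_succ', hΓ γ hγ, ih]; push_cast; ring
  refine tendsto_nhds_unique (hφt γ) ?_
  simp only [hn]
  push_cast
  simp [mul_div_cancel_left₀]

end Quasimorphism

/-! ### Locally additive bounded functions -/

section LocallyAdditive

variable {E : Type*} [NormedAddCommGroup E] [NormedSpace ℝ E]

/-- No continuity is assumed: ψ extends to an additive map, and an additive map bounded near 0 is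
continuous, hence linear. -/
theorem exists_clm_of_locally_additive {ψ : E → ℝ} {B : ℝ}
    (hadd : ∀ᶠ p : E × E in 𝓝 0, ψ (p.1 + p.2) = ψ p.1 + ψ p.2) (hB : ∀ᶠ v in 𝓝 0, |ψ v| ≤ B) :
    ∃ ℓ : E →L[ℝ] ℝ, ∀ᶠ v in 𝓝 0, ψ v = ℓ v := by
  obtain ⟨r₁, hr₁, h₁⟩ := Metric.eventually_nhds_iff_ball.1 hadd
  obtain ⟨r₂, hr₂, h₂⟩ := Metric.eventually_nhds_iff_ball.1 hB
  obtain ⟨r, hr, hr1, hr2⟩ : ∃ r, 0 < r ∧ r ≤ r₁ ∧ r ≤ r₂ :=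
    ⟨min r₁ r₂, lt_min hr₁ hr₂, min_le_left _ _, min_le_right _ _⟩
  have ha : ∀ v w : E, ‖v‖ < r → ‖w‖ < r → ψ (v + w) = ψ v + ψ w := fun v w hv hw =>
    h₁ (v, w) (by
      rw [mem_ball_zero_iff, Prod.norm_def]
      exact max_lt (hv.trans_le hr1) (hw.trans_le hr1))
  have h0 : ψ 0 = 0 := by
    have := ha 0 0 (by simpa) (by simpa)
    rw [add_zero] at this
    linarith
  have hn : ∀ (k : ℕ) (v : E), k * ‖v‖ < r → ψ ((k : ℝ) • v) = k * ψ v := by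
    intro k v
    induction k with
    | zero => simp [h0]
    | succ k ih =>
      intro hk
      push_cast at hk ⊢
      have hv := norm_nonneg v
      rcases Nat.eq_zero_or_pos k with rfl | hk0
      · simp
      · have hk1 : (1 : ℝ) ≤ k := by exact_mod_cast hk0
        have a1 : (k : ℝ) * ‖v‖ < r := by nlinarith
        rw [add_smul, one_smul, ha _ _ (by rw [norm_smul]; simpa using a1) (by nlinarith), ih a1]
        ring
  have hmul : ∀ (m : ℕ), 0 < m → ∀ x : E, ‖x‖ < r → ψ x = m * ψ ((m : ℝ)⁻¹ • x) := by
    intro m hm x hx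
    have hm' : (m : ℝ) ≠ 0 := by exact_mod_cast hm.ne'
    rw [← hn m _ (by rw [norm_smul, norm_inv, Real.norm_natCast, ← mul_assoc,
      mul_inv_cancel₀ hm', one_mul]; exact hx), smul_smul, mul_inv_cancel₀ hm', one_smul]
  have hN : ∀ x : E, ∃ m : ℕ, 0 < m ∧ ‖x‖ < m * r := by
    intro x
    obtain ⟨m, hm⟩ := exists_nat_gt (‖x‖ / r)
    rw [div_lt_iff₀ hr] at hm
    refine ⟨m, ?_, hm⟩
    rcases Nat.eq_zero_or_pos m with rfl | h
    · have := norm_nonneg x; simp at hm; linarith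
    · exact h
  choose N hN0 hN using hN
  have hball : ∀ (x : E) (m : ℕ), 0 < m → ‖x‖ < m * r → ‖(m : ℝ)⁻¹ • x‖ < r := by
    intro x m hm hx
    have hm' : (0 : ℝ) < m := by exact_mod_cast hm
    rw [norm_smul, norm_inv, Real.norm_natCast, inv_mul_lt_iff₀ hm']
    exact hx
  -- The extension is m·ψ(x/m) for any m that brings x into the ball of additivity; `hmul` makes it
  -- independent of m.
  obtain ⟨T, hT⟩ : ∃ T : E → ℝ, T = fun x => N x * ψ ((N x : ℝ)⁻¹ • x) := ⟨_, rfl⟩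
  have hTm : ∀ x (m : ℕ), 0 < m → ‖x‖ < m * r → T x = m * ψ ((m : ℝ)⁻¹ • x) := by
    intro x m hm hx
    rw [hT]
    simp only
    rw [hmul m hm _ (hball x _ (hN0 x) (hN x)), hmul (N x) (hN0 x) _ (hball x m hm hx),
      smul_comm (m : ℝ)⁻¹]
    ring
  have hTψ : ∀ x, ‖x‖ < r → T x = ψ x := by
    intro x hx
    have := hTm x 1 one_pos (by simpa using hx)
    simpa using this
  have hTadd : ∀ x y, T (x + y) = T x + T y := by
    intro x y
    obtain ⟨m, hm, hmr⟩ : ∃ m : ℕ, 0 < m ∧ ‖x‖ + ‖y‖ < m * r := by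
      obtain ⟨m, hm⟩ := exists_nat_gt ((‖x‖ + ‖y‖) / r)
      refine ⟨m, ?_, (div_lt_iff₀ hr).1 hm⟩
      have : (0 : ℝ) < m := lt_of_le_of_lt (by positivity) hm
      exact_mod_cast this
    have hx : ‖x‖ < m * r := by have := norm_nonneg y; linarith
    have hy : ‖y‖ < m * r := by have := norm_nonneg x; linarith
    rw [hTm _ m hm ((norm_add_le x y).trans_lt hmr), hTm x m hm hx, hTm y m hm hy, smul_add,
      ha _ _ (hball x m hm hx) (hball y m hm hy)]
    ring
  let A : E →+ ℝ := AddMonoidHom.mk' T hTadd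
  have hA : Continuous A := by
    refine A.continuous_of_isBounded_nhds_zero (Metric.ball_mem_nhds (0 : E) hr) ?_
    refine (Metric.isBounded_closedBall (x := (0 : ℝ)) (r := B)).subset ?_
    rintro _ ⟨x, hx, rfl⟩
    rw [mem_ball_zero_iff] at hx
    rw [mem_closedBall_zero_iff, Real.norm_eq_abs]
    change |T x| ≤ B
    rw [hTψ x hx]
    exact h₂ x (by rw [mem_ball_zero_iff]; exact hx.trans_le hr2)
  refine ⟨A.toRealLinearMap hA, ?_⟩
  filter_upwards [Metric.ball_mem_nhds (0 : E) hr] with x hx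
  exact (hTψ x (mem_ball_zero_iff.1 hx)).symm

end LocallyAdditive

/-! ### Homomorphisms to ℝ and the logarithm -/

section Homomorphisms

open scoped commutatorElement

variable {E : Type*} [NormedAddCommGroup E] [NormedSpace ℝ E] [FiniteDimensional ℝ E]
  [CompleteSpace E]
  {G : Type*} [TopologicalSpace G] [ChartedSpace E G] [Group G] [LieGroup 𝓘(ℝ, E) ∞ G]
  {M : Type*} [TopologicalSpace M] [ChartedSpace E M] [IsManifold 𝓘(ℝ, E) ∞ M]
  {π : G → M} {Γ : Subgroup G}

-- π is open, so finitely many images of compact neighbourhoods cover the compact M; K is the union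
-- of these neighbourhoods.
omit [FiniteDimensional ℝ E] [CompleteSpace E] in
theorem exists_compact_fundamental_set [FiniteDimensional ℝ E] [CompactSpace M]
    (hπ : IsCosetProjection E Γ π) :
    ∃ K : Set G, IsCompact K ∧ ∀ x, ∃ γ ∈ Γ, ∃ k ∈ K, x = γ * k := by
  have : LocallyCompactSpace G := ChartedSpace.locallyCompactSpace E G
  choose a ha using hπ.surjective
  choose C hC hCa using fun x => exists_compact_mem_nhds (a x)
  have hopen := hπ.isLocalDiffeomorph.isLocalHomeomorph.isOpenMap
  obtain ⟨t, ht⟩ := CompactSpace.elim_nhds_subcover (fun x => π '' C x) fun x => by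
    have := hopen.image_mem_nhds (hCa x)
    rwa [ha] at this
  refine ⟨⋃ x ∈ t, C x, t.isCompact_biUnion fun x _ => hC x, fun x => ?_⟩
  have hx : π x ∈ ⋃ x ∈ t, π '' C x := by rw [ht]; trivial
  simp only [Set.mem_iUnion] at hx
  obtain ⟨y, hy, k, hk, hkx⟩ := hx
  obtain ⟨γ, hγ, h⟩ := (hπ.eq_iff k x).1 hkx
  exact ⟨γ, hγ, k, Set.mem_biUnion hy hk, h⟩

theorem exists_hom_near [CompactSpace M] (hπ : IsCosetProjection E Γ π)
    (hcomm : ∀ a b x : G, ⁅a, b⁆ * x = x * ⁅a, b⁆) {F : G → ℝ} (hF : Continuous F) (h1 : F 1 = 0)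
    (hΓ : ∀ γ ∈ Γ, ∀ x, F (γ * x) = F γ + F x) :
    ∃ φ : G → ℝ, (∀ x y, φ (x * y) = φ x + φ y) ∧ (∃ B, ∀ x, |F x - φ x| ≤ B) ∧
      ∀ γ ∈ Γ, φ γ = F γ := by
  have : IsTopologicalGroup G := topologicalGroup_of_lieGroup 𝓘(ℝ, E) ∞
  obtain ⟨K, hK, hKΓ⟩ := exists_compact_fundamental_set hπ
  have hb : ∀ K' : Set G, IsCompact K' → ∃ B, ∀ k ∈ K', ∀ x, |F (x * k) - F x| ≤ B := by
    intro K' hK'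
    -- F(xk) − F(x) is unchanged under x ↦ γx, so a bound on the compact K × K' holds for all x.
    obtain ⟨B, hB⟩ := (hK.prod hK').exists_bound_of_continuousOn
      (f := fun p : G × G => F (p.1 * p.2) - F p.1) (by fun_prop)
    refine ⟨B, fun k hk x => ?_⟩
    obtain ⟨γ, hγ, k', hk', rfl⟩ := hKΓ x
    rw [mul_assoc, hΓ γ hγ, hΓ γ hγ]
    have := hB (k', k) ⟨hk', hk⟩
    rwa [Real.norm_eq_abs, ← add_sub_add_left_eq_sub _ _ (F γ)] at this
  obtain ⟨C, hC⟩ := hb K hK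
  refine exists_hom_of_equivariant hcomm hKΓ h1 hΓ hC fun a => ?_
  obtain ⟨B, hB⟩ := hb {a} isCompact_singleton
  exact ⟨B, hB a rfl⟩

variable {Φ : G → E} (hΦ : ContMDiff 𝓘(ℝ, E) 𝓘(ℝ, E) ∞ Φ) (h1 : Φ 1 = 0)
  (hd : frameDeriv Φ 1 = ContinuousLinearMap.id ℝ E)
  (hmul : ∀ x y, Φ (x * y) = Φ x + Φ y + (1 / 2 : ℝ) • groupBrL E G (Φ x) (Φ y))
  (hz : ∀ u v w : E, groupBrL E G (groupBrL E G u v) w = 0)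
include hΦ h1 hd hmul hz

/-- The product formula gives Φ = 0 on all triple commutators, and Φ is injective near 1. So the
triples with trivial commutator form a clopen set containing (1, 1, 1). -/
theorem commutator_central [T2Space G] [PreconnectedSpace G] (a b x : G) :
    ⁅a, b⁆ * x = x * ⁅a, b⁆ := by
  have : IsTopologicalGroup G := topologicalGroup_of_lieGroup 𝓘(ℝ, E) ∞
  obtain ⟨s, -, hs1, -, hs⟩ := log_localInverse hΦ h1 hd
  have hself : ∀ v, groupBrL E G v v = 0 := groupBrL_self
  have hzr : ∀ u v w, groupBrL E G w (groupBrL E G u v) = 0 := fun u v w => by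
    rw [groupBrL_swap, hz, neg_zero]
  have hinv : ∀ x, Φ x⁻¹ = -Φ x := by
    intro x
    have h2 := hmul x x⁻¹
    rw [mul_inv_cancel, h1] at h2
    have h3 := congrArg (groupBrL E G (Φ x)) h2
    simp only [map_add, map_smul, hzr, hself, map_zero, zero_add, smul_zero, add_zero] at h3
    rw [← h3, smul_zero, add_zero] at h2
    exact (neg_eq_of_add_eq_zero_right h2.symm).symm
  have hcomm : ∀ a b, Φ ⁅a, b⁆ = groupBrL E G (Φ a) (Φ b) := by
    intro a b
    rw [commutatorElement_def, hmul, hmul, hmul, hinv, hinv]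
    simp only [map_add, map_smul, map_neg, hzr, hz, hself, add_apply, smul_apply, neg_apply,
      groupBrL_swap (Φ b) (Φ a), smul_zero, add_zero, zero_add, neg_zero]
    module
  have hcc : ∀ a b x, Φ ⁅⁅a, b⁆, x⁆ = 0 := fun a b x => by rw [hcomm, hcomm, hz]
  have hcont : Continuous fun p : G × G × G => ⁅⁅p.1, p.2.1⁆, p.2.2⁆ := by
    simp only [commutatorElement_def]
    fun_prop
  have hclopen : IsClopen {p : G × G × G | ⁅⁅p.1, p.2.1⁆, p.2.2⁆ = 1} := by
    refine ⟨isClosed_eq hcont continuous_const, isOpen_iff_mem_nhds.2 fun p hp => ?_⟩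
    have h2 := hcont.continuousAt (x := p)
    rw [ContinuousAt, show ⁅⁅p.1, p.2.1⁆, p.2.2⁆ = 1 from hp] at h2
    filter_upwards [h2.eventually hs] with q hq
    rw [hcc, hs1] at hq
    exact hq.symm
  have huniv := hclopen.eq_univ ⟨(1, 1, 1), by simp⟩
  have h3 : (a, b, x) ∈ {p : G × G × G | ⁅⁅p.1, p.2.1⁆, p.2.2⁆ = 1} := by rw [huniv]; trivial
  exact commutatorElement_eq_one_iff_mul_comm.1 h3

/-- φ is not assumed continuous; staying close to the continuous F bounds it near 1. In logarithmic
coordinates it is then locally linear, and G is connected. -/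
theorem hom_eq_comp_log [PreconnectedSpace G] {φ F : G → ℝ} (hφ : ∀ x y, φ (x * y) = φ x + φ y)
    (hF : Continuous F) {B : ℝ} (hB : ∀ x, |F x - φ x| ≤ B) :
    ∃ ℓ : E →L[ℝ] ℝ, (∀ u v, ℓ (groupBrL E G u v) = 0) ∧ ∀ x, φ x = ℓ (Φ x) := by
  have : IsTopologicalGroup G := topologicalGroup_of_lieGroup 𝓘(ℝ, E) ∞
  obtain ⟨s, hsc, hs0, hΦs, hsΦ⟩ := log_localInverse hΦ h1 hd
  have hφ1 : φ 1 = 0 := by have := hφ 1 1; rw [mul_one] at this; linarith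
  have hzr : ∀ u v w, groupBrL E G w (groupBrL E G u v) = 0 := fun u v w => by
    rw [groupBrL_swap, hz, neg_zero]
  have hself : ∀ v, groupBrL E G v v = 0 := groupBrL_self
  have hprod : ∀ᶠ p : E × E in 𝓝 0, φ (s (p.1 + p.2 + (1 / 2 : ℝ) • groupBrL E G p.1 p.2)) =
      φ (s p.1) + φ (s p.2) := by
    have t1 : Tendsto (fun p : E × E => p.1) (𝓝 0) (𝓝 0) := continuous_fst.tendsto' _ _ rfl
    have t2 : Tendsto (fun p : E × E => p.2) (𝓝 0) (𝓝 0) := continuous_snd.tendsto' _ _ rfl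
    have hsc' : Tendsto s (𝓝 0) (𝓝 1) := by have := hsc.tendsto; rwa [hs0] at this
    have t3 : Tendsto (fun p : E × E => s p.1 * s p.2) (𝓝 0) (𝓝 1) := by
      simpa using (hsc'.comp t1).mul (hsc'.comp t2)
    filter_upwards [t1.eventually hΦs, t2.eventually hΦs, t3.eventually hsΦ] with p e1 e2 e3
    rw [hmul, e1, e2] at e3
    rw [e3, hφ]
  have hcomm : ∀ᶠ p : E × E in 𝓝 0,
      φ (s (p.1 + p.2)) = φ (s p.1) + φ (s p.2) ∧ φ (s ((1 / 2 : ℝ) • groupBrL E G p.1 p.2)) = 0 := by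
    have hc : Continuous fun p : E × E => (1 / 2 : ℝ) • groupBrL E G p.1 p.2 := by fun_prop
    have t1 : Tendsto (fun p : E × E => (p.2, p.1)) (𝓝 0) (𝓝 0) :=
      continuous_swap.tendsto' _ _ rfl
    have t2 : Tendsto (fun p : E × E => (p.1 + p.2, (1 / 2 : ℝ) • groupBrL E G p.1 p.2))
        (𝓝 0) (𝓝 0) := ((continuous_fst.add continuous_snd).prodMk hc).tendsto' _ _ (by simp)
    have t3 : Tendsto (fun p : E × E => (p.1 + p.2, -((1 / 2 : ℝ) • groupBrL E G p.1 p.2)))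
        (𝓝 0) (𝓝 0) := ((continuous_fst.add continuous_snd).prodMk hc.neg).tendsto' _ _ (by simp)
    have t4 : Tendsto (fun p : E × E => ((1 / 2 : ℝ) • groupBrL E G p.1 p.2,
        -((1 / 2 : ℝ) • groupBrL E G p.1 p.2)))
        (𝓝 0) (𝓝 0) := (hc.prodMk hc.neg).tendsto' _ _ (by simp)
    -- Write ψ = φ ∘ s and b = ½[u, v], which is central. Comparing ψ(u + v + b) = ψ(u) + ψ(v) = ψ(u
    -- + v − b) and splitting off the odd contribution of ±b gives ψ(b) = 0 and additivity.
    filter_upwards [hprod, t1.eventually hprod, t2.eventually hprod, t3.eventually hprod,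
      t4.eventually hprod] with p e1 e2 e3 e4 e5
    simp only [map_smul, map_neg, hzr, hself, smul_zero, neg_zero, add_zero, add_neg_cancel, hs0,
      hφ1, smul_apply] at e3 e4 e5
    rw [groupBrL_swap, smul_neg, add_comm p.2 p.1] at e2
    have e1' := e3.symm.trans e1
    have e2' := e4.symm.trans e2
    constructor <;> linarith
  obtain ⟨ℓ, hℓ⟩ := exists_clm_of_locally_additive (ψ := φ ∘ s) (B := |F 1| + 1 + B)
    (hcomm.mono fun p hp => hp.1) (by
      have h2 : Tendsto (fun v => |F (s v)|) (𝓝 0) (𝓝 |F 1|) := by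
        have := (hF.continuousAt.comp hsc).abs.tendsto
        simpa [hs0] using this
      filter_upwards [h2.eventually (gt_mem_nhds (lt_add_one |F 1|))] with v hv
      have h3 := hB (s v)
      have h4 := abs_sub_abs_le_abs_sub (φ (s v)) (F (s v))
      rw [abs_sub_comm] at h4
      simp only [Function.comp_apply]
      linarith)
  have hℓb : ∀ u v, ℓ (groupBrL E G u v) = 0 := by
    intro u v
    have hc : Continuous fun p : E × E => (1 / 2 : ℝ) • groupBrL E G p.1 p.2 := by fun_prop
    have t1 : Tendsto (fun p : E × E => (1 / 2 : ℝ) • groupBrL E G p.1 p.2) (𝓝 0) (𝓝 0) :=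
      hc.tendsto' _ _ (by simp)
    -- Scaling u and v by a small t > 0 brings them where both local identities hold; the bracket
    -- scales by t².
    have t2 : Tendsto (fun t : ℝ => (t • u, t • v)) (𝓝[>] 0) (𝓝 0) :=
      (((continuous_id.smul continuous_const).prodMk
        (continuous_id.smul continuous_const)).tendsto' _ _ (by simp)).mono_left nhdsWithin_le_nhds
    obtain ⟨t, ⟨e1, e2⟩, ht⟩ := ((t2.eventually ((t1.eventually hℓ).and hcomm)).and
      self_mem_nhdsWithin).exists
    simp only [Function.comp_apply] at e1
    rw [e2.2] at e1
    simp only [map_smul, smul_apply, smul_eq_mul] at e1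
    have ht' : t ≠ 0 := (show (0 : ℝ) < t from ht).ne'
    have := e1.symm
    simp only [mul_eq_zero, ht', false_or] at this
    rcases this with h | h
    · norm_num at h
    · exact h
  refine ⟨ℓ, hℓb, ?_⟩
  have hℓmul : ∀ x y, ℓ (Φ (x * y)) = ℓ (Φ x) + ℓ (Φ y) := fun x y => by
    rw [hmul, map_add, map_add, map_smul, hℓb, smul_zero, add_zero]
  -- The agreement set is a subgroup that is a neighbourhood of 1, hence open and closed.
  let H : Subgroup G :=
    { carrier := {x | φ x = ℓ (Φ x)}
      mul_mem' := fun {x y} hx hy => by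
        change φ _ = ℓ _
        rw [hφ, hℓmul, show φ x = _ from hx, show φ y = _ from hy]
      one_mem' := by
        change φ 1 = ℓ (Φ 1)
        rw [hφ1, h1, map_zero]
      inv_mem' := fun {x} hx => by
        change φ _ = ℓ _
        have e1 := hφ x x⁻¹
        have e2 := hℓmul x x⁻¹
        have e3 : φ x = ℓ (Φ x) := hx
        rw [mul_inv_cancel, hφ1] at e1
        rw [mul_inv_cancel, h1, map_zero] at e2
        linarith }
  have hH : IsOpen (H : Set G) := by
    refine Subgroup.isOpen_of_mem_nhds H (g := 1) ?_
    have t : Tendsto Φ (𝓝 1) (𝓝 0) := by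
      have := hΦ.continuous.tendsto 1
      rwa [h1] at this
    filter_upwards [hsΦ, t.eventually hℓ] with y e1 e2
    change φ y = ℓ (Φ y)
    simp only [Function.comp_apply] at e2
    rw [← e2, e1]
  have huniv := (show IsClopen (H : Set G) from ⟨H.isClosed_of_isOpen hH, hH⟩).eq_univ ⟨1, H.one_mem⟩
  intro x
  have : x ∈ (H : Set G) := by rw [huniv]; trivial
  exact this

end Homomorphisms

/-! ### The first Betti number of the quotient -/

section Betti

variable {E : Type*} [NormedAddCommGroup E] [NormedSpace ℝ E] [FiniteDimensional ℝ E]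
  [CompleteSpace E]
  {G : Type*} [TopologicalSpace G] [ChartedSpace E G] [Group G] [LieGroup 𝓘(ℝ, E) ∞ G]
  {M : Type*} [TopologicalSpace M] [ChartedSpace E M] [IsManifold 𝓘(ℝ, E) ∞ M]
  {π : G → M} {Γ : Subgroup G} (hπ : IsCosetProjection E Γ π)

/-- The invariant 1-form on `M` induced by a linear form on the Lie algebra of `G`. -/
def inducedOneForm : (E →ₗ[ℝ] ℝ) →ₗ[ℝ] FormField E M 1 where
  toFun α x := ContinuousAlternatingMap.ofSubsingleton ℝ E ℝ (0 : Fin 1)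
    (LinearMap.toContinuousLinearMap (α ∘ₗ (pushAt hπ x).symm.toLinearMap))
  map_add' _ _ := rfl
  map_smul' _ _ := rfl

theorem inducedOneForm_lin (α : E →ₗ[ℝ] ℝ) (x : M) (v : E) :
    (inducedOneForm hπ α).lin x (pushAt hπ x v) = α v :=
  congrArg α ((pushAt hπ x).symm_apply_apply v)

theorem inducedOneForm_lin_pushMap (α : E →ₗ[ℝ] ℝ) (a : G) (v : E) :
    (inducedOneForm hπ α).lin (π a) (pushMap π a v) = α v := by
  rw [← pushAt_apply hπ, inducedOneForm_lin]

theorem isInvariantForm_inducedOneForm (α : E →ₗ[ℝ] ℝ) :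
    IsInvariantForm π (inducedOneForm hπ α) fun v => α (v 0) := by
  intro a v
  rw [FormField.lin_apply]
  exact inducedOneForm_lin_pushMap hπ α a (v 0)

theorem inducedOneForm_mem_closedOneForms {α : E →ₗ[ℝ] ℝ} (hα : ∀ u v, α (groupBr E G u v) = 0) :
    inducedOneForm hπ α ∈ closedOneForms E M := by
  have h := isInvariantForm_inducedOneForm hπ α
  refine ⟨h.smooth hπ.isLocalDiffeomorph hπ.surjective, ?_⟩
  refine isInvariantForm_unique hπ.isLocalDiffeomorph hπ.surjective
    (h.d hπ.isLocalDiffeomorph) fun a v => ?_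
  have e : Finset.Ici (0 : Fin 1) = {0} := by decide
  rw [Fin.sum_univ_one, e, Finset.sum_singleton]
  simp only [Matrix.cons_val_zero, hα, mul_zero, neg_zero]
  rfl

-- A primitive on a compact manifold attains its maximum, and its derivative vanishes there.
omit [FiniteDimensional ℝ E] [CompleteSpace E] in
theorem exists_lin_eq_zero_of_exact [FiniteDimensional ℝ E] [CompactSpace M] [Nonempty M] {σ : FormField E M 1}
    (hσ : σ ∈ exactOneForms E M) : ∃ x, ∀ v, σ.lin x v = 0 := by
  obtain ⟨f, hf, h⟩ := hσ
  obtain ⟨x, -, hx⟩ := isCompact_univ.exists_isMaxOn Set.univ_nonempty hf.continuous.continuousOn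
  have hmax : IsLocalMax (f ∘ (extChartAt 𝓘(ℝ, E) x).symm) (extChartAt 𝓘(ℝ, E) x x) := by
    refine Eventually.of_forall fun y => ?_
    simp only [Function.comp_apply, extChartAt_to_inv]
    exact hx (Set.mem_univ _)
  have h1 := hmax.fderiv_eq_zero
  rw [(hasFDerivAt_comp_extChartAt_symm (mem_extChartAt_target x)
    ((hf _).mdifferentiableAt (by simp))).fderiv] at h1
  refine ⟨x, fun v => ?_⟩
  rw [← inChart_extChartAt σ (mem_extChartAt_source x) v]
  refine (h _ _).trans ?_
  exact congrArg (fun A : E →L[ℝ] ℝ => A (mfderiv 𝓘(ℝ, E) 𝓘(ℝ, E) (extChartAt 𝓘(ℝ, E) x) x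
    (show TangentSpace 𝓘(ℝ, E) x from v))) h1

/-- The form vanishes at some point, and invariance determines α from its value at any one point. -/
theorem inducedOneForm_injective [CompactSpace M] {α : E →ₗ[ℝ] ℝ}
    (hα : inducedOneForm hπ α ∈ exactOneForms E M) : α = 0 := by
  have : Nonempty M := ⟨π 1⟩
  obtain ⟨x, hx⟩ := exists_lin_eq_zero_of_exact hα
  ext v
  rw [← inducedOneForm_lin hπ α x, hx]
  rfl

include hπ in
/-- A differentiable function on `G` invariant under `Γ` descends to `M`. -/
theorem exists_descent {h : G → ℝ} (hh : ∀ a, MDifferentiableAt 𝓘(ℝ, E) 𝓘(ℝ, ℝ) h a)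
    (hΓ : ∀ γ ∈ Γ, ∀ x, h (γ * x) = h x) :
    ∃ f : M → ℝ, (∀ x, MDifferentiableAt 𝓘(ℝ, E) 𝓘(ℝ, ℝ) f x) ∧ ∀ (a : G) (v : E),
      (show E →L[ℝ] ℝ from mfderiv 𝓘(ℝ, E) 𝓘(ℝ, ℝ) f (π a)) (pushMap π a v) =
        frameDeriv h a v := by
  have hfπ : ∀ a, h (Function.surjInv hπ.surjective (π a)) = h a := by
    intro a
    obtain ⟨γ, hγ, e⟩ := (hπ.eq_iff a _).1 (Function.surjInv_eq hπ.surjective (π a)).symm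
    rw [e, hΓ γ hγ]
  obtain ⟨f, hf⟩ : ∃ f : M → ℝ, f ∘ π = h := ⟨fun x => h (Function.surjInv hπ.surjective x),
    funext hfπ⟩
  have hfd : ∀ x, MDifferentiableAt 𝓘(ℝ, E) 𝓘(ℝ, ℝ) f x := by
    intro x
    obtain ⟨a, rfl⟩ := hπ.surjective x
    have hd := hπ.isLocalDiffeomorph a
    have h1 : MDifferentiableAt 𝓘(ℝ, E) 𝓘(ℝ, ℝ) (h ∘ hd.localInverse) (π a) :=
      (hh _).comp _ (hd.localInverse_contMDiffAt.mdifferentiableAt (by simp))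
    refine h1.congr_of_eventuallyEq ?_
    filter_upwards [hd.localInverse_eventuallyEq_right] with y hy
    rw [← hf]
    exact congrArg f hy.symm
  refine ⟨f, hfd, fun a v => ?_⟩
  have h2 := mfderiv_comp a (hfd (π a)) ((hπ.isLocalDiffeomorph a).mdifferentiableAt (by simp))
  rw [hf] at h2
  unfold frameDeriv
  rw [h2]
  rfl

variable [T2Space G] [SimplyConnectedSpace G] [CompactSpace M]

/-- The periods F(γ) of the primitive F on G extend to a homomorphism φ = ℓ ∘ Φ of G; subtracting
the invariant form ℓ cancels them. -/
theorem exists_inducedOneForm_cohomologous (hz : ∀ u v w : E, groupBrL E G (groupBrL E G u v) w = 0)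
    {σ : FormField E M 1} (hσ : σ ∈ closedOneForms E M) :
    ∃ α : E →ₗ[ℝ] ℝ, (∀ u v, α (groupBr E G u v) = 0) ∧
      σ - inducedOneForm hπ α ∈ exactOneForms E M := by
  obtain ⟨Φ, hΦ, hΦ1, hΦd⟩ := exists_log hz
  have hmul := log_mul hz hΦ hΦ1 hΦd
  have hΦd1 : frameDeriv Φ 1 = ContinuousLinearMap.id ℝ E := by
    ext v
    rw [hΦd, hΦ1]
    simp
  obtain ⟨F₀, hF₀, hF₀d⟩ := closedOneForms_le_exactOneForms
    (pullback_mem_closedOneForms hπ.isLocalDiffeomorph.contMDiff hσ)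
  obtain ⟨F, hFdef⟩ : ∃ F : G → ℝ, F = fun x => -F₀ 1 + F₀ x := ⟨_, rfl⟩
  have hF : ContMDiff 𝓘(ℝ, E) 𝓘(ℝ, ℝ) ∞ F := hFdef ▸ contMDiff_const.add hF₀
  have hFm : ∀ a, MDifferentiableAt 𝓘(ℝ, E) 𝓘(ℝ, ℝ) F a := fun a =>
    (hF a).mdifferentiableAt (by simp)
  have hFd : ∀ a v, frameDeriv F a v = σ.lin (π a) (pushMap π a v) := by
    intro a v
    rw [hFdef, frameDeriv_const_add ((hF₀ a).mdifferentiableAt (by simp))]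
    exact (hF₀d a fun _ => (show TangentSpace 𝓘(ℝ, E) a from frameMap (E := E) a v)).symm
  have hF1 : F 1 = 0 := by rw [hFdef]; simp
  have hΓ : ∀ γ ∈ Γ, ∀ x, F (γ * x) = F γ + F x := by
    intro γ hγ x
    have hm : ∀ a, MDifferentiableAt 𝓘(ℝ, E) 𝓘(ℝ, ℝ) (fun y => F (γ * y)) a := fun a =>
      ((hF.comp (contMDiff_mul_left (n := ∞) (a := γ))) a).mdifferentiableAt (by simp)
    -- dF is pulled back from M, so it is unchanged by left translation by γ, and this difference is
    -- constant.
    have h1 := eq_of_frameDeriv_eq_zero (E := E) (f := fun y => F (γ * y) - F y)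
      (fun a => (hm a).sub (hFm a)) (fun a => by
        rw [frameDeriv_sub (hm a) (hFm a), frameDeriv_mul_left hFm]
        ext v
        have e : π a = π (γ * a) := (hπ.eq_iff a (γ * a)).2 ⟨γ, hγ, rfl⟩
        have e2 : pushMap π a v = pushMap π (γ * a) v := pushInvariant_of_eq hπ e v
        rw [sub_apply, hFd, hFd, ← e, ← e2, sub_self]
        rfl) x 1
    simp only [mul_one, hF1, sub_zero] at h1
    linarith
  obtain ⟨φ, hφ, ⟨B, hB⟩, hφΓ⟩ := exists_hom_near hπ
    (commutator_central hΦ hΦ1 hΦd1 hmul hz) hF.continuous hF1 hΓ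
  obtain ⟨ℓ, hℓ, hℓΦ⟩ := hom_eq_comp_log hΦ hΦ1 hΦd1 hmul hz hφ hF.continuous hB
  have hℓm : ∀ a, MDifferentiableAt 𝓘(ℝ, E) 𝓘(ℝ, ℝ) (fun x => ℓ (Φ x)) a := fun a =>
    ((ℓ.contMDiff.comp hΦ) a).mdifferentiableAt (n := ∞) (by simp)
  -- Both terms change by F(γ) under left translation by γ ∈ Γ, as φ = F on Γ. Since ℓ kills
  -- brackets, ℓ ∘ Φ has constant derivative ℓ along the invariant frame.
  obtain ⟨f, hf, hfd⟩ := exists_descent hπ (h := fun x => F x - ℓ (Φ x))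
    (fun a => (hFm a).sub (hℓm a)) (fun γ hγ x => by
      rw [hΓ γ hγ, ← hℓΦ, ← hℓΦ, hφ, hφΓ γ hγ]; ring)
  refine ⟨ℓ, hℓ, ?_⟩
  have hcl := Submodule.sub_mem _ hσ (inducedOneForm_mem_closedOneForms hπ (α := ℓ) hℓ)
  have h3 : ∀ x (v : Fin 1 → TangentSpace 𝓘(ℝ, E) x), (σ - inducedOneForm hπ (ℓ : E →ₗ[ℝ] ℝ)) x v =
      mfderiv 𝓘(ℝ, E) 𝓘(ℝ, ℝ) f x (v 0) := by
    intro x v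
    obtain ⟨a, rfl⟩ := hπ.surjective x
    rw [FormField.lin_apply]
    obtain ⟨w, hw⟩ : ∃ w : E, pushMap (E := E) π a w = (show E from v 0) :=
      (pushMap_bijective hπ.isLocalDiffeomorph a).2 (v 0)
    change _ = (show E →L[ℝ] ℝ from mfderiv 𝓘(ℝ, E) 𝓘(ℝ, ℝ) f (π a)) (show E from v 0)
    refine (congrArg ((σ - inducedOneForm hπ (ℓ : E →ₗ[ℝ] ℝ)).lin (π a)) hw).symm.trans ?_
    rw [← hw]
    refine Eq.trans ?_ (hfd a w).symm
    rw [frameDeriv_sub (hFm a) (hℓm a),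
      frameDeriv_clm_comp ((hΦ a).mdifferentiableAt (by simp)),
      sub_apply (frameDeriv F a), hFd,
      ContinuousLinearMap.comp_apply, hΦd, map_add, map_smul, hℓ, smul_zero, add_zero]
    exact congrArg (σ.lin (π a) (pushMap π a w) - ·) (inducedOneForm_lin_pushMap hπ ℓ a w)
  exact ⟨f, hcl.1.contMDiff_of_mfderiv hf h3, h3⟩

include hπ in
/-- The first Betti number of a compact quotient of a simply connected 2-step nilpotent Lie group
is that of the Lie algebra. -/
theorem lieBettiOne_eq_bettiOne
    (hz : ∀ u v w : GroupLieAlgebra 𝓘(ℝ, E) G, ⁅u, ⁅v, w⁆⁆ = 0) :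
    (lieBettiOne (GroupLieAlgebra 𝓘(ℝ, E) G) : Cardinal) = bettiOne E M := by
  have hz' : ∀ u v w : E, groupBrL E G (groupBrL E G u v) w = 0 := fun u v w => by
    rw [groupBrL_swap]
    exact neg_eq_zero.2 (hz w u v)
  have : FiniteDimensional ℝ (GroupLieAlgebra 𝓘(ℝ, E) G) :=
    inferInstanceAs (FiniteDimensional ℝ E)
  let Λ : lieClosedOneForms (GroupLieAlgebra 𝓘(ℝ, E) G) →ₗ[ℝ] FormField E M 1 ⧸ exactOneForms E M :=
    (exactOneForms E M).mkQ ∘ₗ inducedOneForm hπ ∘ₗ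
      (lieClosedOneForms (GroupLieAlgebra 𝓘(ℝ, E) G)).subtype
  have hinj : Function.Injective Λ := by
    intro α β h
    have h1 : inducedOneForm hπ (show E →ₗ[ℝ] ℝ from α.1) -
        inducedOneForm hπ (show E →ₗ[ℝ] ℝ from β.1) ∈ exactOneForms E M :=
      (Submodule.Quotient.eq _).1 h
    rw [← map_sub] at h1
    exact Subtype.ext (sub_eq_zero.1 (inducedOneForm_injective hπ h1))
  have hrange : LinearMap.range Λ = (closedOneForms E M).map (exactOneForms E M).mkQ := by
    apply le_antisymm
    · rintro _ ⟨α, rfl⟩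
      exact ⟨_, inducedOneForm_mem_closedOneForms hπ (α := (show E →ₗ[ℝ] ℝ from α.1)) α.2, rfl⟩
    · rintro _ ⟨σ, hσ, rfl⟩
      obtain ⟨α, hα, h⟩ := exists_inducedOneForm_cohomologous hπ hz' hσ
      refine ⟨⟨α, hα⟩, ?_⟩
      exact ((Submodule.Quotient.eq _).2 h).symm
  have h1 := (LinearEquiv.ofInjective Λ hinj).lift_rank_eq
  rw [hrange, ← Module.finrank_eq_rank, Cardinal.lift_natCast] at h1
  have h2 := h1.symm
  rw [Cardinal.lift_eq_nat_iff] at h2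
  exact h2.symm

end Betti

/-! ### The main theorem -/

theorem mainTheorem2
    {G : Type*} [TopologicalSpace G] [T2Space G] [SecondCountableTopology G]
    [ChartedSpace (EuclideanSpace ℝ (Fin 6)) G] [Group G] [LieGroup (𝓡 6) ∞ G]
    [SimplyConnectedSpace G] [LieRing.IsNilpotent (GroupLieAlgebra (𝓡 6) G)]
    (Γ : Subgroup G) [DiscreteTopology Γ]
    {M : Type*} [TopologicalSpace M] [T2Space M] [CompactSpace M]
    [ChartedSpace (EuclideanSpace ℝ (Fin 6)) M] [IsManifold (𝓡 6) ∞ M]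
    (π : G → M) (hπ : IsCosetProjection (EuclideanSpace ℝ (Fin 6)) Γ π) :
    (AdmitsInvariantSKT (EuclideanSpace ℝ (Fin 6)) π ↔
      IsOneOfFour (GroupLieAlgebra (𝓡 6) G)) ∧
    (AdmitsInvariantSKT (EuclideanSpace ℝ (Fin 6)) π →
      IsTwoStep (GroupLieAlgebra (𝓡 6) G) ∧
      (lieBettiOne (GroupLieAlgebra (𝓡 6) G) : Cardinal) =
        bettiOne (EuclideanSpace ℝ (Fin 6)) M ∧
      4 ≤ lieBettiOne (GroupLieAlgebra (𝓡 6) G)) := by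
  have : FiniteDimensional ℝ (GroupLieAlgebra (𝓡 6) G) :=
    inferInstanceAs (FiniteDimensional ℝ (EuclideanSpace ℝ (Fin 6)))
  have hdim : Module.finrank ℝ (GroupLieAlgebra (𝓡 6) G) = 6 :=
    (finrank_euclideanSpace_fin (𝕜 := ℝ) (n := 6))
  have key : AdmitsInvariantSKT (EuclideanSpace ℝ (Fin 6)) π →
      IsOneOfFour (GroupLieAlgebra (𝓡 6) G) := by
    intro hA
    obtain ⟨J, g, h⟩ := exists_isLieSKT_of_admits hπ hA
    exact h.isOneOfFour hdim
  refine ⟨⟨key, fun h => ?_⟩, fun h => ⟨(key h).isTwoStep, ?_, (key h).four_le_lieBettiOne⟩⟩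
  · obtain ⟨J, g, h⟩ := h.exists_isLieSKT
    exact admits_of_isLieSKT hπ h
  · exact lieBettiOne_eq_bettiOne hπ (lowerCentralSeries_two_eq_bot_iff.1 (key h).isTwoStep.1)


end
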